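/- Let $n\ge 1$, let $(\mathcal C,\Sigma,\Theta)$ be a Krull–Schmidt $(n+2)$-angulated category in the sense of Geiss–Keller–Oppermann, with $\Sigma$ an auto-equivalence (Krull–Schmidt: every object is a finite direct sum of indecomposable objects with local endomorphism rings), and let $\mathcal A\subseteq\mathcal C$ be a full subcategory that is closed under isomorphisms, finite direct sums (so it contains $0$) and direct summands, and that is $n$-extension closed: every morphism $f\colon C\to\Sigma A$ with $A,C\in\mathcal A$ is the last morphism of some $(n+2)$-angle $A\to X_1\to\cdots\to X_n\to C\xrightarrow{f}\Sigma A$ in $\Theta$ with $X_1,\dots,X_n\in\mathcal A$. Let $\widetilde{\mathcal C}$ and $\widetilde{\mathcal A}$ be the idempotent completions: their objects are the pairs $(X,e)$ with $e\colon X\to X$ an idempotent, and a morphism $(X,e)\to(Y,e')$ is a morphism $p\colon X\to Y$ with $pe=e'p=p$. View $\widetilde{\mathcal A}$ as a full subcategory of $\widetilde{\mathcal C}$, put $\widetilde\Sigma(X,e)=(\Sigma X,\Sigma e)$, and let $\widetilde\Theta$ be the class of $(n+2)$-$\widetilde\Sigma$-sequences in $\widetilde{\mathcal C}$ that are direct summands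 of sequences in $\Theta$ (viewed in $\widetilde{\mathcal C}$ through $X\mapsto(X,1)$). Then $\widetilde{\mathcal A}$ carries the following $n$-exangulated structure (in the sense of Herschend–Liu–Nakaoka). Let $\mathbb E_{\widetilde{\mathcal A}}\colon\widetilde{\mathcal A}^{\mathrm{op}}\times\widetilde{\mathcal A}\to\mathrm{Ab}$ be the bifunctor $\mathbb E_{\widetilde{\mathcal A}}(C,A)=\widetilde{\mathcal C}(C,\widetilde\Sigma A)$. 1. For all $A,C\in\widetilde{\mathcal A}$ and every $\delta\in\mathbb E_{\widetilde{\mathcal A}}(C,A)$ there is a complex $A\to X_1\to\cdots\to X_n\to C$ with all $X_i\in\widetilde{\mathcal A}$ such that $A\to X_1\to\cdots\to X_n\to C\xrightarrow{\delta}\widetilde\Sigma A$ belongs to $\widetilde\Theta$. 2. The homotopy equivalence class $\mathfrak s_{\widetilde{\mathcal A}}(\delta)=[A\to X_1\to\cdots\to X_n\to C]$ (homotopy equivalences being taken among complexes in $\widetilde{\mathcal A}$, through morphisms that are the identity on $A$ and on $C$) does not depend on the choice of such a complex. 3. $(\widetilde{\mathcal A},\mathbb E_{\widetilde{\mathcal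 A}},\mathfrak s_{\widetilde{\mathcal A}})$ is an $n$-exangulated category: $\widetilde{\mathcal A}$ is additive, $\mathbb E_{\widetilde{\mathcal A}}$ is an additive bifunctor, $\mathfrak s_{\widetilde{\mathcal A}}$ is an exact realization of it, and the axioms (EA1), (EA2) and (EA2$^{\mathrm{op}}$) hold. -/

import Mathlib

open CategoryTheory CategoryTheory.Limits CategoryTheory.ComposableArrows
  CategoryTheory.Idempotents Opposite

universe w v v' u u'

noncomputable section

namespace HigherAngulated

attribute [local instance] hasBinaryBiproducts_of_finite_biproducts

/-! ### `(n+2)`-`Σ`-sequences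

The suspension functor is written `S`. A row of `n + 2` objects `A₀ ⟶ A₁ ⟶ ⋯ ⟶ Aₙ₊₁` is a term
`A : ComposableArrows 𝒞 (n + 1)`; its objects are `A.obj' i` for `i ≤ n + 1`, its arrows
are `A.map' i (i + 1)`, and the components of a morphism `φ` of rows are `app' φ i`. -/

/-- An `(n+2)`-`S`-sequence `A₀ ⟶ A₁ ⟶ ⋯ ⟶ Aₙ₊₁ ⟶ S A₀`. -/
structure SigmaSeq {𝒞 : Type u} [Category.{v} 𝒞] (S : 𝒞 ⥤ 𝒞) (n : ℕ) where
  /-- the row `A₀ ⟶ A₁ ⟶ ⋯ ⟶ Aₙ₊₁` -/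
  seq : ComposableArrows 𝒞 (n + 1)
  /-- the arrow `Aₙ₊₁ ⟶ S A₀` -/
  last : seq.obj' (n + 1) ⟶ S.obj (seq.obj' 0)

namespace SigmaSeq

section Basic

variable {𝒞 : Type u} [Category.{v} 𝒞] {S : 𝒞 ⥤ 𝒞} {n : ℕ}

/-- A morphism `(φ₀, …, φₙ₊₁)` of `(n+2)`-`S`-sequences. -/
@[ext]
structure Hom (A B : SigmaSeq S n) where
  /-- the components `φ₀, …, φₙ₊₁`, commuting with the arrows of the rows -/
  φ : A.seq ⟶ B.seq
  /-- the last square commutes -/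
  comm : A.last ≫ S.map (app' φ 0) = app' φ (n + 1) ≫ B.last

instance : Category (SigmaSeq S n) where
  Hom := Hom
  id A := ⟨𝟙 A.seq, by
    change A.last ≫ S.map (𝟙 _) = 𝟙 _ ≫ A.last
    rw [S.map_id, Category.comp_id, Category.id_comp]⟩
  comp {A B C} f g := ⟨f.φ ≫ g.φ, by
    have hf := f.comm
    have hg := g.comm
    simp only [app', NatTrans.comp_app, Functor.map_comp, Category.assoc] at hf hg ⊢
    rw [← hg, ← Category.assoc, hf, Category.assoc]⟩
  id_comp f := Hom.ext (Category.id_comp f.φ)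
  comp_id f := Hom.ext (Category.comp_id f.φ)
  assoc f g h := Hom.ext (Category.assoc f.φ g.φ h.φ)

/-- `T` is the trivial sequence `A ⟶ A ⟶ 0 ⟶ ⋯ ⟶ 0 ⟶ S A` on some object `A`, up to isomorphism
of sequences: the first arrow is an isomorphism and the objects `T₂, …, Tₙ₊₁` are zero
(so that all the other arrows are zero when `1 ≤ n`). -/
structure IsTrivial (T : SigmaSeq S n) : Prop where
  isIso : IsIso (T.seq.map' 0 1)
  isZero : ∀ (i : ℕ) (hi : i ≤ n + 1), 2 ≤ i → IsZero (T.seq.obj' i)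

end Basic

section Preadditive

variable {𝒞 : Type u} [Category.{v} 𝒞] [Preadditive 𝒞] {S : 𝒞 ⥤ 𝒞} {n : ℕ}

/-- `T` is a direct sum of the sequences `A` and `B`. -/
def IsDirectSum (A B T : SigmaSeq S n) : Prop :=
  ∃ (i₁ : A ⟶ T) (i₂ : B ⟶ T) (p₁ : T ⟶ A) (p₂ : T ⟶ B),
    i₁ ≫ p₁ = 𝟙 A ∧ i₂ ≫ p₂ = 𝟙 B ∧ i₁.φ ≫ p₂.φ = 0 ∧ i₂.φ ≫ p₁.φ = 0 ∧
      p₁.φ ≫ i₁.φ + p₂.φ ≫ i₂.φ = 𝟙 T.seq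

/-- An identification of `R` with the left rotation
`A₁ ⟶ A₂ ⟶ ⋯ ⟶ Aₙ₊₁ ⟶ S A₀ ⟶ S A₁` of `A`, the last arrow being `(-1)ⁿ S f₀`
(an isomorphism of sequences from `R` to it). -/
structure LeftRotation (A R : SigmaSeq S n) where
  /-- `Rᵢ ≅ Aᵢ₊₁` for `i ≤ n` -/
  e : ∀ (i : ℕ) (hi : i ≤ n), R.seq.obj' i ≅ A.seq.obj' (i + 1)
  /-- `Rₙ₊₁ ≅ S A₀` -/
  eLast : R.seq.obj' (n + 1) ≅ S.obj (A.seq.obj' 0)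
  comm : ∀ (i : ℕ) (hi : i < n),
    R.seq.map' i (i + 1) ≫ (e (i + 1) hi).hom =
      (e i hi.le).hom ≫ A.seq.map' (i + 1) (i + 2)
  comm_n : R.seq.map' n (n + 1) ≫ eLast.hom = (e n le_rfl).hom ≫ A.last
  comm_last : R.last ≫ S.map (e 0 (Nat.zero_le n)).hom =
    eLast.hom ≫ ((-1 : ℤ) ^ n • S.map (A.seq.map' 0 1))

/-- An identification of `M` with the mapping cone of `φ : A ⟶ B`, that is, with
`A₁ ⊞ B₀ ⟶ A₂ ⊞ B₁ ⟶ ⋯ ⟶ S A₀ ⊞ Bₙ₊₁ ⟶ S A₁ ⊞ S B₀`, the arrows being the matrices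
`(-fᵢ₊₁, 0; φᵢ₊₁, gᵢ)`, for `i = n + 1` the matrix `(-S f₀, 0; S φ₀, gₙ₊₁)`.
(`Biprod.ofComponents a b c d` sends `(x, y)` to `(a x + c y, b x + d y)`.) -/
structure MappingCone [HasFiniteBiproducts 𝒞] {A B : SigmaSeq S n} (φ : A ⟶ B)
    (M : SigmaSeq S n) where
  /-- `Mᵢ ≅ Aᵢ₊₁ ⊞ Bᵢ` for `i ≤ n` -/
  e : ∀ (i : ℕ) (hi : i ≤ n), M.seq.obj' i ≅ A.seq.obj' (i + 1) ⊞ B.seq.obj' i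
  /-- `Mₙ₊₁ ≅ S A₀ ⊞ Bₙ₊₁` -/
  eLast : M.seq.obj' (n + 1) ≅ S.obj (A.seq.obj' 0) ⊞ B.seq.obj' (n + 1)
  comm : ∀ (i : ℕ) (hi : i < n),
    M.seq.map' i (i + 1) ≫ (e (i + 1) hi).hom =
      (e i hi.le).hom ≫ Biprod.ofComponents (-A.seq.map' (i + 1) (i + 2))
        (app' φ.φ (i + 1)) 0 (B.seq.map' i (i + 1))
  comm_n : M.seq.map' n (n + 1) ≫ eLast.hom =
    (e n le_rfl).hom ≫ Biprod.ofComponents (-A.last) (app' φ.φ (n + 1)) 0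
      (B.seq.map' n (n + 1))
  /-- the component of the last arrow in `S A₁` -/
  comm_last_fst :
    M.last ≫ S.map ((e 0 (Nat.zero_le n)).hom ≫ biprod.fst) =
      eLast.hom ≫ biprod.desc (-S.map (A.seq.map' 0 1)) 0
  /-- the component of the last arrow in `S B₀` -/
  comm_last_snd :
    M.last ≫ S.map ((e 0 (Nat.zero_le n)).hom ≫ biprod.snd) =
      eLast.hom ≫ biprod.desc (S.map (app' φ.φ 0)) B.last

end Preadditive

end SigmaSeq

/-! ### `(n+2)`-angulated categories -/

section Angulated

variable {𝒞 : Type u} [Category.{v} 𝒞] [Preadditive 𝒞]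

/-- `(𝒞, S, Θ)` is an `(n+2)`-angulated category (`𝒞` additive, `1 ≤ n`). -/
structure IsAngulated [HasFiniteBiproducts 𝒞] (S : 𝒞 ⥤ 𝒞) (n : ℕ) (Θ : Set (SigmaSeq S n)) :
    Prop where
  /-- the suspension is an auto-equivalence -/
  isEquivalence : S.IsEquivalence
  /-- (N1)(a), isomorphisms -/
  mem_of_iso : ∀ A B : SigmaSeq S n, Nonempty (A ≅ B) → A ∈ Θ → B ∈ Θ
  /-- (N1)(a), direct sums -/
  sum_mem : ∀ A B T : SigmaSeq S n, SigmaSeq.IsDirectSum A B T → A ∈ Θ → B ∈ Θ → T ∈ Θ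
  /-- (N1)(a), direct summands -/
  summand_mem : ∀ A B T : SigmaSeq S n, SigmaSeq.IsDirectSum A B T → T ∈ Θ → A ∈ Θ
  /-- (N1)(b) -/
  trivial_mem : ∀ T : SigmaSeq S n, T.IsTrivial → T ∈ Θ
  /-- (N1)(c): every morphism is the first arrow of some `(n+2)`-angle -/
  exists_angle : ∀ ⦃A₀ A₁ : 𝒞⦄ (f₀ : A₀ ⟶ A₁), ∃ T ∈ Θ,
    ∃ (e₀ : T.seq.obj' 0 ≅ A₀) (e₁ : T.seq.obj' 1 ≅ A₁),
      T.seq.map' 0 1 ≫ e₁.hom = e₀.hom ≫ f₀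
  /-- (N2) -/
  rotate_iff : ∀ A R : SigmaSeq S n, Nonempty (SigmaSeq.LeftRotation A R) → (A ∈ Θ ↔ R ∈ Θ)
  /-- (N3) -/
  exists_hom : ∀ A ∈ Θ, ∀ B ∈ Θ,
    ∀ (φ₀ : A.seq.obj' 0 ⟶ B.seq.obj' 0) (φ₁ : A.seq.obj' 1 ⟶ B.seq.obj' 1),
      A.seq.map' 0 1 ≫ φ₁ = φ₀ ≫ B.seq.map' 0 1 →
      ∃ φ : A ⟶ B, app' φ.φ 0 = φ₀ ∧ app' φ.φ 1 = φ₁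
  /-- (N4) -/
  exists_hom_cone : ∀ A ∈ Θ, ∀ B ∈ Θ,
    ∀ (φ₀ : A.seq.obj' 0 ⟶ B.seq.obj' 0) (φ₁ : A.seq.obj' 1 ⟶ B.seq.obj' 1),
      A.seq.map' 0 1 ≫ φ₁ = φ₀ ≫ B.seq.map' 0 1 →
      ∃ φ : A ⟶ B, app' φ.φ 0 = φ₀ ∧ app' φ.φ 1 = φ₁ ∧
        ∃ M ∈ Θ, Nonempty (SigmaSeq.MappingCone φ M)

/-- Every object is a finite direct sum of indecomposable objects with local endomorphism
rings. -/
def IsKrullSchmidt (𝒞 : Type u) [Category.{v} 𝒞] [Preadditive 𝒞] [HasFiniteBiproducts 𝒞] :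
    Prop :=
  ∀ X : 𝒞, ∃ (k : ℕ) (F : Fin k → 𝒞), Nonempty (X ≅ ⨁ F) ∧
    ∀ i, Indecomposable (F i) ∧ IsLocalRing (End (F i))

/-- The full subcategory on `P` is closed under isomorphisms, finite direct sums (including the
empty one) and direct summands. -/
structure IsAdditiveSubcategory [HasFiniteBiproducts 𝒞] (P : ObjectProperty 𝒞) : Prop where
  of_iso : ∀ ⦃X Y : 𝒞⦄, Nonempty (X ≅ Y) → P X → P Y
  of_isZero : ∀ ⦃X : 𝒞⦄, IsZero X → P X
  biprod : ∀ ⦃X Y : 𝒞⦄, P X → P Y → P (X ⊞ Y)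
  summand : ∀ ⦃X Y : 𝒞⦄, P (X ⊞ Y) → P X

/-- The full subcategory on `P` is `n`-extension closed: every morphism `f : C ⟶ S A` with
`A` and `C` in `P` is the last arrow of some `(n+2)`-angle whose objects are all in `P`. -/
def IsExtensionClosed {S : 𝒞 ⥤ 𝒞} {n : ℕ} (Θ : Set (SigmaSeq S n)) (P : ObjectProperty 𝒞) :
    Prop :=
  ∀ ⦃A C : 𝒞⦄, P A → P C → ∀ f : C ⟶ S.obj A, ∃ T ∈ Θ,
    (∃ (e₀ : T.seq.obj' 0 ≅ A) (e₁ : T.seq.obj' (n + 1) ≅ C),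
      T.last ≫ S.map e₀.hom = e₁.hom ≫ f) ∧
    ∀ (i : ℕ) (hi : i ≤ n + 1), P (T.seq.obj' i)

end Angulated

/-! ### Complexes with fixed ends and their homotopy classes -/

/-- A complex `X₀ ⟶ X₁ ⟶ ⋯ ⟶ Xₙ₊₁` whose ends are identified with `A` and `C`. -/
structure NComplex {𝒟 : Type u} [Category.{v} 𝒟] [Preadditive 𝒟] (n : ℕ) (A C : 𝒟) where
  /-- the row `X₀ ⟶ X₁ ⟶ ⋯ ⟶ Xₙ₊₁` -/
  seq : ComposableArrows 𝒟 (n + 1)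
  isComplex : seq.IsComplex
  /-- the identification of `X₀` with `A` -/
  left : seq.obj' 0 ≅ A
  /-- the identification of `Xₙ₊₁` with `C` -/
  right : seq.obj' (n + 1) ≅ C

namespace NComplex

variable {𝒟 : Type u} [Category.{v} 𝒟] [Preadditive 𝒟] {n : ℕ}

/-- The first arrow `A ⟶ X₁`. -/
def first {A C : 𝒟} (X : NComplex n A C) : A ⟶ X.seq.obj' 1 :=
  X.left.inv ≫ X.seq.map' 0 1

/-- The last arrow `Xₙ ⟶ C`. -/
def final {A C : 𝒟} (X : NComplex n A C) : X.seq.obj' n ⟶ C :=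
  X.seq.map' n (n + 1) ≫ X.right.hom

/-- The morphism `f` of complexes has end components `a` and `c`. -/
def IsLift {A C A' C' : 𝒟} {X : NComplex n A C} {Y : NComplex n A' C'}
    (a : A ⟶ A') (c : C ⟶ C') (f : X.seq ⟶ Y.seq) : Prop :=
  app' f 0 ≫ Y.left.hom = X.left.hom ≫ a ∧
    app' f (n + 1) ≫ Y.right.hom = X.right.hom ≫ c

/-- Chain homotopy of morphisms of rows of length `n + 2`; `h i` has components
`Xᵢ₊₁ ⟶ Yᵢ`. -/
def Homotopic {X Y : ComposableArrows 𝒟 (n + 1)} (f g : X ⟶ Y) : Prop :=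
  ∃ h : ∀ (i : ℕ) (hi : i ≤ n), X.obj' (i + 1) ⟶ Y.obj' i,
    app' (g - f) 0 = X.map' 0 1 ≫ h 0 (Nat.zero_le n) ∧
    (∀ (i : ℕ) (hi : i < n), app' (g - f) (i + 1) =
      h i hi.le ≫ Y.map' i (i + 1) + X.map' (i + 1) (i + 2) ≫ h (i + 1) hi) ∧
    app' (g - f) (n + 1) = h n le_rfl ≫ Y.map' n (n + 1)

/-- Homotopy equivalence of complexes with ends `A` and `C`, through morphisms that are the
identity on `A` and `C`. -/
def HomotopyEquivalent {A C : 𝒟} (X Y : NComplex n A C) : Prop :=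
  ∃ (f : X.seq ⟶ Y.seq) (g : Y.seq ⟶ X.seq),
    IsLift (X := X) (Y := Y) (𝟙 A) (𝟙 C) f ∧ IsLift (X := Y) (Y := X) (𝟙 A) (𝟙 C) g ∧
      Homotopic (f ≫ g) (𝟙 X.seq) ∧ Homotopic (g ≫ f) (𝟙 Y.seq)

theorem Homotopic.refl {X Y : ComposableArrows 𝒟 (n + 1)} (f : X ⟶ Y) : Homotopic f f := by
  have h : ∀ (i : ℕ) (hi : i ≤ n + 1), app' (f - f) i = 0 := fun i hi => by
    rw [sub_self]; rfl
  refine ⟨fun _ _ => 0, ?_, fun i hi => ?_, ?_⟩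
  · exact (h 0 _).trans comp_zero.symm
  · rw [h, zero_comp, comp_zero, add_zero]
  · rw [h, zero_comp]

theorem Homotopic.trans {X Y : ComposableArrows 𝒟 (n + 1)} {f g k : X ⟶ Y}
    (h₁ : Homotopic f g) (h₂ : Homotopic g k) : Homotopic f k := by
  obtain ⟨h, h0, hi, hn⟩ := h₁
  obtain ⟨h', h0', hi', hn'⟩ := h₂
  have key : ∀ (i : ℕ) (hin : i ≤ n + 1),
      app' (k - f) i hin = app' (g - f) i hin + app' (k - g) i hin := fun i hin => by
    have : k - f = (g - f) + (k - g) := by abel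
    exact congrArg (fun t : X ⟶ Y => t.app ⟨i, by omega⟩) this
  refine ⟨fun i hi => h i hi + h' i hi, ?_, fun i hin => ?_, ?_⟩
  · rw [key, Preadditive.comp_add, ← h0, ← h0']
  · rw [key, hi i hin, hi' i hin, Preadditive.comp_add, Preadditive.add_comp]
    abel
  · rw [key, Preadditive.add_comp, ← hn, ← hn']

theorem Homotopic.comp {X Y Z W : ComposableArrows 𝒟 (n + 1)} {f g : X ⟶ Y}
    (h₁ : Homotopic f g) (l : W ⟶ X) (r : Y ⟶ Z) : Homotopic (l ≫ f ≫ r) (l ≫ g ≫ r) := by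
  obtain ⟨h, h0, hi, hn⟩ := h₁
  have key : ∀ (i : ℕ) (hin : i ≤ n + 1), app' (l ≫ g ≫ r - l ≫ f ≫ r) i =
      app' l i ≫ app' (g - f) i ≫ app' r i := fun i hin => by
    rw [← Preadditive.comp_sub, ← Preadditive.sub_comp]; rfl
  refine ⟨fun i hin => app' l (i + 1) ≫ h i hin ≫ app' r i, ?_, fun i hin => ?_, ?_⟩
  · rw [key, h0, ← Category.assoc (W.map' 0 1), naturality' l 0 1]
    simp only [Category.assoc]
  · rw [key, hi i hin, ← Category.assoc (W.map' (i + 1) (i + 2)),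
      naturality' l (i + 1) (i + 2)]
    simp only [Preadditive.add_comp, Preadditive.comp_add, Category.assoc]
    rw [naturality' r i (i + 1)]
  · rw [key, hn]
    simp only [Category.assoc]
    rw [naturality' r n (n + 1)]

theorem HomotopyEquivalent.trans {A C : 𝒟} {X Y Z : NComplex n A C}
    (h₁ : HomotopyEquivalent X Y) (h₂ : HomotopyEquivalent Y Z) : HomotopyEquivalent X Z := by
  obtain ⟨f, g, hf, hg, hfg, hgf⟩ := h₁
  obtain ⟨f', g', hf', hg', hfg', hgf'⟩ := h₂
  refine ⟨f ≫ f', g' ≫ g, ⟨?_, ?_⟩, ⟨?_, ?_⟩, ?_, ?_⟩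
  · have := hf.1; have := hf'.1
    simp_all
  · have := hf.2; have := hf'.2
    simp_all
  · have := hg.1; have := hg'.1
    simp_all
  · have := hg.2; have := hg'.2
    simp_all
  · have := hfg'.comp f g
    simp only [Category.assoc, Category.id_comp] at this ⊢
    exact this.trans hfg
  · have := hgf.comp g' f'
    simp only [Category.assoc, Category.id_comp] at this ⊢
    exact this.trans hgf'

instance setoid (n : ℕ) (A C : 𝒟) : Setoid (NComplex n A C) where
  r := HomotopyEquivalent
  iseqv :=
    { refl := fun X => ⟨𝟙 _, 𝟙 _, ⟨by simp, by simp⟩, ⟨by simp, by simp⟩,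
        by simpa using Homotopic.refl (𝟙 X.seq), by simpa using Homotopic.refl (𝟙 X.seq)⟩
      symm := fun ⟨f, g, hf, hg, hfg, hgf⟩ => ⟨g, f, hg, hf, hgf, hfg⟩
      trans := HomotopyEquivalent.trans }

/-- The mapping cone of a morphism `f : X ⟶ Y` with `X₀ = A = Y₀` and `f₀ = 𝟙 A`:
an identification of `M` with
`X₁ ⟶ X₂ ⊞ Y₁ ⟶ X₃ ⊞ Y₂ ⟶ ⋯ ⟶ Xₙ₊₁ ⊞ Yₙ ⟶ Yₙ₊₁`, the arrows being `(-d; f₁)`, then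
`(-d, 0; fᵢ₊₁, d)`, and finally `(fₙ₊₁, d)`. -/
structure Cone [HasFiniteBiproducts 𝒟] {A C D : 𝒟} {X : NComplex n A C} {Y : NComplex n A D}
    (f : X.seq ⟶ Y.seq) (M : NComplex n (X.seq.obj' 1) D) where
  /-- `Mⱼ ≅ Xⱼ₊₁ ⊞ Yⱼ` for `1 ≤ j ≤ n` -/
  e : ∀ (j : ℕ) (_ : 1 ≤ j) (hj : j ≤ n), M.seq.obj' j ≅ X.seq.obj' (j + 1) ⊞ Y.seq.obj' j
  comm_first : ∀ h : 1 ≤ n, M.first ≫ (e 1 le_rfl h).hom =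
    biprod.lift (-X.seq.map' 1 2) (app' f 1)
  comm : ∀ (j : ℕ) (hj₁ : 1 ≤ j) (hj : j < n),
    M.seq.map' j (j + 1) ≫ (e (j + 1) (Nat.le_add_left 1 j) hj).hom =
      (e j hj₁ hj.le).hom ≫ Biprod.ofComponents (-X.seq.map' (j + 1) (j + 2))
        (app' f (j + 1)) 0 (Y.seq.map' j (j + 1))
  comm_final : ∀ h : 1 ≤ n, M.final =
    (e n h le_rfl).hom ≫ biprod.desc (app' f (n + 1) ≫ Y.right.hom) Y.final

/-- The mapping cocone (the dual of the mapping cone) of a morphism `f : X ⟶ Y` with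
`Xₙ₊₁ = C = Yₙ₊₁` and `fₙ₊₁ = 𝟙 C`: an identification of `N` with
`X₀ ⟶ Y₀ ⊞ X₁ ⟶ Y₁ ⊞ X₂ ⟶ ⋯ ⟶ Yₙ₋₁ ⊞ Xₙ ⟶ Yₙ`, the arrows being `(f₀; d)`, then
`(-d, fⱼ; 0, d)`, and finally `(-d, fₙ)`. -/
structure Cocone [HasFiniteBiproducts 𝒟] {A B C : 𝒟} {X : NComplex n A C} {Y : NComplex n B C}
    (f : X.seq ⟶ Y.seq) (N : NComplex n A (Y.seq.obj' n)) where
  /-- `Nⱼ ≅ Yᵢ ⊞ Xⱼ` for `1 ≤ j ≤ n`, where `i = j - 1` -/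
  e : ∀ (i j : ℕ) (hij : i + 1 = j) (hj : j ≤ n), N.seq.obj' j ≅ Y.seq.obj' i ⊞ X.seq.obj' j
  comm_first : ∀ h : 1 ≤ n, N.first ≫ (e 0 1 rfl h).hom =
    biprod.lift (X.left.inv ≫ app' f 0) X.first
  comm : ∀ (i j k : ℕ) (hij : i + 1 = j) (hjk : j + 1 = k) (hk : k ≤ n),
    N.seq.map' j k ≫ (e j k hjk hk).hom =
      (e i j hij (by omega)).hom ≫ Biprod.ofComponents (-Y.seq.map' i j) 0 (app' f j)
        (X.seq.map' j k)
  comm_final : ∀ (i : ℕ) (h : i + 1 = n), N.final =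
    (e i n h le_rfl).hom ≫ biprod.desc (-Y.seq.map' i n) (app' f n)

end NComplex

/-! ### `n`-exangulated categories -/

section Exangulated

variable {𝒟 : Type u} [Category.{v} 𝒟] [Preadditive 𝒟]

/-- The group of extensions `E(C, A)`. -/
abbrev Ext (E : 𝒟ᵒᵖ ⥤ 𝒟 ⥤ AddCommGrpCat.{w}) (C A : 𝒟) : Type w :=
  (E.obj (op C)).obj A

/-- `a_* δ` for `a : A ⟶ A'` and `δ ∈ E(C, A)`. -/
def push (E : 𝒟ᵒᵖ ⥤ 𝒟 ⥤ AddCommGrpCat.{w}) {C A A' : 𝒟} (a : A ⟶ A') (δ : Ext E C A) :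
    Ext E C A' :=
  ((E.obj (op C)).map a).hom δ

/-- `c^* δ` for `c : C' ⟶ C` and `δ ∈ E(C, A)`. -/
def pull (E : 𝒟ᵒᵖ ⥤ 𝒟 ⥤ AddCommGrpCat.{w}) {C C' A : 𝒟} (c : C' ⟶ C) (δ : Ext E C A) :
    Ext E C' A :=
  ((E.map c.op).app A).hom δ

/-- `⟨X, δ⟩` is an `n`-exangle: `δ` is killed by the two end arrows of `X`, and the sequences
`𝒟(-, X₀) ⟶ ⋯ ⟶ 𝒟(-, Xₙ₊₁) ⟶ E(-, X₀)` and `𝒟(Xₙ₊₁, -) ⟶ ⋯ ⟶ 𝒟(X₀, -) ⟶ E(Xₙ₊₁, -)` are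
exact. -/
structure IsExangle (E : 𝒟ᵒᵖ ⥤ 𝒟 ⥤ AddCommGrpCat.{w}) {n : ℕ} {A C : 𝒟} (X : NComplex n A C)
    (δ : Ext E C A) : Prop where
  push_first : push E X.first δ = 0
  pull_final : pull E X.final δ = 0
  exact_left : ∀ (i : ℕ) (hi : i < n) (W : 𝒟) (g : W ⟶ X.seq.obj' (i + 1)),
    g ≫ X.seq.map' (i + 1) (i + 2) = 0 → ∃ h : W ⟶ X.seq.obj' i, h ≫ X.seq.map' i (i + 1) = g
  exact_left_end : ∀ (W : 𝒟) (g : W ⟶ C), pull E g δ = 0 →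
    ∃ h : W ⟶ X.seq.obj' n, h ≫ X.final = g
  exact_right : ∀ (i : ℕ) (hi : i < n) (W : 𝒟) (g : X.seq.obj' (i + 1) ⟶ W),
    X.seq.map' i (i + 1) ≫ g = 0 →
      ∃ h : X.seq.obj' (i + 2) ⟶ W, X.seq.map' (i + 1) (i + 2) ≫ h = g
  exact_right_end : ∀ (W : 𝒟) (g : A ⟶ W), push E g δ = 0 →
    ∃ h : X.seq.obj' 1 ⟶ W, X.first ≫ h = g

/-- An assignment `δ ↦ s(δ)` of a homotopy class of complexes with ends `A` and `C` to each
extension `δ ∈ E(C, A)`. -/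
abbrev Realization (E : 𝒟ᵒᵖ ⥤ 𝒟 ⥤ AddCommGrpCat.{w}) (n : ℕ) :=
  ∀ ⦃A C : 𝒟⦄, Ext E C A → Quotient (NComplex.setoid n A C)

variable {E : 𝒟ᵒᵖ ⥤ 𝒟 ⥤ AddCommGrpCat.{w}} {n : ℕ}

/-- `⟨X, δ⟩` is a distinguished `n`-exangle, i.e. `s(δ) = [X]`. -/
def Realization.Distinguished (s : Realization E n) {A C : 𝒟} (X : NComplex n A C)
    (δ : Ext E C A) : Prop :=
  s δ = Quotient.mk (NComplex.setoid n A C) X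

/-- `s` is an exact realization of `E`. -/
structure Realization.IsExact (s : Realization E n) : Prop where
  /-- (R0): every morphism of extensions lifts to the realizing complexes -/
  exists_lift : ∀ ⦃A C A' C' : 𝒟⦄ (δ : Ext E C A) (δ' : Ext E C' A') (a : A ⟶ A') (c : C ⟶ C'),
    push E a δ = pull E c δ' → ∀ (X : NComplex n A C) (Y : NComplex n A' C'),
      s.Distinguished X δ → s.Distinguished Y δ' →
        ∃ f : X.seq ⟶ Y.seq, NComplex.IsLift (X := X) (Y := Y) a c f
  /-- (R1) -/
  isExangle : ∀ ⦃A C : 𝒟⦄ (δ : Ext E C A) (X : NComplex n A C),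
    s.Distinguished X δ → IsExangle E X δ
  /-- (R2): `0 ∈ E(0, A)` is realized by `A ⟶ A ⟶ 0 ⟶ ⋯ ⟶ 0` -/
  zero_right : ∀ ⦃A Z : 𝒟⦄, IsZero Z → ∀ X : NComplex n A Z, IsIso (X.seq.map' 0 1) →
    (∀ (i : ℕ) (hi : i ≤ n + 1), 2 ≤ i → IsZero (X.seq.obj' i)) →
      s.Distinguished X (0 : Ext E Z A)
  /-- (R2): `0 ∈ E(A, 0)` is realized by `0 ⟶ ⋯ ⟶ 0 ⟶ A ⟶ A` -/
  zero_left : ∀ ⦃A Z : 𝒟⦄, IsZero Z → ∀ X : NComplex n Z A, IsIso (X.seq.map' n (n + 1)) →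
    (∀ (i : ℕ) (hi : i < n), IsZero (X.seq.obj' i)) →
      s.Distinguished X (0 : Ext E A Z)

/-- `f` is an inflation: the first arrow of a complex that realizes some extension. -/
def Realization.IsInflation (s : Realization E n) {A B : 𝒟} (f : A ⟶ B) : Prop :=
  ∃ (C : 𝒟) (δ : Ext E C A) (X : NComplex n A C) (e : X.seq.obj' 1 ≅ B),
    s.Distinguished X δ ∧ X.first ≫ e.hom = f

/-- `g` is a deflation: the last arrow of a complex that realizes some extension. -/
def Realization.IsDeflation (s : Realization E n) {B C : 𝒟} (g : B ⟶ C) : Prop :=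
  ∃ (A : 𝒟) (δ : Ext E C A) (X : NComplex n A C) (e : B ≅ X.seq.obj' n),
    s.Distinguished X δ ∧ e.hom ≫ X.final = g

/-- `(𝒟, E, s)` is an `n`-exangulated category. -/
structure IsExangulated (E : 𝒟ᵒᵖ ⥤ 𝒟 ⥤ AddCommGrpCat.{w}) (s : Realization E n) : Prop where
  /-- the preadditive category `𝒟` is additive -/
  hasFiniteBiproducts : HasFiniteBiproducts 𝒟
  /-- the bifunctor `E` is additive in the first variable -/
  additive_fst : E.Additive
  /-- the bifunctor `E` is additive in the second variable -/
  additive_snd : ∀ C : 𝒟ᵒᵖ, (E.obj C).Additive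
  isExact : s.IsExact
  /-- (EA1) -/
  inflation_comp : ∀ ⦃A B C : 𝒟⦄ (f : A ⟶ B) (g : B ⟶ C),
    s.IsInflation f → s.IsInflation g → s.IsInflation (f ≫ g)
  /-- (EA1), dual part -/
  deflation_comp : ∀ ⦃A B C : 𝒟⦄ (f : A ⟶ B) (g : B ⟶ C),
    s.IsDeflation f → s.IsDeflation g → s.IsDeflation (f ≫ g)
  /-- (EA2): existence of good lifts of `(𝟙 A, c)` -/
  good_lift : ∀ ⦃A C D : 𝒟⦄ (ρ : Ext E D A) (c : C ⟶ D) (X : NComplex n A C)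
    (Y : NComplex n A D), s.Distinguished X (pull E c ρ) → s.Distinguished Y ρ →
      ∃ f : X.seq ⟶ Y.seq, NComplex.IsLift (X := X) (Y := Y) (𝟙 A) c f ∧
        ∃ M : NComplex n (X.seq.obj' 1) D,
          Nonempty (NComplex.Cone (X := X) (Y := Y) f M) ∧
            s.Distinguished M (push E X.first ρ)
  /-- (EA2ᵒᵖ): existence of good lifts of `(a, 𝟙 C)` -/
  good_lift_op : ∀ ⦃A B C : 𝒟⦄ (ρ : Ext E C A) (a : A ⟶ B) (X : NComplex n A C)
    (Y : NComplex n B C), s.Distinguished X ρ → s.Distinguished Y (push E a ρ) →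
      ∃ f : X.seq ⟶ Y.seq, NComplex.IsLift (X := X) (Y := Y) a (𝟙 C) f ∧
        ∃ N : NComplex n A (Y.seq.obj' n),
          Nonempty (NComplex.Cocone (X := X) (Y := Y) f N) ∧
            s.Distinguished N (pull E Y.final ρ)

end Exangulated

/-! ### Idempotent completions

The idempotent completion of a category is Mathlib's `Karoubi`: pairs `(A, e)` with `e` an
idempotent endomorphism of `A`. -/

section Completion

variable {𝒞 : Type u} [Category.{v} 𝒞] {𝒟 : Type u'} [Category.{v'} 𝒟]

/-- The functor `(A, e) ↦ (F A, F e)` between idempotent completions induced by `F`. -/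
abbrev karoubiMap (F : 𝒟 ⥤ 𝒞) : Karoubi 𝒟 ⥤ Karoubi 𝒞 :=
  (functorExtension₂ 𝒟 𝒞).obj F

/-- The image in the idempotent completion of an `(n+2)`-`S`-sequence, under `A ↦ (A, 𝟙 A)`. -/
def SigmaSeq.toKaroubi {S : 𝒞 ⥤ 𝒞} {n : ℕ} (U : SigmaSeq S n) : SigmaSeq (karoubiMap S) n where
  seq := U.seq ⋙ Idempotents.toKaroubi 𝒞
  last := Karoubi.Hom.mk U.last (by
    change 𝟙 _ ≫ U.last ≫ S.map (𝟙 _) = U.last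
    rw [S.map_id, Category.comp_id, Category.id_comp])

/-- The class of direct summands, in the idempotent completion, of the sequences in `Θ`. -/
def completedAngles [Preadditive 𝒞] {S : 𝒞 ⥤ 𝒞} {n : ℕ} (Θ : Set (SigmaSeq S n)) :
    Set (SigmaSeq (karoubiMap S) n) :=
  {T | ∃ T' : SigmaSeq (karoubiMap S) n, ∃ U ∈ Θ, SigmaSeq.IsDirectSum T T' U.toKaroubi}

/-- For a functor `F : 𝒟 ⥤ 𝒞`, the bifunctor `(C, A) ↦ 𝒞(F C, S (F A))` on `𝒟`. -/
def homBifunctor [Preadditive 𝒞] (F : 𝒟 ⥤ 𝒞) (S : 𝒞 ⥤ 𝒞) : 𝒟ᵒᵖ ⥤ 𝒟 ⥤ AddCommGrpCat.{v} :=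
  F.op ⋙ preadditiveCoyoneda ⋙ (Functor.whiskeringLeft 𝒟 𝒞 AddCommGrpCat.{v}).obj (F ⋙ S)

/-- The `(n+2)`-`S`-sequence `F X₀ ⟶ F X₁ ⟶ ⋯ ⟶ F Xₙ₊₁ ⟶ S (F X₀)` in `𝒞` given by a complex
`X` in `𝒟` with ends `A` and `C` and by `δ : F C ⟶ S (F A)`. -/
def NComplex.toSigmaSeq [Preadditive 𝒞] [Preadditive 𝒟] (F : 𝒟 ⥤ 𝒞) (S : 𝒞 ⥤ 𝒞) {n : ℕ}
    {A C : 𝒟} (X : NComplex n A C) (δ : F.obj C ⟶ S.obj (F.obj A)) : SigmaSeq S n where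
  seq := X.seq ⋙ F
  last := F.map X.right.hom ≫ δ ≫ S.map (F.map X.left.inv)

/-- For a full subcategory `P` of `𝒞`, the bifunctor `𝒞̃(-, S̃ -)` restricted to the idempotent
completion of `P`. -/
abbrev completedExt [Preadditive 𝒞] (S : 𝒞 ⥤ 𝒞) (P : ObjectProperty 𝒞) :
    (Karoubi P.FullSubcategory)ᵒᵖ ⥤ Karoubi P.FullSubcategory ⥤ AddCommGrpCat.{v} :=
  homBifunctor (karoubiMap P.ι) (karoubiMap S)

/-- `X` (with all its objects in the idempotent completion of `P`) and `δ : C ⟶ S̃ A` form an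
angle in the idempotent completion of `𝒞`. -/
def IsCompletedAngle [Preadditive 𝒞] {S : 𝒞 ⥤ 𝒞} {n : ℕ} (Θ : Set (SigmaSeq S n))
    (P : ObjectProperty 𝒞) {A C : Karoubi P.FullSubcategory} (X : NComplex n A C)
    (δ : Ext (completedExt S P) C A) : Prop :=
  X.toSigmaSeq (karoubiMap P.ι) (karoubiMap S) δ ∈ completedAngles Θ

end Completion

end HigherAngulated

end

/-! The Krull–Schmidt hypothesis enters only through local endomorphism rings: they allow
idempotents to be split one summand at a time, so `𝒞` is already idempotent complete
(`IsKrullSchmidt.isIdempotentComplete`). Hence `toKaroubi 𝒞` is an equivalence, the completed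
subcategory maps fully faithfully to `𝒞` by `splitting P` with essential image `P`, and completed
angles correspond to angles in `Θ` (`isCompletedAngle_iff`). It remains to treat any additive
category `𝒟` with a fully faithful additive functor `G` to `𝒞` of essential image `P`, with the
bifunctor `𝒞(G C, S (G A))`. This is `ExtIso.exists_isExangulated`.

Angles are exact under both Hom functors, by (N3) against discs (an identity between two adjacent
positions, zero elsewhere) and rotation. Two angles over the same extension are joined by lifts `f`,
`g` of the identities. Then `𝟙 - f ≫ g` vanishes at both ends, exactness makes its square
null-homotopic, and `g + g - g ≫ f ≫ g` inverts `f` up to homotopy. Conversely, a complex homotopy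
equivalent to an angle is a retract of the sum of that angle and discs, hence an angle
(`IsAngulated.mem_of_homotopic`). So the class `s(δ)` consists exactly of the angles over `δ`, and
each axiom becomes a statement about angles.

For (EA2) and its dual, (N4) is applied to right rotations, so that both ends of the morphism can be
prescribed. When one end component is invertible, the resulting cone has superfluous summands at its
two ends; splitting them off leaves the required cone or cocone (`exists_cone_angle`,
`exists_cocone_angle`).

For (EA1), extension closure is used twice to build an angle inside `P` whose first arrow `v` and
the composite `h` factor through each other. After adding a disc, a change of basis replaces `(v,
0)` by `(0, h)`, and removing the useless summand gives an angle inside `P` that starts with `h`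
(`isFirstArrow_comp`; deflations in `isFinalArrow_comp`). -/

noncomputable section

namespace HigherAngulated

open scoped ZeroObject

attribute [local instance] hasBinaryBiproducts_of_finite_biproducts

set_option linter.unusedSectionVars false

/-! ### Splitting of idempotents in a Krull–Schmidt category -/

section IdempotentSplitting

variable {𝒞 : Type u} [Category.{v} 𝒞]

/-- The endomorphism `e` of `X` splits. -/
def Splits {X : 𝒞} (e : X ⟶ X) : Prop :=
  ∃ (Y : 𝒞) (i : Y ⟶ X) (p : X ⟶ Y), i ≫ p = 𝟙 Y ∧ p ≫ i = e

/-- In the idempotent completion, `e` on `X` and `a ≫ e ≫ b` on `X'` are isomorphic objects, so a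
splitting of the second gives one of the first. -/
theorem splits_of_split_comp {X X' : 𝒞} {a : X' ⟶ X} {b : X ⟶ X'}
    (h : ∀ e : X' ⟶ X', e ≫ e = e → Splits e) (e : X ⟶ X) (he : e ≫ e = e)
    (h₁ : e ≫ b ≫ a = e) : Splits e := by
  obtain ⟨Y, i, p, hip, hpi⟩ := h (a ≫ e ≫ b) (by
    simp only [Category.assoc]; rw [reassoc_of% h₁, reassoc_of% he])
  refine ⟨Y, i ≫ a ≫ e, e ≫ b ≫ p, ?_, ?_⟩
  · simp only [Category.assoc]
    rw [reassoc_of% he]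
    have : i ≫ (a ≫ e ≫ b) ≫ p = 𝟙 Y := by rw [← hpi]; simp [hip]
    simpa using this
  · have : e ≫ b ≫ (p ≫ i) ≫ a ≫ e = e := by
      rw [hpi]
      simp only [Category.assoc]
      rw [reassoc_of% h₁, reassoc_of% h₁, reassoc_of% he, he]
    simpa using this

variable [Preadditive 𝒞]

theorem splits_add_of_orthogonal [HasBinaryBiproducts 𝒞] {X : 𝒞} {r e : X ⟶ X} (hr : Splits r)
    (he : Splits e) (h₁ : r ≫ e = 0) (h₂ : e ≫ r = 0) : Splits (r + e) := by
  obtain ⟨Y, i, p, hip, rfl⟩ := hr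
  obtain ⟨Z, j, q, hjq, rfl⟩ := he
  have h1 : i ≫ q = 0 := by
    have := i ≫= h₁ =≫ q
    simpa [reassoc_of% hip, hjq] using this
  have h2 : j ≫ p = 0 := by
    have := j ≫= h₂ =≫ p
    simpa [reassoc_of% hjq, hip] using this
  refine ⟨Y ⊞ Z, biprod.desc i j, biprod.lift p q, ?_, by simp⟩
  ext <;> simp [hip, hjq, h1, h2]

/-- The inverse `u` makes `F` a retract of the image of `e`, which gives a subidempotent `r` of `e`
that splits through `F`. Since `𝟙 - r` factors through `X'`, so do `e - r` and `𝟙 - e`, and both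
split by the hypothesis on `X'`. -/
theorem splits_and_splits_of_isUnit [HasBinaryBiproducts 𝒞] {F X X' : 𝒞} {i : F ⟶ X} {p : X ⟶ F}
    {i' : X' ⟶ X} {p' : X ⟶ X'}
    (htot : p ≫ i + p' ≫ i' = 𝟙 X) (h : ∀ e : X' ⟶ X', e ≫ e = e → Splits e)
    (e : X ⟶ X) (he : e ≫ e = e) (u : F ⟶ F) (hu : (i ≫ e ≫ p) ≫ u = 𝟙 F) :
    Splits e ∧ Splits (𝟙 X - e) := by
  have htot' : p' ≫ i' = 𝟙 X - p ≫ i := eq_sub_of_add_eq' htot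
  simp only [Category.assoc] at hu
  set π : X ⟶ F := e ≫ p ≫ u with hπ
  have hiπ : i ≫ π = 𝟙 F := hu
  have heπ : e ≫ π = π := by rw [hπ, reassoc_of% he]
  set r : X ⟶ X := π ≫ i ≫ e with hr
  have hrr : r ≫ r = r := by
    simp only [hr, Category.assoc]; rw [reassoc_of% heπ, reassoc_of% hiπ]
  have her : e ≫ r = r := by rw [hr, reassoc_of% heπ]
  have hre : r ≫ e = r := by simp only [hr, Category.assoc, he]
  have hrπ : r ≫ π = π := by simp only [hr, Category.assoc]; rw [heπ, hiπ, Category.comp_id]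
  have hrs : Splits r := ⟨F, i ≫ e, π, by rw [Category.assoc, heπ, hiπ], rfl⟩
  let a : X' ⟶ X := i' ≫ (𝟙 X - π ≫ i)
  let b : X ⟶ X' := (𝟙 X - r) ≫ p'
  have hba : b ≫ a = 𝟙 X - r := by
    simp only [a, b, Category.assoc]
    rw [reassoc_of% htot']
    simp only [Preadditive.comp_sub, Preadditive.sub_comp, Category.comp_id, Category.id_comp,
      Category.assoc]
    rw [reassoc_of% hiπ, reassoc_of% hrπ]
    abel
  have key : ∀ e' : X ⟶ X, e' ≫ e' = e' → e' ≫ r = 0 → Splits e' :=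
    fun e' h0 h2 => splits_of_split_comp (a := a) (b := b) h e' h0
      (by rw [hba, Preadditive.comp_sub, h2]; simp)
  constructor
  · have := splits_add_of_orthogonal hrs (key (e - r) (by simp [he, her, hre, hrr]) (by simp [her, hrr])) (by simp [hre, hrr]) (by simp [her, hrr])
    simpa using this
  · exact key _ (by simp [he]) (by simp [her])

/-- The compressions of `e` and `𝟙 - e` to `F` add up to `1`, so locality makes one of them a unit.
Either may occur, whence the double conclusion of `splits_and_splits_of_isUnit`. -/
theorem splits_of_isLocalRing [HasBinaryBiproducts 𝒞] {F X X' : 𝒞} [IsLocalRing (End F)]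
    {i : F ⟶ X} {p : X ⟶ F} {i' : X' ⟶ X} {p' : X ⟶ X'} (hip : i ≫ p = 𝟙 F)
    (htot : p ≫ i + p' ≫ i' = 𝟙 X) (h : ∀ e : X' ⟶ X', e ≫ e = e → Splits e)
    (e : X ⟶ X) (he : e ≫ e = e) : Splits e := by
  have h1 : (show End F from i ≫ e ≫ p) + (show End F from i ≫ (𝟙 X - e) ≫ p) = 1 := by
    change i ≫ e ≫ p + i ≫ (𝟙 X - e) ≫ p = 𝟙 F
    rw [← Preadditive.comp_add, ← Preadditive.add_comp, add_sub_cancel, Category.id_comp, hip]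
  rcases IsLocalRing.isUnit_or_isUnit_of_add_one h1 with hu | hu
  · obtain ⟨u, hu⟩ := hu.exists_left_inv
    exact (splits_and_splits_of_isUnit htot h e he u hu).1
  · obtain ⟨u, hu⟩ := hu.exists_left_inv
    have := (splits_and_splits_of_isUnit htot h (𝟙 X - e) (by simp [he]) u hu).2
    simpa using this

/-- Induction on the number of summands, detaching one with local endomorphism ring at each step. -/
theorem IsKrullSchmidt.isIdempotentComplete [HasFiniteBiproducts 𝒞] (h : IsKrullSchmidt 𝒞) :
    IsIdempotentComplete 𝒞 := by
  have aux : ∀ (k : ℕ) (F : Fin k → 𝒞), (∀ i, IsLocalRing (End (F i))) →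
      ∀ e : (⨁ F) ⟶ (⨁ F), e ≫ e = e → Splits e := by
    intro k
    induction k with
    | zero =>
      intro F _ e he
      have h0 : ∀ f : (⨁ F) ⟶ (⨁ F), f = 0 := fun f => by
        ext j; exact j.elim0
      exact ⟨⨁ F, 𝟙 _, 𝟙 _, by simp, by rw [h0 e, h0 (𝟙 _ ≫ 𝟙 _)]⟩
    | succ k ih =>
      intro F hF e he
      have := hF 0
      refine splits_of_isLocalRing (F := F 0) (X' := ⨁ fun j : Fin k => F j.succ)
        (i := biproduct.ι F 0) (p := biproduct.π F 0)
        (i' := biproduct.desc fun j => biproduct.ι F j.succ)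
        (p' := biproduct.lift fun j => biproduct.π F j.succ) (by simp) ?_
        (ih _ fun i => hF _) e he
      rw [biproduct.lift_desc, ← biproduct.total, Fin.sum_univ_succ]
  refine ⟨fun X e he => ?_⟩
  obtain ⟨k, F, ⟨φ⟩, hF⟩ := h X
  exact splits_of_split_comp (a := φ.inv) (b := φ.hom) (aux k F fun i => (hF i).2) e he (by simp)

end IdempotentSplitting

/-! ### Rows, direct sums and retracts of sequences -/

section Rows

variable {𝒞 : Type u} [Category.{v} 𝒞]

/-- Morphisms of rows from components indexed by natural numbers. -/
def rowHom {m : ℕ} {X Y : ComposableArrows 𝒞 m} (a : ∀ (i : ℕ) (hi : i ≤ m), X.obj' i ⟶ Y.obj' i)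
    (w : ∀ (i : ℕ) (hi : i < m), X.map' i (i + 1) ≫ a (i + 1) hi = a i hi.le ≫ Y.map' i (i + 1)) :
    X ⟶ Y :=
  homMk (fun i => a i.1 (Nat.lt_succ_iff.1 i.2)) w

theorem rowHom_app {m : ℕ} {X Y : ComposableArrows 𝒞 m}
    (a : ∀ (i : ℕ) (hi : i ≤ m), X.obj' i ⟶ Y.obj' i)
    (w : ∀ (i : ℕ) (hi : i < m), X.map' i (i + 1) ≫ a (i + 1) hi = a i hi.le ≫ Y.map' i (i + 1))
    (i : ℕ) (hi : i ≤ m) : app' (rowHom a w) i = a i hi := rfl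

theorem row_ext {m : ℕ} {X Y : ComposableArrows 𝒞 m} {f g : X ⟶ Y}
    (h : ∀ (i : ℕ) (hi : i ≤ m), app' f i = app' g i) : f = g := by
  ext i
  exact h i.1 (Nat.lt_succ_iff.1 i.2)

theorem app'_comp {m : ℕ} {X Y Z : ComposableArrows 𝒞 m} (f : X ⟶ Y) (g : Y ⟶ Z) (i : ℕ)
    (hi : i ≤ m) : app' f i hi ≫ app' g i hi = app' (f ≫ g) i hi := rfl

end Rows

namespace SigmaSeq

section Basic

variable {𝒞 : Type u} [Category.{v} 𝒞] {S : 𝒞 ⥤ 𝒞} {n : ℕ}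

@[simp]
theorem comp_φ {A B C : SigmaSeq S n} (f : A ⟶ B) (g : B ⟶ C) : (f ≫ g).φ = f.φ ≫ g.φ := rfl

@[simp]
theorem id_φ (A : SigmaSeq S n) : Hom.φ (𝟙 A) = 𝟙 A.seq := rfl

theorem hom_ext {A B : SigmaSeq S n} {f g : A ⟶ B} (h : f.φ = g.φ) : f = g := Hom.ext h

/-- Isomorphisms of sequences from isomorphisms of rows. -/
def isoMk {A B : SigmaSeq S n} (e : A.seq ≅ B.seq)
    (h : A.last ≫ S.map (app' e.hom 0) = app' e.hom (n + 1) ≫ B.last) : A ≅ B where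
  hom := ⟨e.hom, h⟩
  inv := ⟨e.inv, by
    have h0 : S.map (app' e.hom 0) ≫ S.map (app' e.inv 0) = 𝟙 _ := by
      rw [← S.map_comp, ← S.map_id]; exact congrArg S.map (e.hom_inv_id_app _)
    have h1 : app' e.inv (n + 1) ≫ app' e.hom (n + 1) = 𝟙 _ := e.inv_hom_id_app _
    rw [← Category.id_comp (B.last ≫ _), ← h1, Category.assoc, ← Category.assoc _ B.last, ← h,
      Category.assoc, h0, Category.comp_id]⟩
  hom_inv_id := hom_ext e.hom_inv_id
  inv_hom_id := hom_ext e.inv_hom_id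

/-- Rows form a functor category, so the row of the summand exists; its last arrow has to be
`X.last` restricted along `i` and projected along `q`. -/
instance [IsIdempotentComplete 𝒞] : IsIdempotentComplete (SigmaSeq S n) where
  idempotents_split X p hp := by
    obtain ⟨Y, i, q, hiq, hqi⟩ := IsIdempotentComplete.idempotents_split X.seq p.φ
      (congrArg Hom.φ hp)
    have h0 : ∀ (j : ℕ) (hj : j ≤ n + 1), app' i j ≫ app' q j = 𝟙 _ := fun j hj =>
      congr_app hiq _
    have h1 : ∀ (j : ℕ) (hj : j ≤ n + 1), app' q j ≫ app' i j = app' p.φ j := fun j hj =>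
      congr_app hqi _
    have hip : app' i (n + 1) ≫ app' p.φ (n + 1) = app' i (n + 1) := by
      rw [← h1, ← Category.assoc, h0, Category.id_comp]
    have hpq : app' p.φ 0 ≫ app' q 0 = app' q 0 := by
      rw [← h1, Category.assoc, h0, Category.comp_id]
    refine ⟨⟨Y, app' i (n + 1) ≫ X.last ≫ S.map (app' q 0)⟩, ⟨i, ?_⟩, ⟨q, ?_⟩, hom_ext hiq,
      hom_ext hqi⟩
    · dsimp only
      rw [Category.assoc, Category.assoc, ← S.map_comp, h1, p.comm, ← Category.assoc, hip]
    · dsimp only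
      rw [← Category.assoc, h1, ← Category.assoc, ← p.comm, Category.assoc, ← S.map_comp, hpq]

end Basic

section Preadditive

variable {𝒞 : Type u} [Category.{v} 𝒞] [Preadditive 𝒞] {S : 𝒞 ⥤ 𝒞} {n : ℕ}

@[simp]
theorem app'_add {m : ℕ} {X Y : ComposableArrows 𝒞 m} (f g : X ⟶ Y) (i : ℕ) (hi : i ≤ m) :
    app' (f + g) i hi = app' f i hi + app' g i hi := rfl

@[simp]
theorem app'_sub {m : ℕ} {X Y : ComposableArrows 𝒞 m} (f g : X ⟶ Y) (i : ℕ) (hi : i ≤ m) :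
    app' (f - g) i hi = app' f i hi - app' g i hi := rfl

/-- The endomorphism `𝟙 - f`. -/
def idSub [S.Additive] {X : SigmaSeq S n} (f : X ⟶ X) : X ⟶ X where
  φ := 𝟙 X.seq - f.φ
  comm := by
    have h := f.comm
    rw [app'_sub, app'_sub, S.map_sub, Preadditive.comp_sub, Preadditive.sub_comp, h]
    change X.last ≫ S.map (𝟙 _) - _ = 𝟙 _ ≫ X.last - _
    rw [S.map_id, Category.comp_id, Category.id_comp]

variable [HasFiniteBiproducts 𝒞]

instance hasBinaryBiproducts_rows (m : ℕ) : HasBinaryBiproducts (ComposableArrows 𝒞 m) :=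
  HasBinaryBiproducts.of_hasBinaryProducts

variable [S.Additive]

/-- The direct sum of two sequences. -/
abbrev sum (A B : SigmaSeq S n) : SigmaSeq S n where
  seq := A.seq ⊞ B.seq
  last := app' (biprod.fst : A.seq ⊞ B.seq ⟶ _) (n + 1) le_rfl ≫ A.last ≫
      S.map (app' (biprod.inl : _ ⟶ A.seq ⊞ B.seq) 0 (Nat.zero_le _)) +
    app' (biprod.snd : A.seq ⊞ B.seq ⟶ _) (n + 1) le_rfl ≫ B.last ≫
      S.map (app' (biprod.inr : _ ⟶ A.seq ⊞ B.seq) 0 (Nat.zero_le _))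

/-- Morphisms into a direct sum. -/
def sumLift {A B X : SigmaSeq S n} (f : X ⟶ A) (g : X ⟶ B) : X ⟶ sum A B where
  φ := biprod.lift f.φ g.φ
  comm := by
    have hf := f.comm
    have hg := g.comm
    have h : biprod.lift f.φ g.φ = f.φ ≫ biprod.inl + g.φ ≫ biprod.inr := by
      apply biprod.hom_ext <;> simp
    dsimp only [sum]
    rw [Preadditive.comp_add, ← Category.assoc, ← Category.assoc (app' _ _) (app' _ _),
      app'_comp, app'_comp, biprod.lift_fst, biprod.lift_snd, ← Category.assoc, ← hf,
      ← Category.assoc (app' g.φ _), ← hg, h, app'_add, S.map_add, Preadditive.comp_add,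
      ← app'_comp, ← app'_comp, S.map_comp, S.map_comp, Category.assoc, Category.assoc]

/-- Morphisms from a direct sum. -/
def sumDesc {A B X : SigmaSeq S n} (f : A ⟶ X) (g : B ⟶ X) : sum A B ⟶ X where
  φ := biprod.desc f.φ g.φ
  comm := by
    have hf := f.comm
    have hg := g.comm
    have h : biprod.desc f.φ g.φ = biprod.fst ≫ f.φ + biprod.snd ≫ g.φ := by
      apply biprod.hom_ext' <;> simp
    dsimp only [sum]
    rw [Preadditive.add_comp, Category.assoc, Category.assoc, Category.assoc, Category.assoc,
      ← S.map_comp, ← S.map_comp, app'_comp, app'_comp, biprod.inl_desc, biprod.inr_desc, hf, hg,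
      ← Category.assoc, ← Category.assoc (app' _ _) (app' _ _), app'_comp, app'_comp,
      ← Preadditive.add_comp, ← app'_add, ← h]

theorem isDirectSum_sum (A B : SigmaSeq S n) : IsDirectSum A B (sum A B) := by
  have h0 : ∀ X Y : SigmaSeq S n, Y.last ≫ S.map (app' (0 : Y.seq ⟶ X.seq) 0) =
      app' (0 : Y.seq ⟶ X.seq) (n + 1) ≫ X.last := fun X Y => by
    change Y.last ≫ S.map 0 = 0 ≫ X.last
    rw [S.map_zero, comp_zero, zero_comp]
  refine ⟨sumLift (𝟙 A) ⟨0, h0 _ _⟩, sumLift ⟨0, h0 _ _⟩ (𝟙 B), sumDesc (𝟙 A) ⟨0, h0 _ _⟩,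
    sumDesc ⟨0, h0 _ _⟩ (𝟙 B), hom_ext ?_, hom_ext ?_, ?_, ?_, ?_⟩
  all_goals simp only [sumLift, sumDesc, comp_φ, id_φ]
  · simp
  · simp
  · simp
  · simp
  · apply biprod.hom_ext <;> apply biprod.hom_ext' <;> simp

end Preadditive

end SigmaSeq

namespace IsAngulated

variable {𝒞 : Type u} [Category.{v} 𝒞] [Preadditive 𝒞] [HasFiniteBiproducts 𝒞] {S : 𝒞 ⥤ 𝒞}
  {n : ℕ} {Θ : Set (SigmaSeq S n)}

/-- An equivalence preserves binary products, so additivity of the suspension is automatic. -/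
theorem additive (hΘ : IsAngulated S n Θ) : S.Additive := by
  have := hΘ.isEquivalence
  have := hasBinaryBiproducts_of_finite_biproducts 𝒞
  exact Functor.additive_of_preserves_binary_products S

/-- Splitting the complementary idempotent turns the retract into a direct summand, to which (N1)(a)
applies. -/
theorem mem_of_retract [IsIdempotentComplete 𝒞] (hΘ : IsAngulated S n Θ) {X Y : SigmaSeq S n}
    (hX : X ∈ Θ) (f : Y ⟶ X) (g : X ⟶ Y) (h : f.φ ≫ g.φ = 𝟙 Y.seq) : Y ∈ Θ := by
  have := hΘ.additive
  obtain ⟨Z, i, p, hip, hpi⟩ := IsIdempotentComplete.idempotents_split X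
    (SigmaSeq.idSub (g ≫ f)) (SigmaSeq.hom_ext (by simp [SigmaSeq.idSub, reassoc_of% h]))
  have hip' : i.φ ≫ p.φ = 𝟙 Z.seq := congrArg SigmaSeq.Hom.φ hip
  have hpi' : p.φ ≫ i.φ = 𝟙 X.seq - g.φ ≫ f.φ := congrArg SigmaSeq.Hom.φ hpi
  refine hΘ.summand_mem Y Z X ⟨f, i, g, p, SigmaSeq.hom_ext h, hip, ?_, ?_, by simp [hpi']⟩ hX
  · have : (f.φ ≫ p.φ) ≫ i.φ = 0 := by simp [hpi', reassoc_of% h]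
    rw [← Category.comp_id (f.φ ≫ p.φ), ← hip', ← Category.assoc, this, zero_comp]
  · have : p.φ ≫ i.φ ≫ g.φ = 0 := by rw [← Category.assoc, hpi']; simp [h]
    rw [← Category.id_comp (i.φ ≫ g.φ), ← hip', Category.assoc, this, comp_zero]

theorem sum_mem' [S.Additive] (hΘ : IsAngulated S n Θ) {A B : SigmaSeq S n} (hA : A ∈ Θ)
    (hB : B ∈ Θ) : SigmaSeq.sum A B ∈ Θ :=
  hΘ.sum_mem A B _ (SigmaSeq.isDirectSum_sum A B) hA hB

theorem mem_of_iso' (hΘ : IsAngulated S n Θ) {A B : SigmaSeq S n} (e : A.seq ≅ B.seq)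
    (h : A.last ≫ S.map (app' e.hom 0) = app' e.hom (n + 1) ≫ B.last) (hA : A ∈ Θ) : B ∈ Θ :=
  hΘ.mem_of_iso A B ⟨SigmaSeq.isoMk e h⟩ hA

end IsAngulated

/-! ### Rotations -/

namespace SigmaSeq

section Rotation

variable {𝒞 : Type u} [Category.{v} 𝒞] [Preadditive 𝒞] {S : 𝒞 ⥤ 𝒞} {n : ℕ}

theorem neg_one_pow_zsmul_zsmul {X Y : 𝒞} (n : ℕ) (f : X ⟶ Y) :
    (-1 : ℤ) ^ n • (-1 : ℤ) ^ n • f = f := by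
  rw [smul_smul, ← mul_pow]; simp

/-- The right rotation `U ⟶ T₀ ⟶ ⋯ ⟶ Tₙ ⟶ S U` of `T`, where `S U ≅ Tₙ₊₁`. -/
def rightRot [S.Full] (T : SigmaSeq S n) {U : 𝒞} (u : S.obj U ≅ T.seq.obj' (n + 1)) :
    SigmaSeq S n where
  seq := T.seq.δlast.precomp (S.preimage ((-1 : ℤ) ^ n • (u.hom ≫ T.last)))
  last := T.seq.map' n (n + 1) ≫ u.inv

theorem rightRot_map_zero_one [S.Full] (T : SigmaSeq S n) {U : 𝒞}
    (u : S.obj U ≅ T.seq.obj' (n + 1)) :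
    S.map ((T.rightRot u).seq.map' 0 1) = (-1 : ℤ) ^ n • (u.hom ≫ T.last) :=
  S.map_preimage _

/-- `T` is the left rotation of its right rotation. -/
def rightRotLeftRotation [S.Full] (T : SigmaSeq S n) {U : 𝒞} (u : S.obj U ≅ T.seq.obj' (n + 1)) :
    LeftRotation (T.rightRot u) T where
  e i hi := Iso.refl (T.seq.obj' i)
  eLast := u.symm
  comm i hi := (Category.comp_id _).trans (Category.id_comp _).symm
  comm_n := (Category.id_comp _).symm
  comm_last := by
    -- The sign built into the first arrow of `rightRot` cancels the sign introduced by rotating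
    -- back.
    have h : T.last = u.inv ≫ ((-1 : ℤ) ^ n • (-1 : ℤ) ^ n • (u.hom ≫ T.last)) := by
      rw [neg_one_pow_zsmul_zsmul, Iso.inv_hom_id_assoc]
    have h' : T.last ≫ S.map (𝟙 _) = T.last := by rw [S.map_id, Category.comp_id]
    refine h'.trans (h.trans ?_)
    rw [← rightRot_map_zero_one]
    rfl

/-- (N2) compares a sequence with a given left rotation but does not supply one, so a row with
objects `T₁, …, Tₙ₊₁, S T₀` is assembled by hand. -/
theorem exists_leftRotation (T : SigmaSeq S n) :
    ∃ R : SigmaSeq S n, Nonempty (LeftRotation T R) := by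
  let obj : Fin (n + 2) → 𝒞 := fun j =>
    if h : j.1 ≤ n then T.seq.obj' (j.1 + 1) else S.obj (T.seq.obj' 0)
  -- The case distinction in `obj` does not reduce for a variable index; these isomorphisms carry
  -- the identifications from here on.
  let e : ∀ (j : ℕ) (hj : j ≤ n), obj ⟨j, by omega⟩ ≅ T.seq.obj' (j + 1) := fun j hj =>
    eqToIso (dif_pos hj)
  let eL : obj ⟨n + 1, by omega⟩ ≅ S.obj (T.seq.obj' 0) := eqToIso (dif_neg (by simp))
  let m : ∀ j : Fin (n + 1), obj j.castSucc ⟶ obj j.succ := fun j =>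
    if h : j.1 < n then (e j.1 h.le).hom ≫ T.seq.map' (j.1 + 1) (j.1 + 2) ≫ (e (j.1 + 1) h).inv
    else eqToHom (by rw [show j = ⟨n, by omega⟩ by ext; simp; omega]; rfl) ≫
      (e n le_rfl).hom ≫ T.last ≫ eL.inv ≫
      eqToHom (by rw [show j = ⟨n, by omega⟩ by ext; simp; omega]; rfl)
  let F := mkOfObjOfMapSucc obj m
  refine ⟨⟨F, (eL.hom ≫ ((-1 : ℤ) ^ n • S.map (T.seq.map' 0 1))) ≫
    S.map (e 0 (Nat.zero_le n)).inv⟩, ⟨⟨e, eL, fun i hi => ?_, ?_, ?_⟩⟩⟩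
  · have : F.map' i (i + 1) = m ⟨i, by omega⟩ := mkOfObjOfMapSucc_map_succ obj m i (by omega)
    refine (congrArg (· ≫ (e (i + 1) hi).hom) this).trans ?_
    have h : m ⟨i, by omega⟩ =
        (e i hi.le).hom ≫ T.seq.map' (i + 1) (i + 2) ≫ (e (i + 1) hi).inv := dif_pos hi
    rw [h]
    have h' : ((e i hi.le).hom ≫ T.seq.map' (i + 1) (i + 2) ≫ (e (i + 1) hi).inv) ≫
        (e (i + 1) hi).hom = (e i hi.le).hom ≫ T.seq.map' (i + 1) (i + 2) := by
      rw [Category.assoc, Category.assoc, Iso.inv_hom_id, Category.comp_id]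
    exact h'
  · have : F.map' n (n + 1) = m ⟨n, by omega⟩ := mkOfObjOfMapSucc_map_succ obj m n (by omega)
    refine (congrArg (· ≫ eL.hom) this).trans ?_
    have h : m ⟨n, by omega⟩ = (e n le_rfl).hom ≫ T.last ≫ eL.inv := by
      refine (dif_neg (lt_irrefl n)).trans ?_
      erw [eqToHom_refl, eqToHom_refl, Category.comp_id, Category.id_comp]
    rw [h]
    have h' : ((e n le_rfl).hom ≫ T.last ≫ eL.inv) ≫ eL.hom = (e n le_rfl).hom ≫ T.last := by
      rw [Category.assoc, Category.assoc, Iso.inv_hom_id, Category.comp_id]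
    exact h'
  · have h : S.map (e 0 (Nat.zero_le n)).inv ≫ S.map (e 0 (Nat.zero_le n)).hom = 𝟙 _ := by
      rw [← S.map_comp, Iso.inv_hom_id, S.map_id]
    exact (Category.assoc _ _ _).trans ((congrArg (_ ≫ ·) h).trans (Category.comp_id _))

end Rotation

end SigmaSeq

/-! ### Discs -/

section Disc

variable {𝒞 : Type u} [Category.{v} 𝒞] [Preadditive 𝒞]  {S : 𝒞 ⥤ 𝒞} {n : ℕ}

namespace SigmaSeq

/-- `T` is, up to isomorphism, the sequence with `𝟙 W : W ⟶ W` in positions `i`, `i + 1` and zero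
objects elsewhere. -/
structure IsDisc (i : ℕ) (hi : i ≤ n) (T : SigmaSeq S n) : Prop where
  isIso : IsIso (T.seq.map' i (i + 1))
  isZero : ∀ (j : ℕ) (hj : j ≤ n + 1), j ≠ i → j ≠ i + 1 → IsZero (T.seq.obj' j)

end SigmaSeq

variable [HasFiniteBiproducts 𝒞]

/-- The row with `𝟙 W : W ⟶ W` in positions `i`, `i + 1` and zero objects elsewhere. -/
def disc (n i : ℕ) (W : 𝒞) : ComposableArrows 𝒞 (n + 1) :=
  mkOfObjOfMapSucc (fun j => if j.1 = i ∨ j.1 = i + 1 then W else ⨁ (Fin.elim0 : Fin 0 → 𝒞))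
    fun j => if h : j.1 = i then eqToHom (by simp [h]) else 0

/-- The object of the disc in position `i`. -/
def discFst (n i : ℕ) (hi : i ≤ n) (W : 𝒞) : (disc n i W).obj' i ≅ W :=
  eqToIso (if_pos (Or.inl rfl))

/-- The object of the disc in position `i + 1`. -/
def discSnd (n i : ℕ) (hi : i ≤ n) (W : 𝒞) : (disc n i W).obj' (i + 1) ≅ W :=
  eqToIso (if_pos (Or.inr rfl))

theorem isZero_biproduct_elim0 : IsZero (⨁ (Fin.elim0 : Fin 0 → 𝒞)) := by
  rw [IsZero.iff_id_eq_zero]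
  ext j
  exact j.elim0

theorem disc_isZero (n i : ℕ) (W : 𝒞) (j : ℕ) (hj : j ≤ n + 1) (h₁ : j ≠ i) (h₂ : j ≠ i + 1) :
    IsZero ((disc n i W).obj' j) := by
  have : (disc n i W).obj' j = ⨁ (Fin.elim0 : Fin 0 → 𝒞) := if_neg (by simp [h₁, h₂])
  rw [this]
  exact isZero_biproduct_elim0

theorem disc_map (n i : ℕ) (hi : i ≤ n) (W : 𝒞) :
    (disc n i W).map' i (i + 1) = (discFst n i hi W).hom ≫ (discSnd n i hi W).inv := by
  refine (mkOfObjOfMapSucc_map_succ _ _ i (by omega)).trans ?_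
  refine (dif_pos rfl).trans ?_
  exact (eqToHom_trans (if_pos (Or.inl rfl)) (if_pos (Or.inr rfl)).symm).symm

/-- The disc as a sequence. -/
abbrev discSeq (S : 𝒞 ⥤ 𝒞) (n i : ℕ) (W : 𝒞) : SigmaSeq S n := ⟨disc n i W, 0⟩

theorem discSeq_isDisc (S : 𝒞 ⥤ 𝒞) (n i : ℕ) (hi : i ≤ n) (W : 𝒞) :
    (discSeq S n i W).IsDisc i hi where
  isIso := by
    have := disc_map n i hi W
    dsimp only [discSeq]
    rw [this]
    infer_instance
  isZero := disc_isZero n i W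

/-- Left rotation moves a disc one position to the left, and (N2) is an equivalence; at position `0`
a disc is a trivial sequence. -/
theorem SigmaSeq.IsDisc.mem {Θ : Set (SigmaSeq S n)} (hΘ : IsAngulated S n Θ) {i : ℕ} {hi : i ≤ n}
    {T : SigmaSeq S n} (hT : T.IsDisc i hi) : T ∈ Θ := by
  have := hΘ.additive
  induction i generalizing T with
  | zero => exact hΘ.trivial_mem T ⟨hT.isIso, fun j hj h => hT.isZero j hj (by omega) (by omega)⟩
  | succ i ih =>
    obtain ⟨R, ⟨r⟩⟩ := T.exists_leftRotation
    refine (hΘ.rotate_iff T R ⟨r⟩).2 (ih (hi := by omega) ⟨?_, fun j hj h₁ h₂ => ?_⟩)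
    · have h := r.comm i hi
      have h' : R.seq.map' i (i + 1) = (r.e i (by omega)).hom ≫
          T.seq.map' (i + 1) (i + 2) ≫ (r.e (i + 1) hi).inv := by
        rw [← Category.assoc, ← h, Category.assoc, Iso.hom_inv_id, Category.comp_id]
      have := hT.isIso
      rw [h']
      infer_instance
    · by_cases hjn : j ≤ n
      · exact (hT.isZero (j + 1) (by omega) (by omega) (by omega)).of_iso (r.e j hjn)
      -- The new last object is `S T₀`, which is zero because the disc in `T` starts at a positive
      -- position.
      · obtain rfl : j = n + 1 := by omega
        exact (S.map_isZero (hT.isZero 0 (by omega) (by omega) (by omega))).of_iso r.eLast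

end Disc

namespace IsAngulated

variable {𝒞 : Type u} [Category.{v} 𝒞] [Preadditive 𝒞] [HasFiniteBiproducts 𝒞] {S : 𝒞 ⥤ 𝒞}
  {n : ℕ} {Θ : Set (SigmaSeq S n)}

theorem discSeq_mem (hΘ : IsAngulated S n Θ) (i : ℕ) (hi : i ≤ n) (W : 𝒞) :
    discSeq S n i W ∈ Θ :=
  (discSeq_isDisc S n i hi W).mem hΘ

/-- The object whose suspension is isomorphic to `X`. -/
theorem exists_desuspension (hΘ : IsAngulated S n Θ) (X : 𝒞) : ∃ U : 𝒞, Nonempty (S.obj U ≅ X) := by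
  have := hΘ.isEquivalence
  exact ⟨S.objPreimage X, ⟨S.objObjPreimageIso X⟩⟩

theorem rightRot_mem [S.Full] (hΘ : IsAngulated S n Θ) {T : SigmaSeq S n} (hT : T ∈ Θ) {U : 𝒞}
    (u : S.obj U ≅ T.seq.obj' (n + 1)) : T.rightRot u ∈ Θ :=
  (hΘ.rotate_iff _ T ⟨T.rightRotLeftRotation u⟩).2 hT

theorem exists_rightRotation (hΘ : IsAngulated S n Θ) {T : SigmaSeq S n} (hT : T ∈ Θ) :
    ∃ A ∈ Θ, Nonempty (SigmaSeq.LeftRotation A T) := by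
  have := hΘ.isEquivalence
  obtain ⟨U, ⟨u⟩⟩ := hΘ.exists_desuspension (T.seq.obj' (n + 1))
  exact ⟨_, hΘ.rightRot_mem hT u, ⟨T.rightRotLeftRotation u⟩⟩

/-! ### Exactness of angles under the Hom functors -/

section Exactness

variable (hΘ : IsAngulated S n Θ) (hn : 1 ≤ n)
include hΘ hn

/-- By (N3), the identity of `T₀` and the first arrow extend to a morphism from the disc on `T₀` at
position `0`; its component at position `2` starts from a zero object. -/
theorem map_comp_map_zero {T : SigmaSeq S n} (hT : T ∈ Θ) :
    T.seq.map' 0 1 ≫ T.seq.map' 1 2 = 0 := by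
  obtain ⟨φ, h0, h1⟩ := hΘ.exists_hom _ (hΘ.discSeq_mem 0 (Nat.zero_le n) (T.seq.obj' 0)) T hT
    (discFst n 0 (Nat.zero_le n) _).hom
    ((discSnd n 0 (Nat.zero_le n) _).hom ≫ T.seq.map' 0 1) (by
      have := disc_map n 0 (Nat.zero_le n) (T.seq.obj' 0)
      dsimp only [discSeq]
      rw [this, Category.assoc, Iso.inv_hom_id_assoc])
  have hw := naturality' φ.φ 1 2
  rw [h1, (disc_isZero n 0 (T.seq.obj' 0) 2 (by omega) (by omega) (by omega)).eq_of_src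
    (app' φ.φ 2) 0, comp_zero] at hw
  rw [← cancel_epi (discSnd n 0 (Nat.zero_le n) _).hom, comp_zero, hw, Category.assoc]

/-- Up to sign and isomorphism, this is the suspension of the composite of the first two arrows of
the right rotation. -/
theorem last_comp_map {T : SigmaSeq S n} (hT : T ∈ Θ) : T.last ≫ S.map (T.seq.map' 0 1) = 0 := by
  have := hΘ.additive
  obtain ⟨A, hA, ⟨r⟩⟩ := hΘ.exists_rightRotation hT
  have h := hΘ.map_comp_map_zero hn hA
  have h1 := r.comm 0 (by omega)
  have h2 := r.comm_last
  have : IsIso (S.map (r.e 1 hn).hom) := inferInstance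
  rw [← cancel_mono (S.map (r.e 1 hn).hom), Category.assoc, ← S.map_comp, h1, S.map_comp,
    reassoc_of% h2, Preadditive.zsmul_comp, ← S.map_comp, h, S.map_zero]
  simp only [comp_zero, zero_comp, smul_zero, Functor.map_zero]

theorem map_comp_last {T : SigmaSeq S n} (hT : T ∈ Θ) : T.seq.map' n (n + 1) ≫ T.last = 0 := by
  have := hΘ.additive
  obtain ⟨A, hA, ⟨r⟩⟩ := hΘ.exists_rightRotation hT
  have h := hΘ.last_comp_map hn hA
  have h1 := r.comm_n
  have h2 := r.comm_last
  rw [← cancel_mono (S.map (r.e 0 (Nat.zero_le n)).hom), Category.assoc, h2, reassoc_of% h1,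
    Preadditive.comp_zsmul, h]
  simp only [comp_zero, zero_comp, smul_zero, Functor.map_zero]

/-- A right rotation raises positions by one, so repeated rotation pushes the composite to the right
end, where `map_comp_last` applies. The induction is on the distance `k` to that end. -/
theorem isComplex {T : SigmaSeq S n} (hT : T ∈ Θ) : T.seq.IsComplex := by
  suffices h : ∀ (k i : ℕ) (hi : i + 1 + k = n) (T : SigmaSeq S n), T ∈ Θ →
      T.seq.map' i (i + 1) ≫ T.seq.map' (i + 1) (i + 2) = 0 from
    ⟨fun i hi => h (n - (i + 1)) i (by omega) T hT⟩
  intro k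
  induction k with
  | zero =>
    intro i hi T hT
    obtain ⟨A, hA, ⟨r⟩⟩ := hΘ.exists_rightRotation hT
    obtain rfl : n = i + 1 := by omega
    have h1 := r.comm i (by omega)
    have h2 := r.comm_n
    rw [← cancel_mono r.eLast.hom, Category.assoc, h2, reassoc_of% h1,
      hΘ.map_comp_last hn hA]
    simp only [comp_zero, zero_comp, smul_zero, Functor.map_zero]
  | succ k ih =>
    intro i hi T hT
    obtain ⟨A, hA, ⟨r⟩⟩ := hΘ.exists_rightRotation hT
    have h1 := r.comm i (by omega)
    have h2 := r.comm (i + 1) (by omega)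
    rw [← cancel_mono (r.e (i + 2) (by omega)).hom, Category.assoc, h2, reassoc_of% h1,
      ih (i + 1) (by omega) A hA]
    simp only [comp_zero, zero_comp, smul_zero, Functor.map_zero]

/-- (N3) extends the components `0` and `g` to a morphism into the disc on `W` at position `1`; its
component at position `2` is the factorization. -/
theorem exists_desc_map_zero {T : SigmaSeq S n} (hT : T ∈ Θ) {W : 𝒞} (g : T.seq.obj' 1 ⟶ W)
    (hg : T.seq.map' 0 1 ≫ g = 0) : ∃ h : T.seq.obj' 2 ⟶ W, T.seq.map' 1 2 ≫ h = g := by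
  obtain ⟨φ, h0, h1⟩ := hΘ.exists_hom T hT _ (hΘ.discSeq_mem 1 hn W) 0
    (g ≫ (discFst n 1 hn W).inv) (by rw [reassoc_of% hg, zero_comp, zero_comp])
  have hw := naturality' φ.φ 1 2
  have hd := disc_map n 1 hn W
  refine ⟨app' φ.φ 2 ≫ (discSnd n 1 hn W).hom, ?_⟩
  rw [reassoc_of% hw, h1]
  dsimp only [discSeq]
  rw [hd, Category.assoc, Category.assoc, Iso.inv_hom_id, Category.comp_id,
    Iso.inv_hom_id, Category.comp_id]

theorem exists_desc_first {T : SigmaSeq S n} (hT : T ∈ Θ) {W : 𝒞} (g : T.seq.obj' 0 ⟶ W)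
    (hg : T.last ≫ S.map g = 0) : ∃ h : T.seq.obj' 1 ⟶ W, T.seq.map' 0 1 ≫ h = g := by
  have := hΘ.additive
  have := hΘ.isEquivalence
  obtain ⟨A, hA, ⟨r⟩⟩ := hΘ.exists_rightRotation hT
  have h1 := r.comm 0 (by omega)
  have h2 := r.comm_last
  obtain ⟨h, hh⟩ := hΘ.exists_desc_map_zero hn hA ((r.e 0 (Nat.zero_le n)).inv ≫ g) (by
    apply S.map_injective
    have : r.eLast.hom ≫ ((-1 : ℤ) ^ n • S.map (A.seq.map' 0 1)) ≫
        S.map (r.e 0 (Nat.zero_le n)).inv ≫ S.map g = 0 := by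
      rw [← reassoc_of% h2, ← Category.assoc (S.map _), ← S.map_comp, Iso.hom_inv_id, S.map_id, Category.id_comp, hg]
    rw [Preadditive.zsmul_comp, Preadditive.comp_zsmul] at this
    have h3 := congrArg (fun f => r.eLast.inv ≫ ((-1 : ℤ) ^ n • f)) this
    simp only [SigmaSeq.neg_one_pow_zsmul_zsmul, Iso.inv_hom_id_assoc] at h3
    rw [S.map_comp, S.map_comp, h3]
    simp only [comp_zero, zero_comp, smul_zero, Functor.map_zero])
  refine ⟨(r.e 1 hn).hom ≫ h, ?_⟩
  rw [reassoc_of% h1, hh, Iso.hom_inv_id_assoc]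

theorem exists_desc_suspension {T : SigmaSeq S n} (hT : T ∈ Θ) {W : 𝒞}
    (g : S.obj (T.seq.obj' 0) ⟶ W) (hg : T.last ≫ g = 0) :
    ∃ h : S.obj (T.seq.obj' 1) ⟶ W, S.map (T.seq.map' 0 1) ≫ h = g := by
  have := hΘ.isEquivalence
  obtain ⟨U, ⟨u⟩⟩ := hΘ.exists_desuspension W
  obtain ⟨h, hh⟩ := hΘ.exists_desc_first hn hT (S.preimage (g ≫ u.inv)) (by
    rw [S.map_preimage, reassoc_of% hg, zero_comp])
  refine ⟨S.map h ≫ u.hom, ?_⟩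
  rw [← Category.assoc, ← S.map_comp, hh, S.map_preimage, Category.assoc, Iso.inv_hom_id, Category.comp_id]

theorem exists_desc_last {T : SigmaSeq S n} (hT : T ∈ Θ) {W : 𝒞} (g : T.seq.obj' (n + 1) ⟶ W)
    (hg : T.seq.map' n (n + 1) ≫ g = 0) : ∃ h : S.obj (T.seq.obj' 0) ⟶ W, T.last ≫ h = g := by
  obtain ⟨A, hA, ⟨r⟩⟩ := hΘ.exists_rightRotation hT
  have h1 := r.comm_n
  have h2 := r.comm_last
  obtain ⟨h, hh⟩ := hΘ.exists_desc_suspension hn hA (r.eLast.inv ≫ g) (by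
    rw [← cancel_epi (r.e n le_rfl).hom, ← reassoc_of% h1]
    simp only [Iso.hom_inv_id_assoc, hg, comp_zero])
  refine ⟨S.map (r.e 0 (Nat.zero_le n)).hom ≫ ((-1 : ℤ) ^ n • h), ?_⟩
  rw [reassoc_of% h2, Preadditive.zsmul_comp, Preadditive.comp_zsmul, Preadditive.comp_zsmul,
    Preadditive.comp_zsmul, SigmaSeq.neg_one_pow_zsmul_zsmul, hh, Iso.hom_inv_id_assoc]

/-- The rotation argument of `isComplex` again, ending with `exists_desc_last`. -/
theorem exists_desc {T : SigmaSeq S n} (hT : T ∈ Θ) (i : ℕ) (hi : i < n) {W : 𝒞}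
    (g : T.seq.obj' (i + 1) ⟶ W) (hg : T.seq.map' i (i + 1) ≫ g = 0) :
    ∃ h : T.seq.obj' (i + 2) ⟶ W, T.seq.map' (i + 1) (i + 2) ≫ h = g := by
  suffices h : ∀ (k i : ℕ) (hi : i + 1 + k = n) (T : SigmaSeq S n), T ∈ Θ →
      ∀ (g : T.seq.obj' (i + 1) ⟶ W), T.seq.map' i (i + 1) ≫ g = 0 →
    ∃ h : T.seq.obj' (i + 2) ⟶ W, T.seq.map' (i + 1) (i + 2) ≫ h = g from
    h (n - (i + 1)) i (by omega) T hT g hg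
  intro k
  induction k with
  | zero =>
    intro i hi T hT g hg
    obtain ⟨A, hA, ⟨r⟩⟩ := hΘ.exists_rightRotation hT
    obtain rfl : n = i + 1 := by omega
    have h1 := r.comm i (by omega)
    have h2 := r.comm_n
    obtain ⟨h, hh⟩ := hΘ.exists_desc_last hn hA ((r.e (i + 1) le_rfl).inv ≫ g) (by
      rw [← cancel_epi (r.e i (by omega)).hom, ← reassoc_of% h1]
      simp only [Iso.hom_inv_id_assoc, hg, comp_zero])
    refine ⟨r.eLast.hom ≫ h, ?_⟩
    rw [reassoc_of% h2, hh, Iso.hom_inv_id_assoc]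
  | succ k ih =>
    intro i hi T hT g hg
    obtain ⟨A, hA, ⟨r⟩⟩ := hΘ.exists_rightRotation hT
    have h1 := r.comm i (by omega)
    have h2 := r.comm (i + 1) (by omega)
    obtain ⟨h, hh⟩ := ih (i + 1) (by omega) A hA ((r.e (i + 1) (by omega)).inv ≫ g) (by
      rw [← cancel_epi (r.e i (by omega)).hom, ← reassoc_of% h1]
      simp only [Iso.hom_inv_id_assoc, hg, comp_zero])
    refine ⟨(r.e (i + 2) (by omega)).hom ≫ h, ?_⟩
    rw [reassoc_of% h2, hh, Iso.hom_inv_id_assoc]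

/-- (N3) prescribes components at the left end only, so lifting needs a test sequence with `W` at
position `0`: the right rotation `W ⟶ 0 ⟶ ⋯ ⟶ 0 ⟶ S W ⟶ S W` of a disc. The component at position `n
+ 1` of the extended morphism is the lift. -/
theorem exists_lift_last_map {T : SigmaSeq S n} (hT : T ∈ Θ) {W : 𝒞} (g : W ⟶ T.seq.obj' 0)
    (hg : g ≫ T.seq.map' 0 1 = 0) :
    ∃ h : S.obj W ⟶ T.seq.obj' (n + 1), h ≫ T.last = S.map g := by
  have := hΘ.isEquivalence
  let B := (discSeq S n n (S.obj W)).rightRot (discSnd n n le_rfl (S.obj W)).symm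
  have hB : B ∈ Θ := hΘ.rightRot_mem (hΘ.discSeq_mem n le_rfl (S.obj W)) _
  obtain ⟨φ, h0, h1⟩ := hΘ.exists_hom B hB T hT g 0 (by rw [comp_zero]; exact hg.symm)
  have hl : B.last = (discFst n n le_rfl (S.obj W)).hom := by
    change (disc n n (S.obj W)).map' n (n + 1) ≫ (discSnd n n le_rfl (S.obj W)).hom = _
    rw [disc_map n n le_rfl, Category.assoc, Iso.inv_hom_id, Category.comp_id]
  have hc := φ.comm
  refine ⟨(discFst n n le_rfl (S.obj W)).inv ≫ app' φ.φ (n + 1), ?_⟩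
  have h2 : (discFst n n le_rfl (S.obj W)).hom ≫ S.map g = app' φ.φ (n + 1) ≫ T.last := by
    rw [← hl, ← h0]; exact hc
  exact (Category.assoc _ _ _).trans ((Iso.inv_comp_eq _).2 h2.symm)

theorem exists_lift_suspension {T : SigmaSeq S n} (hT : T ∈ Θ) {W : 𝒞}
    (g : W ⟶ S.obj (T.seq.obj' 0)) (hg : g ≫ S.map (T.seq.map' 0 1) = 0) :
    ∃ h : W ⟶ T.seq.obj' (n + 1), h ≫ T.last = g := by
  have := hΘ.isEquivalence
  have := hΘ.additive
  obtain ⟨U, ⟨u⟩⟩ := hΘ.exists_desuspension W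
  obtain ⟨h, hh⟩ := hΘ.exists_lift_last_map hn hT (S.preimage (u.hom ≫ g)) (by
    apply S.map_injective
    rw [S.map_comp, S.map_preimage, Category.assoc, hg, comp_zero, S.map_zero])
  refine ⟨u.inv ≫ h, ?_⟩
  rw [Category.assoc, hh, S.map_preimage, Iso.inv_hom_id_assoc]

theorem exists_lift_last {T : SigmaSeq S n} (hT : T ∈ Θ) {W : 𝒞} (g : W ⟶ T.seq.obj' (n + 1))
    (hg : g ≫ T.last = 0) : ∃ h : W ⟶ T.seq.obj' n, h ≫ T.seq.map' n (n + 1) = g := by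
  obtain ⟨A, hA, ⟨r⟩⟩ := hΘ.exists_rightRotation hT
  have h1 := r.comm_n
  have h2 := r.comm_last
  obtain ⟨h, hh⟩ := hΘ.exists_lift_suspension hn hA (g ≫ r.eLast.hom) (by
    have h3 := congrArg (fun f => (-1 : ℤ) ^ n • (g ≫ f)) h2
    simp only [Preadditive.comp_zsmul, SigmaSeq.neg_one_pow_zsmul_zsmul, reassoc_of% hg] at h3
    rw [Category.assoc, ← h3, zero_comp, smul_zero])
  refine ⟨h ≫ (r.e n le_rfl).inv, ?_⟩
  rw [← cancel_mono r.eLast.hom, Category.assoc, Category.assoc, h1, Iso.inv_hom_id_assoc, hh]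

/-- Rotations push the position to the right end, where `exists_lift_last` is the base case. -/
theorem exists_lift {T : SigmaSeq S n} (hT : T ∈ Θ) (i : ℕ) (hi : i < n) {W : 𝒞}
    (g : W ⟶ T.seq.obj' (i + 1)) (hg : g ≫ T.seq.map' (i + 1) (i + 2) = 0) :
    ∃ h : W ⟶ T.seq.obj' i, h ≫ T.seq.map' i (i + 1) = g := by
  suffices h : ∀ (k i : ℕ) (hi : i + 1 + k = n) (T : SigmaSeq S n), T ∈ Θ →
      ∀ (g : W ⟶ T.seq.obj' (i + 1)), g ≫ T.seq.map' (i + 1) (i + 2) = 0 →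
    ∃ h : W ⟶ T.seq.obj' i, h ≫ T.seq.map' i (i + 1) = g from
    h (n - (i + 1)) i (by omega) T hT g hg
  intro k
  induction k with
  | zero =>
    intro i hi T hT g hg
    obtain ⟨A, hA, ⟨r⟩⟩ := hΘ.exists_rightRotation hT
    obtain rfl : n = i + 1 := by omega
    have h1 := r.comm i (by omega)
    have h2 := r.comm_n
    obtain ⟨h, hh⟩ := hΘ.exists_lift_last hn hA (g ≫ (r.e (i + 1) le_rfl).hom) (by
      rw [Category.assoc, ← h2, reassoc_of% hg, zero_comp])
    refine ⟨h ≫ (r.e i (by omega)).inv, ?_⟩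
    rw [← cancel_mono (r.e (i + 1) le_rfl).hom, Category.assoc, Category.assoc, h1,
      Iso.inv_hom_id_assoc, hh]
  | succ k ih =>
    intro i hi T hT g hg
    obtain ⟨A, hA, ⟨r⟩⟩ := hΘ.exists_rightRotation hT
    have h1 := r.comm i (by omega)
    have h2 := r.comm (i + 1) (by omega)
    obtain ⟨h, hh⟩ := ih (i + 1) (by omega) A hA (g ≫ (r.e (i + 1) (by omega)).hom) (by
      rw [Category.assoc, ← h2, reassoc_of% hg, zero_comp])
    refine ⟨h ≫ (r.e i (by omega)).inv, ?_⟩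
    rw [← cancel_mono (r.e (i + 1) (by omega)).hom, Category.assoc, Category.assoc, h1,
      Iso.inv_hom_id_assoc, hh]

end Exactness

end IsAngulated

section TwoTerm

variable {𝒞 : Type u} [Category.{v} 𝒞] [HasZeroMorphisms 𝒞] {n : ℕ}

/-- Serves for maps into and out of discs, for homotopies with one component and for idempotents
supported on two adjacent objects. The neighbours are given by equations so that the ends of the row
need no separate treatment. -/
theorem exists_rowHom_two {X Y : ComposableArrows 𝒞 (n + 1)} (i : ℕ) (hi : i ≤ n)
    (f : X.obj' i ⟶ Y.obj' i) (g : X.obj' (i + 1) ⟶ Y.obj' (i + 1))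
    (w : X.map' i (i + 1) ≫ g = f ≫ Y.map' i (i + 1))
    (hpre : ∀ (j : ℕ) (_ : j + 1 = i), X.map' j i ≫ f = 0)
    (hpost : ∀ (k : ℕ) (_ : i + 1 + 1 = k) (_ : k ≤ n + 1), g ≫ Y.map' (i + 1) k = 0) :
    ∃ φ : X ⟶ Y, app' φ i = f ∧ app' φ (i + 1) = g ∧
      ∀ (j : ℕ) (hj : j ≤ n + 1), j ≠ i → j ≠ i + 1 → app' φ j = 0 := by
  obtain ⟨a, ai, ai1, a0⟩ : ∃ a : ∀ (j : ℕ) (hj : j ≤ n + 1), X.obj' j ⟶ Y.obj' j,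
      a i (by omega) = f ∧ a (i + 1) (by omega) = g ∧
        ∀ (j : ℕ) (hj : j ≤ n + 1), j ≠ i → j ≠ i + 1 → a j hj = 0 :=
    ⟨fun j hj => if h : j = i then by subst h; exact f
      else if h' : j = i + 1 then by subst h'; exact g else 0, dif_pos rfl,
      (dif_neg (by omega)).trans (dif_pos rfl), fun j hj h1 h2 => (dif_neg h1).trans (dif_neg h2)⟩
  refine ⟨rowHom a fun j hj => ?_, ai, ai1, a0⟩
  by_cases h1 : j + 1 = i
  · subst h1
    rw [ai, a0 j (by omega) (by omega) (by omega), hpre j rfl, zero_comp]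
  by_cases h2 : j = i
  · subst h2
    rw [ai, ai1, w]
  by_cases h3 : j = i + 1
  · subst h3
    rw [ai1, a0 (i + 1 + 1) (by omega) (by omega) (by omega), hpost _ rfl (by omega), comp_zero]
  · rw [a0 j (by omega) h2 h3, a0 (j + 1) (by omega) h1 (by omega), comp_zero, zero_comp]

end TwoTerm

/-! ### Homotopies between exact rows -/

section Null

variable {𝒟 : Type u} [Category.{v} 𝒟] [Preadditive 𝒟] {n : ℕ}

namespace NComplex

theorem Homotopic.congr {X Y : ComposableArrows 𝒟 (n + 1)} {f g f' g' : X ⟶ Y}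
    (h : Homotopic f g) (e : g - f = g' - f') : Homotopic f' g' := by
  unfold Homotopic at h ⊢
  rwa [e] at h

/-- The homotopy with the single component `h : Xᵢ₊₁ ⟶ Yᵢ`. -/
theorem exists_homotopic_zero {X Y : ComposableArrows 𝒟 (n + 1)} (hX : X.IsComplex)
    (hY : Y.IsComplex) (i : ℕ) (hi : i ≤ n) (h : X.obj' (i + 1) ⟶ Y.obj' i) :
    ∃ φ : X ⟶ Y, app' φ i = X.map' i (i + 1) ≫ h ∧ app' φ (i + 1) = h ≫ Y.map' i (i + 1) ∧
      (∀ (j : ℕ) (hj : j ≤ n + 1), j ≠ i → j ≠ i + 1 → app' φ j = 0) ∧ Homotopic 0 φ := by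
  obtain ⟨φ, h1, h2, h3⟩ := exists_rowHom_two (X := X) (Y := Y) i hi (X.map' i (i + 1) ≫ h)
    (h ≫ Y.map' i (i + 1)) (Category.assoc _ _ _).symm
    (fun j hj => by subst hj; rw [← Category.assoc, hX.zero j, zero_comp])
    (fun k hk _ => by subst hk; rw [Category.assoc, hY.zero i, comp_zero])
  obtain ⟨k, ki, k0⟩ : ∃ k : ∀ (j : ℕ) (hj : j ≤ n), X.obj' (j + 1) ⟶ Y.obj' j,
      k i hi = h ∧ ∀ (j : ℕ) (hj : j ≤ n), j ≠ i → k j hj = 0 :=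
    ⟨fun j hj => if e : j = i then by subst e; exact h else 0, dif_pos rfl,
      fun j hj e => dif_neg e⟩
  refine ⟨φ, h1, h2, h3, k, ?_, ?_, ?_⟩
  all_goals rw [sub_zero]
  · by_cases e : 0 = i
    · subst e; rw [ki]; exact h1
    · rw [k0 0 _ e, comp_zero, h3 0 (by omega) e (by omega)]
  · intro j hj
    by_cases e : j = i
    · subst e; rw [ki, k0 _ _ (by omega), comp_zero, add_zero]; exact h2
    by_cases e' : j + 1 = i
    · subst e'; rw [k0 _ _ (by omega), ki, zero_comp, zero_add]; exact h1
    · rw [k0 _ _ e, k0 _ _ e', h3 _ _ e' (by omega), zero_comp, comp_zero, add_zero]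
  · by_cases e : n = i
    · subst e; rw [ki]; exact h2
    · rw [k0 _ _ e, zero_comp, h3 (n + 1) le_rfl (by omega) (by omega)]

theorem Homotopic.add_zero {X Y : ComposableArrows 𝒟 (n + 1)} {f g : X ⟶ Y}
    (hf : Homotopic 0 f) (hg : Homotopic 0 g) : Homotopic 0 (f + g) :=
  hf.trans (hg.congr (by abel))

/-- A morphism from an exact row that vanishes at the left end is homotopic to one that vanishes
everywhere except at the right end. -/
theorem exists_vanishing_left {X Y : ComposableArrows 𝒟 (n + 1)} (hX : X.IsComplex)
    (hY : Y.IsComplex)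
    (ex : ∀ (i : ℕ) (hi : i < n) (W : 𝒟) (g : X.obj' (i + 1) ⟶ W), X.map' i (i + 1) ≫ g = 0 →
      ∃ h : X.obj' (i + 2) ⟶ W, X.map' (i + 1) (i + 2) ≫ h = g)
    (ψ : X ⟶ Y) (h0 : app' ψ 0 = 0) (m : ℕ) (hm : m ≤ n) :
    ∃ ψ' : X ⟶ Y, Homotopic 0 (ψ - ψ') ∧ ∀ (j : ℕ) (hj : j ≤ m), app' ψ' j = 0 := by
  induction m with
  | zero =>
    refine ⟨ψ, by rw [sub_self]; exact Homotopic.refl 0, fun j hj => ?_⟩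
    obtain rfl : j = 0 := by omega
    exact h0
  | succ m ih =>
    obtain ⟨ψ', hψ, hz⟩ := ih (by omega)
    -- As `ψ'` vanishes at `m`, its next component kills the incoming arrow of `X` and so factors
    -- through the outgoing one. The factor `h` is the homotopy to subtract.
    have hw := naturality' ψ' m (m + 1)
    rw [hz m le_rfl, zero_comp] at hw
    obtain ⟨h, hh⟩ := ex m (by omega) _ _ hw
    obtain ⟨φ, h1, h2, h3, h4⟩ := exists_homotopic_zero hX hY (m + 1) hm h
    refine ⟨ψ' - φ, ?_, fun j hj => ?_⟩
    · have : ψ - (ψ' - φ) = (ψ - ψ') + φ := by abel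
      rw [this]
      exact hψ.add_zero h4
    · rw [SigmaSeq.app'_sub]
      by_cases e : j = m + 1
      · subst e; exact sub_eq_zero.2 (hh.symm.trans h1.symm)
      · rw [hz j (by omega), h3 j (by omega) e (by omega), sub_self]

/-- A morphism to an exact row that vanishes at the right end is homotopic to one that vanishes
everywhere except at the left end. -/
theorem exists_vanishing_right {X Y : ComposableArrows 𝒟 (n + 1)} (hX : X.IsComplex)
    (hY : Y.IsComplex)
    (ex : ∀ (i : ℕ) (hi : i < n) (W : 𝒟) (g : W ⟶ Y.obj' (i + 1)),
      g ≫ Y.map' (i + 1) (i + 2) = 0 → ∃ h : W ⟶ Y.obj' i, h ≫ Y.map' i (i + 1) = g)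
    (ψ : X ⟶ Y) (h0 : app' ψ (n + 1) = 0) (m : ℕ) (hm : m ≤ n) :
    ∃ ψ' : X ⟶ Y, Homotopic 0 (ψ - ψ') ∧
      ∀ (j : ℕ) (hj : j ≤ n + 1), n + 1 ≤ m + j → app' ψ' j = 0 := by
  induction m with
  | zero =>
    refine ⟨ψ, by rw [sub_self]; exact Homotopic.refl 0, fun j hj hj' => ?_⟩
    obtain rfl : j = n + 1 := by omega
    exact h0
  | succ m ih =>
    obtain ⟨ψ', hψ, hz⟩ := ih (by omega)
    -- The position cleared in this step is `n - m`, written `i + 1` to avoid subtraction.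
    obtain ⟨i, rfl⟩ : ∃ i, n = m + 1 + i := ⟨n - (m + 1), by omega⟩
    have hw := naturality' ψ' (i + 1) (i + 2)
    rw [hz (i + 2) (by omega) (by omega), comp_zero] at hw
    obtain ⟨h, hh⟩ := ex i (by omega) _ _ hw.symm
    obtain ⟨φ, h1, h2, h3, h4⟩ := exists_homotopic_zero hX hY i (by omega) h
    refine ⟨ψ' - φ, ?_, fun j hj hj' => ?_⟩
    · have : ψ - (ψ' - φ) = (ψ - ψ') + φ := by abel
      rw [this]
      exact hψ.add_zero h4
    · rw [SigmaSeq.app'_sub]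
      by_cases e : j = i + 1
      · subst e; exact sub_eq_zero.2 (hh.symm.trans h2.symm)
      · rw [hz j (by omega) (by omega), h3 j (by omega) (by omega) e, sub_self]

/-- An endomorphism of an exact row that vanishes at both ends has null-homotopic square. -/
theorem homotopic_zero_comp_self {X : ComposableArrows 𝒟 (n + 1)} (hX : X.IsComplex)
    (exR : ∀ (i : ℕ) (hi : i < n) (W : 𝒟) (g : X.obj' (i + 1) ⟶ W), X.map' i (i + 1) ≫ g = 0 →
      ∃ h : X.obj' (i + 2) ⟶ W, X.map' (i + 1) (i + 2) ≫ h = g)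
    (exL : ∀ (i : ℕ) (hi : i < n) (W : 𝒟) (g : W ⟶ X.obj' (i + 1)),
      g ≫ X.map' (i + 1) (i + 2) = 0 → ∃ h : W ⟶ X.obj' i, h ≫ X.map' i (i + 1) = g)
    (ψ : X ⟶ X) (h0 : app' ψ 0 = 0) (h1 : app' ψ (n + 1) = 0) : Homotopic 0 (ψ ≫ ψ) := by
  obtain ⟨ψ₁, e₁, z₁⟩ := exists_vanishing_left hX hX exR ψ h0 n le_rfl
  obtain ⟨ψ₂, e₂, z₂⟩ := exists_vanishing_right hX hX exL ψ h1 n le_rfl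
  -- `ψ₂` lives at position `0` only and `ψ₁` at position `n + 1` only. Hence `ψ ≫ ψ` is the sum of
  -- `(ψ - ψ₂) ≫ ψ` and `ψ₂ ≫ (ψ - ψ₁)`, both null-homotopic.
  have hz : ψ₂ ≫ ψ₁ = 0 := by
    refine row_ext fun j hj => ?_
    rw [← app'_comp]
    by_cases hj' : j ≤ n
    · rw [z₁ j hj', comp_zero]; rfl
    · rw [z₂ j hj (by omega), zero_comp]; rfl
  have a := e₂.comp (𝟙 X) ψ
  have b := e₁.comp ψ₂ (𝟙 X)
  simp only [Category.id_comp, Category.comp_id, zero_comp, comp_zero, Preadditive.comp_sub,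
    Preadditive.sub_comp, hz, sub_zero] at a b
  have := a.add_zero b
  rwa [sub_add_cancel] at this

/-- With `u = 𝟙 - f ≫ g`, which vanishes at both ends, `u ≫ u` is null-homotopic. The inverse `g' =
g + g - g ≫ f ≫ g` is the one for which `𝟙 - f ≫ g' = u ≫ u`; the other composite behaves in the
same way. -/
theorem homotopyEquivalent_of_exact {A C : 𝒟} {X Y : NComplex n A C}
    (exRX : ∀ (i : ℕ) (hi : i < n) (W : 𝒟) (g : X.seq.obj' (i + 1) ⟶ W),
      X.seq.map' i (i + 1) ≫ g = 0 →
      ∃ h : X.seq.obj' (i + 2) ⟶ W, X.seq.map' (i + 1) (i + 2) ≫ h = g)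
    (exLX : ∀ (i : ℕ) (hi : i < n) (W : 𝒟) (g : W ⟶ X.seq.obj' (i + 1)),
      g ≫ X.seq.map' (i + 1) (i + 2) = 0 → ∃ h : W ⟶ X.seq.obj' i, h ≫ X.seq.map' i (i + 1) = g)
    (exRY : ∀ (i : ℕ) (hi : i < n) (W : 𝒟) (g : Y.seq.obj' (i + 1) ⟶ W),
      Y.seq.map' i (i + 1) ≫ g = 0 →
      ∃ h : Y.seq.obj' (i + 2) ⟶ W, Y.seq.map' (i + 1) (i + 2) ≫ h = g)
    (exLY : ∀ (i : ℕ) (hi : i < n) (W : 𝒟) (g : W ⟶ Y.seq.obj' (i + 1)),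
      g ≫ Y.seq.map' (i + 1) (i + 2) = 0 → ∃ h : W ⟶ Y.seq.obj' i, h ≫ Y.seq.map' i (i + 1) = g)
    {f : X.seq ⟶ Y.seq} {g : Y.seq ⟶ X.seq} (hf : IsLift (X := X) (Y := Y) (𝟙 A) (𝟙 C) f)
    (hg : IsLift (X := Y) (Y := X) (𝟙 A) (𝟙 C) g) : HomotopyEquivalent X Y := by
  have f0 : app' f 0 = X.left.hom ≫ Y.left.inv := by
    rw [← cancel_mono Y.left.hom, hf.1, Category.comp_id, Category.assoc, Iso.inv_hom_id,
      Category.comp_id]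
  have f1 : app' f (n + 1) = X.right.hom ≫ Y.right.inv := by
    rw [← cancel_mono Y.right.hom, hf.2, Category.comp_id, Category.assoc, Iso.inv_hom_id,
      Category.comp_id]
  have g0 : app' g 0 = Y.left.hom ≫ X.left.inv := by
    rw [← cancel_mono X.left.hom, hg.1, Category.comp_id, Category.assoc, Iso.inv_hom_id,
      Category.comp_id]
  have g1 : app' g (n + 1) = Y.right.hom ≫ X.right.inv := by
    rw [← cancel_mono X.right.hom, hg.2, Category.comp_id, Category.assoc, Iso.inv_hom_id,
      Category.comp_id]
  have hX := homotopic_zero_comp_self X.isComplex exRX exLX (𝟙 X.seq - f ≫ g)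
    (by
      rw [SigmaSeq.app'_sub, ← app'_comp, f0, g0, Category.assoc, Iso.inv_hom_id_assoc,
        Iso.hom_inv_id]
      exact sub_self _)
    (by
      rw [SigmaSeq.app'_sub, ← app'_comp, f1, g1, Category.assoc, Iso.inv_hom_id_assoc,
        Iso.hom_inv_id]
      exact sub_self _)
  have hY := homotopic_zero_comp_self Y.isComplex exRY exLY (𝟙 Y.seq - g ≫ f)
    (by
      rw [SigmaSeq.app'_sub, ← app'_comp, f0, g0, Category.assoc, Iso.inv_hom_id_assoc,
        Iso.hom_inv_id]
      exact sub_self _)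
    (by
      rw [SigmaSeq.app'_sub, ← app'_comp, f1, g1, Category.assoc, Iso.inv_hom_id_assoc,
        Iso.hom_inv_id]
      exact sub_self _)
  refine ⟨f, g + g - g ≫ f ≫ g, hf, ⟨?_, ?_⟩, hX.congr ?_,
    hY.congr ?_⟩
  · rw [SigmaSeq.app'_sub, SigmaSeq.app'_add, ← app'_comp, ← app'_comp, f0, g0]
    simp only [Category.assoc, Iso.inv_hom_id_assoc, add_sub_cancel_right, Iso.inv_hom_id]
  · rw [SigmaSeq.app'_sub, SigmaSeq.app'_add, ← app'_comp, ← app'_comp, f1, g1]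
    simp only [Category.assoc, Iso.inv_hom_id_assoc, add_sub_cancel_right, Iso.inv_hom_id]
  · simp only [Preadditive.comp_sub, Preadditive.sub_comp, Preadditive.comp_add,
      Category.id_comp, Category.comp_id, Category.assoc, sub_zero]
    abel
  · simp only [Preadditive.comp_sub, Preadditive.sub_comp, Preadditive.add_comp,
      Category.id_comp, Category.comp_id, Category.assoc, sub_zero]
    abel

end NComplex

end Null

/-! ### Stability of angles under homotopy equivalence -/

section Factorization

variable {𝒞 : Type u} [Category.{v} 𝒞] [Preadditive 𝒞] [HasFiniteBiproducts 𝒞] {S : 𝒞 ⥤ 𝒞}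
  {n : ℕ} {Θ : Set (SigmaSeq S n)}

/-- The endomorphism `φ` of the row of `Y` factors through a sequence in `Θ`. -/
def FactorsThrough (Θ : Set (SigmaSeq S n)) (Y : SigmaSeq S n) (φ : Y.seq ⟶ Y.seq) : Prop :=
  ∃ X ∈ Θ, ∃ (f : Y ⟶ X) (g : X ⟶ Y), f.φ ≫ g.φ = φ

namespace IsAngulated

theorem factorsThrough_add (hΘ : IsAngulated S n Θ) {Y : SigmaSeq S n} {φ ψ : Y.seq ⟶ Y.seq}
    (hφ : FactorsThrough Θ Y φ) (hψ : FactorsThrough Θ Y ψ) : FactorsThrough Θ Y (φ + ψ) := by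
  have := hΘ.additive
  obtain ⟨X, hX, f, g, rfl⟩ := hφ
  obtain ⟨X', hX', f', g', rfl⟩ := hψ
  exact ⟨_, hΘ.sum_mem' hX hX', SigmaSeq.sumLift f f', SigmaSeq.sumDesc g g',
    biprod.lift_desc⟩

/-- A homotopy with one component `h` gives `(d ≫ h, h)` into the disc on `Yᵢ` followed by `(𝟙, d)`
out of it. The last arrow of the disc is zero, so compatibility with last arrows is a condition at
the two ends of the row, supplied by `h0` and `hl`. -/
theorem factorsThrough_of_homotopic_zero (hΘ : IsAngulated S n Θ) {Y : SigmaSeq S n}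
    (hY : Y.seq.IsComplex) (hl : Y.seq.map' n (n + 1) ≫ Y.last = 0) (i : ℕ) (hi : i ≤ n)
    (h : Y.seq.obj' (i + 1) ⟶ Y.seq.obj' i) (h0 : i = 0 → Y.seq.map' i (i + 1) ≫ h = 0)
    {φ : Y.seq ⟶ Y.seq} (h₁ : app' φ i = Y.seq.map' i (i + 1) ≫ h)
    (h₂ : app' φ (i + 1) = h ≫ Y.seq.map' i (i + 1))
    (h₃ : ∀ (j : ℕ) (hj : j ≤ n + 1), j ≠ i → j ≠ i + 1 → app' φ j = 0) :
    FactorsThrough Θ Y φ := by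
  have := hΘ.additive
  let W := Y.seq.obj' i
  have hd := disc_map n i hi W
  obtain ⟨a, a1, a2, a3⟩ := exists_rowHom_two (X := Y.seq) (Y := disc n i W) i hi
    ((Y.seq.map' i (i + 1) ≫ h) ≫ (discFst n i hi W).inv) (h ≫ (discSnd n i hi W).inv)
    (by rw [hd, Category.assoc, Iso.inv_hom_id_assoc, Category.assoc])
    (fun j hj => by subst hj; rw [← Category.assoc, ← Category.assoc, hY.zero j, zero_comp,
      zero_comp])
    (fun k hk hk' => (disc_isZero n i W k hk' (by omega) (by omega)).eq_of_tgt _ _)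
  obtain ⟨b, b1, b2, b3⟩ := exists_rowHom_two (X := disc n i W) (Y := Y.seq) i hi
    (discFst n i hi W).hom ((discSnd n i hi W).hom ≫ Y.seq.map' i (i + 1))
    (by rw [hd, Category.assoc, Iso.inv_hom_id_assoc])
    (fun j hj => (disc_isZero n i W j (by omega) (by omega) (by omega)).eq_of_src _ _)
    (fun k hk hk' => by subst hk; rw [Category.assoc, hY.zero i, comp_zero])
  refine ⟨discSeq S n i W, hΘ.discSeq_mem i hi W, ⟨a, ?_⟩, ⟨b, ?_⟩, row_ext fun j hj => ?_⟩
  · have e : app' a 0 = 0 := by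
      by_cases hi0 : 0 = i
      · subst hi0
        rw [a1, h0 rfl, zero_comp]
      · exact a3 0 _ hi0 (by omega)
    rw [e, S.map_zero, comp_zero, comp_zero]
  · rw [zero_comp]
    by_cases hin : n = i
    · subst hin
      rw [b2, Category.assoc, hl, comp_zero]
    · rw [b3 (n + 1) le_rfl (by omega) (by omega), zero_comp]
  · rw [← app'_comp]
    by_cases e : j = i
    · subst e
      rw [a1, b1, h₁, Category.assoc, Iso.inv_hom_id, Category.comp_id]
    by_cases e' : j = i + 1
    · subst e'
      rw [a2, b2, h₂, Category.assoc, Iso.inv_hom_id_assoc]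
    · rw [h₃ j hj e e', b3 j hj e e', comp_zero]

theorem factorsThrough_zero (hΘ : IsAngulated S n Θ) (Y : SigmaSeq S n) :
    FactorsThrough Θ Y 0 := by
  have := hΘ.additive
  refine ⟨discSeq S n 0 (Y.seq.obj' 0), hΘ.discSeq_mem 0 (Nat.zero_le n) _, ⟨0, ?_⟩, ⟨0, ?_⟩,
    zero_comp⟩
  · change _ ≫ S.map 0 = 0 ≫ _
    rw [S.map_zero, comp_zero, zero_comp]
  · change _ ≫ S.map 0 = 0 ≫ _
    rw [S.map_zero, comp_zero, zero_comp]

/-- A sequence that is a homotopy retract of an angle is an angle. -/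
theorem mem_of_homotopic [IsIdempotentComplete 𝒞] (hΘ : IsAngulated S n Θ) {X Y : SigmaSeq S n}
    (hX : X ∈ Θ) (hY : Y.seq.IsComplex) (hl : Y.seq.map' n (n + 1) ≫ Y.last = 0)
    (f : Y ⟶ X) (g : X ⟶ Y) (h0 : app' (f.φ ≫ g.φ) 0 = 𝟙 _)
    (h : NComplex.Homotopic (f.φ ≫ g.φ) (𝟙 Y.seq)) : Y ∈ Θ := by
  obtain ⟨s, s0, si, sn⟩ := h
  -- The homotopy is cut into its components: `c i` is the endomorphism that `s i` alone
  -- contributes.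
  choose c c1 c2 c3 using fun i : Fin (n + 1) => NComplex.exists_homotopic_zero hY hY i.1
    (Nat.lt_succ_iff.1 i.2) (s i.1 (Nat.lt_succ_iff.1 i.2))
  have key : ∀ m : Finset (Fin (n + 1)), FactorsThrough Θ Y (∑ i ∈ m, c i) := by
    intro m
    refine Finset.sum_induction _ (FactorsThrough Θ Y) (fun _ _ => hΘ.factorsThrough_add)
      (hΘ.factorsThrough_zero Y) fun i _ => ?_
    refine hΘ.factorsThrough_of_homotopic_zero hY hl i.1 (Nat.lt_succ_iff.1 i.2) _ ?_ (c1 i)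
      (c2 i) (c3 i).1
    intro hi
    obtain ⟨i, hi'⟩ := i
    dsimp only at hi
    subst hi
    -- Here `h0` matters: `f ≫ g` is the identity at position `0`, so the contribution of the
    -- homotopy there is zero.
    refine s0.symm.trans ?_
    rw [SigmaSeq.app'_sub, h0]
    exact sub_self _
  have app_sum : ∀ (m : Finset (Fin (n + 1))) (j : ℕ) (hj : j ≤ n + 1),
      app' (∑ i ∈ m, c i) j = ∑ i ∈ m, app' (c i) j := fun m j hj => by
    induction m using Finset.induction_on with
    | empty => rfl
    | insert i m hi ih => rw [Finset.sum_insert hi, Finset.sum_insert hi, ← ih]; rfl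
  -- At a given position only the one or two adjacent homotopy components contribute.
  have total : 𝟙 Y.seq - f.φ ≫ g.φ = ∑ i, c i := by
    refine row_ext fun j hj => ?_
    rw [app_sum]
    rcases Nat.eq_zero_or_pos j with rfl | hj0
    · rw [Finset.sum_eq_single ⟨0, by omega⟩]
      · rw [s0, c1]
      · intro b _ hb
        exact (c3 b).1 _ _ (fun h => hb (Fin.ext h.symm)) (by omega)
      · simp
    obtain ⟨j, rfl⟩ : ∃ k, j = k + 1 := ⟨j - 1, by omega⟩
    by_cases hjn : j < n
    · rw [Finset.sum_eq_add (⟨j, by omega⟩ : Fin (n + 1)) ⟨j + 1, by omega⟩ (by simp)]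
      · rw [si j hjn, c2, c1]
      · intro b _ hb
        exact (c3 b).1 _ _ (fun h => hb.2 (Fin.ext h.symm)) (fun h => hb.1 (Fin.ext (by
          simpa using h.symm)))
      · simp
      · simp
    · obtain rfl : j = n := by omega
      rw [Finset.sum_eq_single ⟨j, by omega⟩]
      · rw [sn, c2]
      · intro b _ hb
        exact (c3 b).1 _ _ (fun h => by omega) (fun h => hb (Fin.ext (by simpa using h.symm)))
      · simp
  have h1 : FactorsThrough Θ Y (𝟙 Y.seq) := by
    have := hΘ.factorsThrough_add ⟨X, hX, f, g, rfl⟩ (key Finset.univ)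
    rwa [← total, add_sub_cancel] at this
  obtain ⟨Z, hZ, f', g', e⟩ := h1
  exact hΘ.mem_of_retract hZ f' g' e

end IsAngulated

end Factorization

/-! ### Angles inside the subcategory and removal of summands -/

variable {𝒞 : Type u} [Category.{v} 𝒞] [Preadditive 𝒞] [HasFiniteBiproducts 𝒞]

/-- Closure under summands speaks of biproducts; splitting the complementary idempotent provides the
second factor. -/
theorem IsAdditiveSubcategory.retract [IsIdempotentComplete 𝒞] {P : ObjectProperty 𝒞}
    (hP : IsAdditiveSubcategory P) {X Y : 𝒞} (i : Y ⟶ X) (p : X ⟶ Y) (h : i ≫ p = 𝟙 Y)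
    (hX : P X) : P Y := by
  obtain ⟨Z, j, q, hjq, hqj⟩ := IsIdempotentComplete.idempotents_split X (𝟙 X - p ≫ i)
    (by simp [reassoc_of% h])
  refine hP.summand (Y := Z) (hP.of_iso ⟨?_⟩ hX)
  have h1 : i ≫ q = 0 := by
    have : i ≫ q ≫ j = 0 := by rw [hqj]; simp [reassoc_of% h]
    rw [← Category.comp_id q, ← hjq, ← Category.assoc q, ← Category.assoc, this, zero_comp]
  have h2 : j ≫ p = 0 := by
    have : (q ≫ j) ≫ p = 0 := by rw [hqj]; simp [h]
    rw [← Category.id_comp (j ≫ p), ← hjq, Category.assoc, ← Category.assoc q, this, comp_zero]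
  refine ⟨biprod.lift p q, biprod.desc i j, by simp [hqj], ?_⟩
  ext <;> simp [h, h1, h2, hjq]

variable {S : 𝒞 ⥤ 𝒞} {n : ℕ} {Θ : Set (SigmaSeq S n)} {P : ObjectProperty 𝒞}

theorem SigmaSeq.sum_prop [IsIdempotentComplete 𝒞] [S.Additive] (hP : IsAdditiveSubcategory P)
    {A B : SigmaSeq S n} (j : ℕ) (hj : j ≤ n + 1) (hA : P (A.seq.obj' j)) (hB : P (B.seq.obj' j)) :
    P ((SigmaSeq.sum A B).seq.obj' j) := by
  have h : app' (biprod.fst : A.seq ⊞ B.seq ⟶ _) j hj ≫ app' biprod.inl j hj +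
      app' (biprod.snd : A.seq ⊞ B.seq ⟶ _) j hj ≫ app' biprod.inr j hj = 𝟙 _ :=
    congrArg (fun f : A.seq ⊞ B.seq ⟶ A.seq ⊞ B.seq => app' f j hj) biprod.total
  refine hP.retract (biprod.lift (app' (biprod.fst : A.seq ⊞ B.seq ⟶ _) j hj)
    (app' (biprod.snd : A.seq ⊞ B.seq ⟶ _) j hj))
    (biprod.desc (app' (biprod.inl : _ ⟶ A.seq ⊞ B.seq) j hj)
    (app' (biprod.inr : _ ⟶ A.seq ⊞ B.seq) j hj)) ?_ (hP.biprod hA hB)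
  rw [biprod.lift_desc]
  exact h

theorem disc_prop (hP : IsAdditiveSubcategory P) (i : ℕ) (hi : i ≤ n) {W : 𝒞} (hW : P W) (j : ℕ)
    (hj : j ≤ n + 1) : P ((disc n i W).obj' j) := by
  by_cases h1 : j = i
  · subst h1
    exact hP.of_iso ⟨(discFst n j hi W).symm⟩ hW
  by_cases h2 : j = i + 1
  · subst h2
    exact hP.of_iso ⟨(discSnd n i hi W).symm⟩ hW
  · exact hP.of_isZero (disc_isZero n i W j hj h1 h2)

/-- The objects of `T` are all in `P`. -/
def SigmaSeq.Within (T : SigmaSeq S n) (P : ObjectProperty 𝒞) : Prop :=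
  ∀ (i : ℕ) (hi : i ≤ n + 1), P (T.seq.obj' i)

/-- The first arrow of an angle with objects in `P`. -/
def IsFirstArrow (Θ : Set (SigmaSeq S n)) (P : ObjectProperty 𝒞) {A B : 𝒞} (f : A ⟶ B) : Prop :=
  ∃ T ∈ Θ, T.Within P ∧ ∃ (e₀ : T.seq.obj' 0 ≅ A) (e₁ : T.seq.obj' 1 ≅ B),
    T.seq.map' 0 1 ≫ e₁.hom = e₀.hom ≫ f

/-- The last arrow of the row of an angle with objects in `P`. -/
def IsFinalArrow (Θ : Set (SigmaSeq S n)) (P : ObjectProperty 𝒞) {A B : 𝒞} (f : A ⟶ B) : Prop :=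
  ∃ T ∈ Θ, T.Within P ∧ ∃ (e₀ : T.seq.obj' n ≅ A) (e₁ : T.seq.obj' (n + 1) ≅ B),
    T.seq.map' n (n + 1) ≫ e₁.hom = e₀.hom ≫ f

namespace IsAngulated

/-- The complement of an idempotent endomorphism of an angle. -/
theorem exists_complement [IsIdempotentComplete 𝒞] (hΘ : IsAngulated S n Θ) {T : SigmaSeq S n}
    (hT : T ∈ Θ) (ψ : T ⟶ T) (hψ : ψ.φ ≫ ψ.φ = ψ.φ) :
    ∃ T' ∈ Θ, ∃ (i : T' ⟶ T) (p : T ⟶ T'),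
      (∀ (j : ℕ) (hj : j ≤ n + 1), app' i.φ j hj ≫ app' p.φ j hj = 𝟙 _) ∧
      ∀ (j : ℕ) (hj : j ≤ n + 1), app' p.φ j hj ≫ app' i.φ j hj = 𝟙 _ - app' ψ.φ j hj := by
  have := hΘ.additive
  obtain ⟨T', i, p, hip, hpi⟩ := IsIdempotentComplete.idempotents_split T
    (SigmaSeq.idSub ψ) (SigmaSeq.hom_ext (by simp [SigmaSeq.idSub, hψ]))
  have hip' := congrArg SigmaSeq.Hom.φ hip
  have hpi' := congrArg SigmaSeq.Hom.φ hpi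
  exact ⟨T', hΘ.mem_of_retract hT i p hip', i, p, fun j hj => congr_app hip' _,
    fun j hj => congr_app hpi' _⟩

/-- Removal of a summand of the object in position `1` of an angle. -/
theorem exists_remove_first [IsIdempotentComplete 𝒞] (hΘ : IsAngulated S n Θ) (hn : 1 ≤ n)
    (hP : IsAdditiveSubcategory P) {T : SigmaSeq S n} (hT : T ∈ Θ) (hTP : T.Within P) {V C : 𝒞}
    (j : V ⟶ T.seq.obj' 1 (Nat.le_add_left 1 n)) (q : T.seq.obj' 1 (Nat.le_add_left 1 n) ⟶ V) (hjq : j ≫ q = 𝟙 V)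
    (hq : T.seq.map' 0 1 ≫ q = 0)
    (i : C ⟶ T.seq.obj' 1 (Nat.le_add_left 1 n)) (p : T.seq.obj' 1 (Nat.le_add_left 1 n) ⟶ C) (hip : i ≫ p = 𝟙 C)
    (hpi : p ≫ i + q ≫ j = 𝟙 _) : IsFirstArrow Θ P (T.seq.map' 0 1 ≫ p) := by
  have := hΘ.additive
  have hc := hΘ.isComplex hn hT
  -- Since `q` factors through the second arrow, `V` has a copy in position `2` as well. The
  -- idempotent `φ` below cuts out the disc on `V` in positions `1` and `2`, and its complement is
  -- the desired angle.
  obtain ⟨s, hs⟩ := hΘ.exists_desc_map_zero hn hT q hq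
  obtain ⟨φ, h1, h2, h3⟩ := exists_rowHom_two (X := T.seq) (Y := T.seq) 1 hn (q ≫ j)
    (s ≫ j ≫ T.seq.map' 1 2) (by rw [reassoc_of% hs, Category.assoc])
    (fun k hk => by
      obtain rfl : k = 0 := by omega
      rw [reassoc_of% hq, zero_comp])
    (fun k hk hk' => by subst hk; rw [Category.assoc, Category.assoc, hc.zero 1, comp_zero,
      comp_zero])
  have h2' : app' φ 2 = s ≫ j ≫ T.seq.map' 1 2 := h2
  have h0 : app' φ 0 = 0 := h3 0 (by omega) (by omega) (by omega)
  obtain ⟨T', hT', ι, π, hιπ, hπι⟩ := hΘ.exists_complement hT ⟨φ, by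
      rw [h0, S.map_zero, comp_zero]
      -- For `n = 1` position `2` is the right end, so compatibility with the last arrow is not
      -- vacuous.
      by_cases hn1 : n = 1
      · subst hn1
        rw [h2', Category.assoc, Category.assoc, hΘ.map_comp_last hn hT, comp_zero, comp_zero]
      · rw [h3 (n + 1) le_rfl (by omega) (by omega), zero_comp]⟩ (by
      refine row_ext fun k hk => ?_
      rw [← app'_comp]
      by_cases e1 : k = 1
      · subst e1
        rw [h1, Category.assoc, reassoc_of% hjq]
      by_cases e2 : k = 2
      · subst e2
        rw [h2', Category.assoc, Category.assoc, reassoc_of% hs, reassoc_of% hjq]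
      · rw [h3 k hk e1 e2, comp_zero])
  have hπι0 : app' π.φ 0 (by omega) ≫ app' ι.φ 0 (by omega) = 𝟙 _ := (hπι 0 (by omega)).trans (by
    dsimp only; rw [h0, sub_zero])
  have hπι1 : app' π.φ 1 (by omega) ≫ app' ι.φ 1 (by omega) = p ≫ i := (hπι 1 (by omega)).trans (by
    dsimp only; rw [h1, ← hpi, add_sub_cancel_right])
  refine ⟨T', hT', fun k hk => hP.retract _ _ (hιπ k hk) (hTP k hk),
    ⟨app' ι.φ 0, app' π.φ 0, hιπ 0 (by omega), hπι0⟩,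
    ⟨app' ι.φ 1 ≫ p, i ≫ app' π.φ 1, ?_, ?_⟩, ?_⟩
  · rw [Category.assoc, ← Category.assoc p, ← hπι1, Category.assoc, hιπ, Category.comp_id, hιπ]
  · rw [Category.assoc, reassoc_of% hπι1, hip, Category.comp_id, hip]
  · exact naturality'_assoc ι.φ 0 1 _ _ p

/-- Removal of a summand of the object in position `n` of an angle. -/
theorem exists_remove_final [IsIdempotentComplete 𝒞] (hΘ : IsAngulated S n Θ) (hn : 1 ≤ n)
    (hP : IsAdditiveSubcategory P) {T : SigmaSeq S n} (hT : T ∈ Θ) (hTP : T.Within P) {V C : 𝒞}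
    (j : V ⟶ T.seq.obj' n n.le_succ) (q : T.seq.obj' n n.le_succ ⟶ V) (hjq : j ≫ q = 𝟙 V)
    (hj : j ≫ T.seq.map' n (n + 1) = 0)
    (i : C ⟶ T.seq.obj' n n.le_succ) (p : T.seq.obj' n n.le_succ ⟶ C) (hip : i ≫ p = 𝟙 C)
    (hpi : p ≫ i + q ≫ j = 𝟙 _) : IsFinalArrow Θ P (i ≫ T.seq.map' n (n + 1)) := by
  have := hΘ.additive
  obtain ⟨m, rfl⟩ : ∃ m, n = m + 1 := ⟨n - 1, by omega⟩
  have hc := hΘ.isComplex hn hT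
  -- Dually, `j` lifts along the preceding arrow and the disc on `V` occupies positions `n - 1` and
  -- `n`.
  obtain ⟨s, hs⟩ := hΘ.exists_lift hn hT m (by omega) j hj
  obtain ⟨φ, h1, h2, h3⟩ := exists_rowHom_two (X := T.seq) (Y := T.seq) m (by omega)
    (T.seq.map' m (m + 1) ≫ q ≫ s) (q ≫ j) (by rw [Category.assoc, Category.assoc, hs])
    (fun k hk => by subst hk; rw [← Category.assoc, hc.zero k, zero_comp])
    (fun k hk hk' => by
      subst hk
      rw [Category.assoc]
      exact (congrArg (q ≫ ·) hj).trans comp_zero)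
  have hl : app' φ (m + 1 + 1) = 0 := h3 _ (by omega) (by omega) (by omega)
  obtain ⟨T', hT', ι, π, hιπ, hπι⟩ := hΘ.exists_complement hT ⟨φ, by
      rw [hl, zero_comp]
      by_cases hm : m = 0
      · subst hm
        rw [h1, S.map_comp, ← Category.assoc]
        exact (congrArg (· ≫ _) (hΘ.last_comp_map hn hT)).trans zero_comp
      · rw [h3 0 (by omega) (by omega) (by omega), S.map_zero, comp_zero]⟩ (by
      refine row_ext fun k hk => ?_
      rw [← app'_comp]
      by_cases e1 : k = m
      · subst e1
        rw [h1, Category.assoc, Category.assoc, reassoc_of% hs, reassoc_of% hjq]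
      by_cases e2 : k = m + 1
      · subst e2
        rw [h2, Category.assoc, reassoc_of% hjq]
      · rw [h3 k hk e1 e2, comp_zero])
  have hπι0 : app' π.φ (m + 1 + 1) le_rfl ≫ app' ι.φ (m + 1 + 1) le_rfl = 𝟙 _ :=
    (hπι _ (by omega)).trans (by dsimp only; rw [hl, sub_zero])
  have hπι1 : app' π.φ (m + 1) (by omega) ≫ app' ι.φ (m + 1) (by omega) = p ≫ i := (hπι _ (by omega)).trans (by
    dsimp only; rw [h2, ← hpi, add_sub_cancel_right])
  refine ⟨T', hT', fun k hk => hP.retract _ _ (hιπ k hk) (hTP k hk),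
    ⟨app' ι.φ (m + 1) ≫ p, i ≫ app' π.φ (m + 1), ?_, ?_⟩,
    ⟨app' ι.φ (m + 1 + 1), app' π.φ (m + 1 + 1), hιπ _ (by omega), hπι0⟩, ?_⟩
  · rw [Category.assoc, ← Category.assoc p, ← hπι1, Category.assoc, hιπ, Category.comp_id, hιπ]
  · rw [Category.assoc, reassoc_of% hπι1, hip, Category.comp_id, hip]
  · rw [Category.assoc, ← reassoc_of% hπι1, reassoc_of% (hιπ (m + 1) (by omega))]
    exact naturality' ι.φ (m + 1) (m + 1 + 1)

end IsAngulated

/-! ### Composition of inflations and of deflations -/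

variable {𝒞 : Type u} [Category.{v} 𝒞] [Preadditive 𝒞]

section Exchange

variable {V C T : 𝒞} {inl : V ⟶ T} {inr : C ⟶ T} {fst : T ⟶ V} {snd : T ⟶ C}

/-- A change of basis on `V ⊞ C`. An arrow `(x, 0)` into it, with `x ≫ c = h` and `h ≫ k = x`, gets
the coordinate `h` in `C` and `x - x ≫ c ≫ k = 0` in `V`. -/
theorem exchange_first (h1 : inl ≫ fst = 𝟙 V) (h2 : inl ≫ snd = 0) (h3 : inr ≫ fst = 0)
    (h4 : inr ≫ snd = 𝟙 C) (h5 : fst ≫ inl + snd ≫ inr = 𝟙 T) (c : V ⟶ C) (k : C ⟶ V) :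
    (inl - c ≫ inr) ≫ (fst - fst ≫ c ≫ k - snd ≫ k) = 𝟙 V ∧
    (k ≫ inl + inr - k ≫ c ≫ inr) ≫ (fst ≫ c + snd) = 𝟙 C ∧
    (fst ≫ c + snd) ≫ (k ≫ inl + inr - k ≫ c ≫ inr) +
      (fst - fst ≫ c ≫ k - snd ≫ k) ≫ (inl - c ≫ inr) = 𝟙 T := by
  refine ⟨?_, ?_, ?_⟩
  · simp [h1, h2, h3, h4, reassoc_of% h1, reassoc_of% h2, reassoc_of% h3, reassoc_of% h4]
  · simp [h1, h2, h3, h4, reassoc_of% h1, reassoc_of% h2, reassoc_of% h3, reassoc_of% h4]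
  · rw [← h5]
    simp only [Preadditive.add_comp, Preadditive.comp_add, Preadditive.sub_comp,
      Preadditive.comp_sub, Category.assoc]
    abel

/-- The dual change of basis. An arrow out of the biproduct that is `y` on `V` and zero on `C`, with
`c ≫ y = h` and `k ≫ h = y`, becomes zero on the new copy of `V` and `h` on the new copy of `C`. -/
theorem exchange_final (h1 : inl ≫ fst = 𝟙 V) (h2 : inl ≫ snd = 0) (h3 : inr ≫ fst = 0)
    (h4 : inr ≫ snd = 𝟙 C) (h5 : fst ≫ inl + snd ≫ inr = 𝟙 T) (k : V ⟶ C) (c : C ⟶ V) :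
    (inl - k ≫ c ≫ inl - k ≫ inr) ≫ (fst - snd ≫ c) = 𝟙 V ∧
    (c ≫ inl + inr) ≫ (fst ≫ k + snd - snd ≫ c ≫ k) = 𝟙 C ∧
    (fst ≫ k + snd - snd ≫ c ≫ k) ≫ (c ≫ inl + inr) +
      (fst - snd ≫ c) ≫ (inl - k ≫ c ≫ inl - k ≫ inr) = 𝟙 T := by
  refine ⟨?_, ?_, ?_⟩
  · simp [h1, h2, h3, h4, reassoc_of% h1, reassoc_of% h2, reassoc_of% h3, reassoc_of% h4]
  · simp [h1, h2, h3, h4, reassoc_of% h1, reassoc_of% h2, reassoc_of% h3, reassoc_of% h4]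
  · rw [← h5]
    simp only [Preadditive.add_comp, Preadditive.comp_add, Preadditive.sub_comp,
      Preadditive.comp_sub, Category.assoc]
    abel

end Exchange

variable [HasFiniteBiproducts 𝒞]

variable {S : 𝒞 ⥤ 𝒞} {n : ℕ} {Θ : Set (SigmaSeq S n)} {P : ObjectProperty 𝒞}

theorem row_biprod (A B : ComposableArrows 𝒞 (n + 1)) (j : ℕ) (hj : j ≤ n + 1) :
    app' (biprod.inl : A ⟶ A ⊞ B) j hj ≫ app' (biprod.fst : A ⊞ B ⟶ A) j hj = 𝟙 _ ∧
    app' (biprod.inl : A ⟶ A ⊞ B) j hj ≫ app' (biprod.snd : A ⊞ B ⟶ B) j hj = 0 ∧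
    app' (biprod.inr : B ⟶ A ⊞ B) j hj ≫ app' (biprod.fst : A ⊞ B ⟶ A) j hj = 0 ∧
    app' (biprod.inr : B ⟶ A ⊞ B) j hj ≫ app' (biprod.snd : A ⊞ B ⟶ B) j hj = 𝟙 _ ∧
    app' (biprod.fst : A ⊞ B ⟶ A) j hj ≫ app' (biprod.inl : A ⟶ A ⊞ B) j hj +
      app' (biprod.snd : A ⊞ B ⟶ B) j hj ≫ app' (biprod.inr : B ⟶ A ⊞ B) j hj = 𝟙 _ :=
  ⟨congr_app (biprod.inl_fst (X := A) (Y := B)) _, congr_app (biprod.inl_snd (X := A) (Y := B)) _,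
    congr_app (biprod.inr_fst (X := A) (Y := B)) _, congr_app (biprod.inr_snd (X := A) (Y := B)) _,
    congr_app (biprod.total (X := A) (Y := B)) _⟩

omit [Preadditive 𝒞] [HasFiniteBiproducts 𝒞] in
theorem IsFirstArrow.of_iso {A B A' B' : 𝒞} {f : A ⟶ B} (hf : IsFirstArrow Θ P f) (e : A ≅ A')
    (e' : B ≅ B') (f' : A' ⟶ B') (h : f ≫ e'.hom = e.hom ≫ f') : IsFirstArrow Θ P f' := by
  obtain ⟨T, hT, hTP, e₀, e₁, w⟩ := hf
  refine ⟨T, hT, hTP, e₀ ≪≫ e, e₁ ≪≫ e', ?_⟩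
  rw [Iso.trans_hom, Iso.trans_hom, reassoc_of% w, h, Category.assoc]

omit [Preadditive 𝒞] [HasFiniteBiproducts 𝒞] in
theorem IsFinalArrow.of_iso {A B A' B' : 𝒞} {f : A ⟶ B} (hf : IsFinalArrow Θ P f) (e : A ≅ A')
    (e' : B ≅ B') (f' : A' ⟶ B') (h : f ≫ e'.hom = e.hom ≫ f') : IsFinalArrow Θ P f' := by
  obtain ⟨T, hT, hTP, e₀, e₁, w⟩ := hf
  refine ⟨T, hT, hTP, e₀ ≪≫ e, e₁ ≪≫ e', ?_⟩
  rw [Iso.trans_hom, Iso.trans_hom, reassoc_of% w, h, Category.assoc]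

namespace IsAngulated

theorem exists_lift_suspension_map (hΘ : IsAngulated S n Θ) (hn : 1 ≤ n) {T : SigmaSeq S n}
    (hT : T ∈ Θ) {W : 𝒞} (g : W ⟶ S.obj (T.seq.obj' 1)) (hg : g ≫ S.map (T.seq.map' 1 2) = 0) :
    ∃ h : W ⟶ S.obj (T.seq.obj' 0), h ≫ S.map (T.seq.map' 0 1) = g := by
  have := hΘ.isEquivalence
  have := hΘ.additive
  obtain ⟨U, ⟨u⟩⟩ := hΘ.exists_desuspension W
  obtain ⟨g', hg'⟩ := S.map_surjective (u.hom ≫ g)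
  obtain ⟨h, hh⟩ := hΘ.exists_lift hn hT 0 hn g' (S.map_injective (by
    rw [S.map_comp, hg', S.map_zero, Category.assoc]
    exact (congrArg (u.hom ≫ ·) hg).trans comp_zero))
  refine ⟨u.inv ≫ S.map h, ?_⟩
  have : S.map h ≫ S.map (T.seq.map' 0 1) = u.hom ≫ g := by
    rw [← hg', ← hh]
    exact (S.map_comp _ _).symm
  rw [Category.assoc, this, u.inv_hom_id_assoc]

/-- A morphism that factors through, and is a factor of, the first arrow of an angle. -/
theorem isFirstArrow_of_factors [IsIdempotentComplete 𝒞] (hΘ : IsAngulated S n Θ) (hn : 1 ≤ n)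
    (hP : IsAdditiveSubcategory P) {V : SigmaSeq S n} (hV : V ∈ Θ) (hVP : V.Within P) {C : 𝒞}
    (hC : P C) (h : V.seq.obj' 0 ⟶ C) (k : C ⟶ V.seq.obj' 1) (hk : V.seq.map' 0 1 = h ≫ k)
    (c : V.seq.obj' 1 ⟶ C) (hc : V.seq.map' 0 1 ≫ c = h) : IsFirstArrow Θ P h := by
  have := hΘ.additive
  -- The disc in positions `1` and `2` leaves position `0` unchanged up to isomorphism and makes
  -- room for `C` next to `V₁`; `exchange_first` then moves the first arrow into `C`.
  let D := discSeq S n 1 C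
  obtain ⟨r1, r2, r3, r4, r5⟩ := row_biprod V.seq D.seq 1 (by omega)
  obtain ⟨s1, s2, s3, s4, s5⟩ := row_biprod V.seq D.seq 0 (by omega)
  let d := discFst n 1 hn C
  have hD0 : IsZero (D.seq.obj' 0) := disc_isZero n 1 C 0 (by omega) (by omega) (by omega)
  have hs5 : app' (biprod.fst : V.seq ⊞ D.seq ⟶ _) 0 (by omega) ≫
      app' (biprod.inl : _ ⟶ V.seq ⊞ D.seq) 0 (by omega) = 𝟙 _ := by
    rw [← s5, hD0.eq_of_tgt (app' (biprod.snd : V.seq ⊞ D.seq ⟶ _) 0 _) 0, zero_comp, add_zero]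
  have hfst := naturality' (biprod.fst : V.seq ⊞ D.seq ⟶ _) 0 1
  have hsnd := naturality' (biprod.snd : V.seq ⊞ D.seq ⟶ _) 0 1
  have hsnd' : (V.seq ⊞ D.seq).map' 0 1 ≫
      app' (biprod.snd : V.seq ⊞ D.seq ⟶ _) 1 (by omega) = 0 := by
    rw [hsnd, hD0.eq_of_tgt (app' (biprod.snd : V.seq ⊞ D.seq ⟶ _) 0 _) 0, zero_comp]
  obtain ⟨x1, x2, x3⟩ := exchange_first (snd := app' (biprod.snd : V.seq ⊞ D.seq ⟶ _) 1 (by omega) ≫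
      d.hom) (inr := d.inv ≫ app' (biprod.inr : _ ⟶ V.seq ⊞ D.seq) 1 (by omega)) r1
    (by rw [reassoc_of% r2, zero_comp]) (by rw [Category.assoc, r3, comp_zero])
    (by rw [Category.assoc, reassoc_of% r4]; exact d.inv_hom_id)
    (by rw [Category.assoc, d.hom_inv_id_assoc, r5]) c k
  refine (hΘ.exists_remove_first hn hP (hΘ.sum_mem' hV (hΘ.discSeq_mem 1 hn C))
    (fun j hj => SigmaSeq.sum_prop hP j hj (hVP j hj) (disc_prop hP 1 hn hC j hj))
    _ _ x1 ?_ _ _ x2 x3).of_iso ⟨_, _, hs5, s1⟩ (Iso.refl _) h ?_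
  · change (V.seq ⊞ D.seq).map' 0 1 ≫ _ = 0
    simp only [Preadditive.comp_sub, Category.assoc]
    rw [reassoc_of% hsnd', reassoc_of% hfst, hfst, reassoc_of% hc, hk, zero_comp, sub_zero,
      sub_self]
  · change ((V.seq ⊞ D.seq).map' 0 1 ≫ _) ≫ 𝟙 _ = _ ≫ h
    simp only [Preadditive.comp_add, Category.comp_id]
    rw [reassoc_of% hsnd', reassoc_of% hfst, hc, zero_comp, add_zero]

/-- A morphism that factors through, and is a factor of, the last arrow of the row of an angle. -/
theorem isFinalArrow_of_factors [IsIdempotentComplete 𝒞] (hΘ : IsAngulated S n Θ) (hn : 1 ≤ n)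
    (hP : IsAdditiveSubcategory P) {V : SigmaSeq S n} (hV : V ∈ Θ) (hVP : V.Within P) {B : 𝒞}
    (hB : P B) (h : B ⟶ V.seq.obj' (n + 1)) (k : V.seq.obj' n ⟶ B)
    (hk : V.seq.map' n (n + 1) = k ≫ h)
    (c : B ⟶ V.seq.obj' n) (hc : c ≫ V.seq.map' n (n + 1) = h) : IsFinalArrow Θ P h := by
  have := hΘ.additive
  obtain ⟨m, rfl⟩ : ∃ m, n = m + 1 := ⟨n - 1, by omega⟩
  -- The disc ends at position `m + 1 = n`, so the right end of `V` is unchanged up to isomorphism.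
  let D := discSeq S (m + 1) m B
  obtain ⟨r1, r2, r3, r4, r5⟩ := row_biprod V.seq D.seq (m + 1) (by omega)
  obtain ⟨s1, s2, s3, s4, s5⟩ := row_biprod V.seq D.seq (m + 1 + 1) (by omega)
  let d := discSnd (m + 1) m (by omega) B
  have hD0 : IsZero (D.seq.obj' (m + 1 + 1)) :=
    disc_isZero (m + 1) m B (m + 1 + 1) (by omega) (by omega) (by omega)
  have hs5 : app' (biprod.fst : V.seq ⊞ D.seq ⟶ _) (m + 1 + 1) (by omega) ≫
      app' (biprod.inl : _ ⟶ V.seq ⊞ D.seq) (m + 1 + 1) (by omega) = 𝟙 _ := by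
    rw [← s5, hD0.eq_of_tgt (app' (biprod.snd : V.seq ⊞ D.seq ⟶ _) (m + 1 + 1) _) 0, zero_comp,
      add_zero]
  have hinl := naturality' (biprod.inl : _ ⟶ V.seq ⊞ D.seq) (m + 1) (m + 1 + 1)
  have hinr := naturality' (biprod.inr : _ ⟶ V.seq ⊞ D.seq) (m + 1) (m + 1 + 1)
  have hinr' : app' (biprod.inr : _ ⟶ V.seq ⊞ D.seq) (m + 1) (by omega) ≫
      (V.seq ⊞ D.seq).map' (m + 1) (m + 1 + 1) = 0 := by
    rw [← hinr, hD0.eq_of_tgt (D.seq.map' (m + 1) (m + 1 + 1)) 0, zero_comp]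
  obtain ⟨x1, x2, x3⟩ := exchange_final
    (snd := app' (biprod.snd : V.seq ⊞ D.seq ⟶ _) (m + 1) (by omega) ≫ d.hom)
    (inr := d.inv ≫ app' (biprod.inr : _ ⟶ V.seq ⊞ D.seq) (m + 1) (by omega)) r1
    (by rw [reassoc_of% r2, zero_comp]) (by rw [Category.assoc, r3, comp_zero])
    (by rw [Category.assoc, reassoc_of% r4]; exact d.inv_hom_id)
    (by rw [Category.assoc, d.hom_inv_id_assoc, r5]) k c
  refine (hΘ.exists_remove_final hn hP (hΘ.sum_mem' hV (hΘ.discSeq_mem m (by omega) B))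
    (fun j hj => SigmaSeq.sum_prop hP j hj (hVP j hj) (disc_prop hP m (by omega) hB j hj))
    _ _ x1 ?_ _ _ x2 x3).of_iso (Iso.refl _) ⟨_, _, hs5, s1⟩ h ?_
  · change _ ≫ (V.seq ⊞ D.seq).map' (m + 1) (m + 1 + 1) = 0
    simp only [Preadditive.sub_comp, Category.assoc]
    rw [hinr', ← hinl, reassoc_of% hc, comp_zero, comp_zero, sub_zero, reassoc_of% hk, sub_self]
  · change (_ ≫ (V.seq ⊞ D.seq).map' (m + 1) (m + 1 + 1)) ≫ _ = 𝟙 _ ≫ h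
    simp only [Preadditive.add_comp, Category.assoc, Category.id_comp]
    rw [reassoc_of% hinr', ← reassoc_of% hinl, s1, zero_comp, comp_zero, add_zero,
      Category.comp_id, hc]

/-- The angle `V` is built from an extension with values in `S X₀` that `S h` kills and through
which the weak kernel `q` of `S h` factors. Consequently `h` and the first arrow of `V` factor
through each other, and `isFirstArrow_of_factors` applies. -/
theorem isFirstArrow_comp [IsIdempotentComplete 𝒞] (hΘ : IsAngulated S n Θ) (hn : 1 ≤ n)
    (hP : IsAdditiveSubcategory P) (hext : IsExtensionClosed Θ P) {A B C : 𝒞} {f : A ⟶ B}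
    {g : B ⟶ C} (hf : IsFirstArrow Θ P f) (hg : IsFirstArrow Θ P g) :
    IsFirstArrow Θ P (f ≫ g) := by
  have := hΘ.additive
  obtain ⟨X, hX, hXP, e₀, e₁, hXf⟩ := hf
  obtain ⟨Y, hY, hYP, e₀', e₁', hYg⟩ := hg
  let w : X.seq.obj' 1 ≅ Y.seq.obj' 0 := e₁ ≪≫ e₀'.symm
  have hw : w.hom ≫ e₀'.hom = e₁.hom := by
    rw [Iso.trans_hom, Category.assoc, Iso.symm_hom, e₀'.inv_hom_id, Category.comp_id]
  obtain ⟨h, hh⟩ : ∃ h : X.seq.obj' 0 ⟶ Y.seq.obj' 1, h = X.seq.map' 0 1 ≫ w.hom ≫ Y.seq.map' 0 1 := ⟨_, rfl⟩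
  suffices IsFirstArrow Θ P h from this.of_iso e₀ e₁' _ (by
    rw [hh, Category.assoc, Category.assoc, hYg, ← reassoc_of% hXf, reassoc_of% hw])
  -- `W` measures the obstruction to lifting `Yₙ₊₁ ⟶ S Y₀ ≅ S X₁` to `S X₀`: after restriction to
  -- `Wₙ` the composite to `S X₂` vanishes, which yields `η`.
  obtain ⟨W, hW, ⟨a0, a1, hWl⟩, hWP⟩ := hext (hXP 2 (by omega)) (hYP (n + 1) le_rfl)
    (Y.last ≫ S.map (w.inv ≫ X.seq.map' 1 2))
  have ha : (W.seq.map' n (n + 1) ≫ a1.hom) ≫ Y.last ≫ S.map (w.inv ≫ X.seq.map' 1 2) = 0 := by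
    rw [Category.assoc, ← hWl, reassoc_of% (hΘ.map_comp_last hn hW), zero_comp]
  obtain ⟨η, hη⟩ : ∃ η : W.seq.obj' n ⟶ S.obj (X.seq.obj' 0), η ≫ S.map (X.seq.map' 0 1) =
      (W.seq.map' n (n + 1) ≫ a1.hom) ≫ Y.last ≫ S.map w.inv := by
    refine hΘ.exists_lift_suspension_map hn hX _ ?_
    rw [S.map_comp] at ha
    simpa only [Category.assoc] using ha
  obtain ⟨V, hV, ⟨v0, v1, hVl⟩, hVP⟩ := hext (hXP 0 (by omega))
    (hP.biprod (hWP n (by omega)) (hXP (n + 1) le_rfl)) (biprod.desc η X.last)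
  have hx := hΘ.last_comp_map hn hX
  have hy := hΘ.last_comp_map hn hY
  have hv := hΘ.last_comp_map hn hV
  -- Both components `η` and `X.last` are killed by `S h`, so `h` factors through the first arrow of
  -- `V`.
  obtain ⟨c, hc⟩ := hΘ.exists_desc_first hn hV (v0.hom ≫ h) (by
    rw [S.map_comp, reassoc_of% hVl, hh, S.map_comp, S.map_comp]
    refine (congrArg (v1.hom ≫ ·) ?_).trans comp_zero
    refine biprod.hom_ext' _ _ ?_ ?_
    · rw [biprod.inl_desc_assoc, reassoc_of% hη, ← S.map_comp_assoc, w.inv_hom_id, S.map_id,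
        Category.id_comp, hy, comp_zero, comp_zero, comp_zero]
    · rw [biprod.inr_desc_assoc, reassoc_of% hx, zero_comp, comp_zero])
  -- This angle on `h` need not lie inside `P`; it only serves to test which arrows factor through
  -- `h`.
  obtain ⟨Z, hZ, z0, z1, hz⟩ := hΘ.exists_angle h
  have hzl := hΘ.last_comp_map hn hZ
  obtain ⟨q, hq⟩ : ∃ q, q = Z.last ≫ S.map z0.hom := ⟨_, rfl⟩
  have hqh : q ≫ S.map h = 0 := by
    rw [hq, Category.assoc, ← S.map_comp, ← hz, S.map_comp, reassoc_of% hzl, zero_comp]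
  have hqh' := hqh
  rw [hh, S.map_comp, S.map_comp] at hqh'
  obtain ⟨t₀, ht₀⟩ := hΘ.exists_lift_suspension hn hY (q ≫ S.map (X.seq.map' 0 1) ≫ S.map w.hom)
    (by simpa only [Category.assoc] using hqh')
  have ht₀' : t₀ ≫ Y.last ≫ S.map w.inv = q ≫ S.map (X.seq.map' 0 1) := by
    rw [reassoc_of% ht₀, ← S.map_comp, w.hom_inv_id, S.map_id, Category.comp_id]
  obtain ⟨t, ht⟩ := hΘ.exists_lift_last hn hW (t₀ ≫ a1.inv) (by
    rw [← cancel_mono (S.map a0.hom), Category.assoc, Category.assoc, hWl, a1.inv_hom_id_assoc,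
      S.map_comp, reassoc_of% ht₀', ← S.map_comp, hΘ.map_comp_map_zero hn hX, S.map_zero,
      comp_zero, zero_comp])
  -- `t ≫ η` already agrees with `q` in `S X₁`; the remaining difference comes from `Xₙ₊₁`, so `q`
  -- factors through `(η, X.last)`.
  obtain ⟨r, hr⟩ := hΘ.exists_lift_suspension hn hX (q - t ≫ η) (by
    rw [Preadditive.sub_comp, Category.assoc, hη, ← Category.assoc t, reassoc_of% ht,
      a1.inv_hom_id, Category.comp_id, ht₀', sub_self])
  have hqV : q = (biprod.lift t r ≫ v1.inv) ≫ V.last ≫ S.map v0.hom := by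
    rw [hVl, Category.assoc, v1.inv_hom_id_assoc, biprod.lift_desc, hr, add_sub_cancel]
  obtain ⟨k, hk⟩ := hΘ.exists_desc_first hn hZ (z0.hom ≫ v0.inv ≫ V.seq.map' 0 1) (by
    rw [S.map_comp, ← Category.assoc, ← hq, hqV, S.map_comp, Category.assoc, Category.assoc,
      Category.assoc, ← S.map_comp_assoc, v0.hom_inv_id, S.map_id, Category.id_comp, hv, comp_zero, comp_zero])
  refine (hΘ.isFirstArrow_of_factors hn hP hV hVP (hYP 1 (by omega)) (v0.hom ≫ h) (z1.inv ≫ k)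
    ?_ c hc).of_iso v0 (Iso.refl _) h (Category.comp_id _)
  rw [← cancel_epi v0.inv, ← cancel_epi z0.hom, ← hk, Category.assoc, v0.inv_hom_id_assoc,
    ← reassoc_of% hz, z1.hom_inv_id_assoc]

/-- The dual construction: `W` is an extension of `Yₙ₋₁` by `X₀`, `η` arises by factoring through
`Yₙ₊₁`, and `V` realizes an extension `θ` with values in `S (W₁ ⊞ Y₀)`. It satisfies `h ≫ θ = 0`,
and the weak cokernel `q` of `h` factors through `θ`. -/
theorem isFinalArrow_comp [IsIdempotentComplete 𝒞] (hΘ : IsAngulated S n Θ) (hn : 1 ≤ n)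
    (hP : IsAdditiveSubcategory P) (hext : IsExtensionClosed Θ P) {A B C : 𝒞} {f : A ⟶ B}
    {g : B ⟶ C} (hf : IsFinalArrow Θ P f) (hg : IsFinalArrow Θ P g) :
    IsFinalArrow Θ P (f ≫ g) := by
  have := hΘ.additive
  obtain ⟨m, rfl⟩ : ∃ m, n = m + 1 := ⟨n - 1, by omega⟩
  obtain ⟨X, hX, hXP, e₀, e₁, hXf⟩ := hf
  obtain ⟨Y, hY, hYP, e₀', e₁', hYg⟩ := hg
  let w : X.seq.obj' (m + 1 + 1) ≅ Y.seq.obj' (m + 1) := e₁ ≪≫ e₀'.symm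
  have hw : w.hom ≫ e₀'.hom = e₁.hom := by
    rw [Iso.trans_hom, Category.assoc, Iso.symm_hom, e₀'.inv_hom_id, Category.comp_id]
  obtain ⟨h, hh⟩ : ∃ h : X.seq.obj' (m + 1) ⟶ Y.seq.obj' (m + 1 + 1),
    h = X.seq.map' (m + 1) (m + 1 + 1) ≫ w.hom ≫
    Y.seq.map' (m + 1) (m + 1 + 1) := ⟨_, rfl⟩
  suffices IsFinalArrow Θ P h from this.of_iso e₀ e₁' _ (by
    rw [hh, Category.assoc, Category.assoc, hYg, ← reassoc_of% hXf, reassoc_of% hw])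
  have hx := hΘ.map_comp_last hn hX
  have hy := hΘ.map_comp_last hn hY
  have hyc : Y.seq.map' m (m + 1) ≫ Y.seq.map' (m + 1) (m + 1 + 1) = 0 :=
    (hΘ.isComplex hn hY).zero m
  obtain ⟨W, hW, ⟨a0, a1, hWl⟩, hWP⟩ := hext (hXP 0 (by omega)) (hYP m (by omega))
    (Y.seq.map' m (m + 1) ≫ w.inv ≫ X.last)
  have hwl := hΘ.last_comp_map hn hW
  have ha : (Y.seq.map' m (m + 1) ≫ w.inv ≫ X.last) ≫ S.map a0.inv ≫ S.map (W.seq.map' 0 1) =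
      0 := by
    rw [← cancel_epi a1.hom, ← Category.assoc, ← hWl, Category.assoc, ← S.map_comp_assoc, a0.hom_inv_id, S.map_id,
      Category.id_comp, hwl, comp_zero]
  obtain ⟨η, hη⟩ := hΘ.exists_desc hn hY m (by omega)
    (w.inv ≫ X.last ≫ S.map a0.inv ≫ S.map (W.seq.map' 0 1))
    (by simpa only [Category.assoc] using ha)
  obtain ⟨θ, hθ⟩ : ∃ θ, θ = η ≫ S.map (biprod.inl : _ ⟶ W.seq.obj' 1 ⊞ Y.seq.obj' 0) +
    Y.last ≫ S.map biprod.inr := ⟨_, rfl⟩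
  obtain ⟨V, hV, ⟨b0, b1, hVl⟩, hVP⟩ := hext
    (hP.biprod (hWP 1 (by omega)) (hYP 0 (by omega))) (hYP (m + 1 + 1) le_rfl) θ
  have hhθ : h ≫ θ = 0 := by
    rw [hθ, hh, Preadditive.comp_add, Category.assoc, Category.assoc, Category.assoc,
      Category.assoc, reassoc_of% hη, w.hom_inv_id_assoc, reassoc_of% hx, reassoc_of% hy, zero_comp,
      zero_comp, comp_zero, comp_zero, add_zero]
  obtain ⟨c, hc⟩ := hΘ.exists_lift_last hn hV (h ≫ b1.inv) (by
    rw [← cancel_mono (S.map b0.hom), Category.assoc, Category.assoc, hVl, b1.inv_hom_id_assoc,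
      hhθ, zero_comp])
  have hvθ : (V.seq.map' (m + 1) (m + 1 + 1) ≫ b1.hom) ≫ θ = 0 := by
    rw [Category.assoc, ← hVl, reassoc_of% (hΘ.map_comp_last hn hV), zero_comp]
  obtain ⟨Z, hZ, z0, z1, hz⟩ := hΘ.exists_angle h
  obtain ⟨q, hq⟩ : ∃ q : Y.seq.obj' (m + 1 + 1) ⟶ Z.seq.obj' 2, q = z1.inv ≫ Z.seq.map' 1 2 := ⟨_, rfl⟩
  have hhq : h ≫ q = 0 := by
    rw [hq, ← cancel_epi z0.hom, ← reassoc_of% hz, z1.hom_inv_id_assoc,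
      hΘ.map_comp_map_zero hn hZ, comp_zero]
  rw [hh, Category.assoc, Category.assoc] at hhq
  obtain ⟨t₀, ht₀⟩ := hΘ.exists_desc_last hn hX _ hhq
  obtain ⟨t, ht⟩ := hΘ.exists_desc_suspension hn hW (S.map a0.hom ≫ t₀) (by
    rw [reassoc_of% hWl, ht₀, w.inv_hom_id_assoc, reassoc_of% hyc, zero_comp, comp_zero])
  obtain ⟨r, hr⟩ := hΘ.exists_desc_last hn hY (q - η ≫ t) (by
    rw [Preadditive.comp_sub, reassoc_of% hη, ht, ← S.map_comp_assoc, a0.inv_hom_id, S.map_id,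
      Category.id_comp, ht₀, w.inv_hom_id_assoc, sub_self])
  -- Since the last arrow of the row of `V` is killed by `θ`, it is now killed by `q`, and exactness
  -- of `Z` makes it factor through `h`.
  have hqθ : q = θ ≫ (S.map biprod.fst ≫ t + S.map biprod.snd ≫ r) := by
    rw [hθ, Preadditive.add_comp, Preadditive.comp_add, Preadditive.comp_add, Category.assoc,
      Category.assoc, Category.assoc, Category.assoc, ← S.map_comp_assoc, ← S.map_comp_assoc,
      ← S.map_comp_assoc, ← S.map_comp_assoc, biprod.inl_fst, biprod.inl_snd, biprod.inr_fst,
      biprod.inr_snd, S.map_id, S.map_id, S.map_zero, S.map_zero, zero_comp, zero_comp, comp_zero,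
      comp_zero, Category.id_comp, Category.id_comp, hr]
    abel
  obtain ⟨k, hk⟩ := hΘ.exists_lift hn hZ 0 (by omega)
    ((V.seq.map' (m + 1) (m + 1 + 1) ≫ b1.hom) ≫ z1.inv) (by
      have : (V.seq.map' (m + 1) (m + 1 + 1) ≫ b1.hom) ≫ q = 0 := by
        rw [hqθ, ← Category.assoc, hvθ, zero_comp]
      rw [hq] at this
      rw [Category.assoc]
      exact this)
  refine (hΘ.isFinalArrow_of_factors hn hP hV hVP (hXP (m + 1) (by omega)) (h ≫ b1.inv)
    (k ≫ z0.hom) ?_ c hc).of_iso (Iso.refl _) b1 h (by simp)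
  have hk' : k ≫ Z.seq.map' 0 1 ≫ z1.hom = V.seq.map' (m + 1) (m + 1 + 1) ≫ b1.hom := by
    rw [← Category.assoc, ← cancel_mono z1.inv, Category.assoc, z1.hom_inv_id, Category.comp_id]
    exact hk
  rw [← cancel_mono b1.hom, Category.assoc, Category.assoc, Category.assoc, b1.inv_hom_id,
    Category.comp_id, ← hz, hk']

end IsAngulated

/-! ### Mapping cones and cocones with an invertible end component -/

variable {𝒞 : Type u} [Category.{v} 𝒞] [Preadditive 𝒞] [HasFiniteBiproducts 𝒞]
  {S : 𝒞 ⥤ 𝒞} {n : ℕ} {Θ : Set (SigmaSeq S n)}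

omit [HasFiniteBiproducts 𝒞] in
theorem sub_comp_self_idem {X Z : 𝒞} (i : Z ⟶ X) (p : X ⟶ Z) (h : i ≫ p = 𝟙 Z) :
    (𝟙 X - p ≫ i) ≫ (𝟙 X - p ≫ i) = 𝟙 X - p ≫ i := by
  simp [reassoc_of% h]

omit [HasFiniteBiproducts 𝒞] in
theorem ofComponents_comp_map_iso [HasBinaryBiproducts 𝒞] {A B A' B' B'' : 𝒞} (x : A ⟶ A')
    (b : A ⟶ B') (y : B ⟶ B') (u : B'' ≅ A') :
    Biprod.ofComponents (-x ≫ u.inv) b 0 y ≫ (biprod.mapIso u (Iso.refl B')).hom =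
      Biprod.ofComponents (-x) b 0 y := by
  apply biprod.hom_ext' <;> apply biprod.hom_ext <;> simp [Biprod.ofComponents]

omit [HasFiniteBiproducts 𝒞] in
theorem mapIso_hom_comp_desc [HasBinaryBiproducts 𝒞] {A A' B W : 𝒞} (u : A ≅ A') (f : A' ⟶ W)
    (g : B ⟶ W) :
    (biprod.mapIso u (Iso.refl B)).hom ≫ biprod.desc f g = biprod.desc (u.hom ≫ f) g := by
  apply biprod.hom_ext' <;> simp

namespace IsAngulated

/-- An angle is reduced by replacing its end objects by retracts that carry its arrows. -/
theorem exists_trim_ends [IsIdempotentComplete 𝒞] (hΘ : IsAngulated S n Θ) (hn : 1 ≤ n)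
    {T : SigmaSeq S n} (hT : T ∈ Θ) {Z Z' : 𝒞} (i : Z ⟶ T.seq.obj' 0 (Nat.zero_le _))
    (p : T.seq.obj' 0 (Nat.zero_le _) ⟶ Z) (hip : i ≫ p = 𝟙 Z)
    (hpi : p ≫ i ≫ T.seq.map' 0 1 = T.seq.map' 0 1)
    (i' : Z' ⟶ T.seq.obj' (n + 1) le_rfl) (p' : T.seq.obj' (n + 1) le_rfl ⟶ Z')
    (hip' : i' ≫ p' = 𝟙 Z')
    (hpi' : T.seq.map' n (n + 1) ≫ p' ≫ i' = T.seq.map' n (n + 1))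
    (hl : T.last ≫ S.map (p ≫ i) = p' ≫ i' ≫ T.last) :
    ∃ M ∈ Θ, ∃ (m₀ : M.seq.obj' 0 ≅ Z) (m' : M.seq.obj' (n + 1) ≅ Z')
      (m : ∀ (j : ℕ) (_ : 1 ≤ j) (hj : j ≤ n), M.seq.obj' j ≅ T.seq.obj' j),
      M.seq.map' 0 1 ≫ (m 1 le_rfl hn).hom = m₀.hom ≫ i ≫ T.seq.map' 0 1 ∧
      (∀ (j : ℕ) (h1 : 1 ≤ j) (hj : j < n), M.seq.map' j (j + 1) ≫
        (m (j + 1) (by omega) hj).hom = (m j h1 hj.le).hom ≫ T.seq.map' j (j + 1)) ∧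
      M.seq.map' n (n + 1) ≫ m'.hom = (m n hn le_rfl).hom ≫ T.seq.map' n (n + 1) ≫ p' ∧
      M.last ≫ S.map m₀.hom = m'.hom ≫ i' ≫ T.last ≫ S.map p := by
  have := hΘ.additive
  -- The idempotent to discard is supported on the two ends; `hpi`, `hpi'` and `hl` say precisely
  -- that it commutes with the three arrows at the ends.
  obtain ⟨ε, hε0, hε1, hε⟩ : ∃ ε : ∀ (j : ℕ) (hj : j ≤ n + 1), T.seq.obj' j ⟶ T.seq.obj' j,
      ε 0 (Nat.zero_le _) = 𝟙 _ - p ≫ i ∧ ε (n + 1) le_rfl = 𝟙 _ - p' ≫ i' ∧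
      ∀ (j : ℕ) (hj : j ≤ n + 1), 1 ≤ j → j ≤ n → ε j hj = 0 :=
    ⟨fun j hj => if h : j = 0 then by subst h; exact 𝟙 _ - p ≫ i else
      if h' : j = n + 1 then by subst h'; exact 𝟙 _ - p' ≫ i' else 0, dif_pos rfl,
      (dif_neg (by omega)).trans (dif_pos rfl), fun j hj h1 h2 =>
        (dif_neg (by omega)).trans (dif_neg (by omega))⟩
  have hcomm : ∀ (j : ℕ) (hj : j < n + 1),
      T.seq.map' j (j + 1) ≫ ε (j + 1) hj = ε j (by omega) ≫ T.seq.map' j (j + 1) := by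
    intro j hj
    by_cases h0 : j = 0
    · subst h0
      rw [hε (0 + 1) _ (by omega) (by omega), hε0, Preadditive.sub_comp, Category.id_comp,
        Category.assoc, comp_zero]
      exact (sub_eq_zero.2 hpi.symm).symm
    by_cases h1 : j = n
    · subst h1
      rw [hε j _ (by omega) (by omega), hε1, Preadditive.comp_sub, Category.comp_id, hpi',
        sub_self, zero_comp]
    · rw [hε j _ (by omega) (by omega), hε _ _ (by omega) (by omega), comp_zero, zero_comp]
  let ψ : T ⟶ T := ⟨rowHom ε hcomm, by
    rw [rowHom_app, rowHom_app, hε0, hε1, S.map_sub, S.map_id, Preadditive.comp_sub, hl,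
      Preadditive.sub_comp, Category.assoc, Category.comp_id, Category.id_comp]⟩
  have hψ : ∀ (j : ℕ) (hj : j ≤ n + 1), app' ψ.φ j hj = ε j hj := fun j hj =>
    rowHom_app ε hcomm j hj
  obtain ⟨M, hM, ι, π, hιπ, hπι⟩ := hΘ.exists_complement hT ψ (by
    refine row_ext fun j hj => ?_
    rw [← app'_comp, hψ]
    by_cases h0 : j = 0
    · subst h0
      rw [hε0, sub_comp_self_idem i p hip]
    by_cases h1 : j = n + 1
    · subst h1
      rw [hε1, sub_comp_self_idem i' p' hip']
    · rw [hε j _ (by omega) (by omega), comp_zero])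
  have h0 : app' π.φ 0 (Nat.zero_le _) ≫ app' ι.φ 0 (Nat.zero_le _) = p ≫ i := by
    rw [hπι, hψ, hε0, sub_sub_cancel]
  have h1 : app' π.φ (n + 1) le_rfl ≫ app' ι.φ (n + 1) le_rfl = p' ≫ i' := by
    rw [hπι, hψ, hε1, sub_sub_cancel]
  have h2 : ∀ (j : ℕ) (_ : 1 ≤ j) (hj : j ≤ n),
      app' π.φ j (by omega) ≫ app' ι.φ j (by omega) = 𝟙 _ := fun j h hj => by
    rw [hπι, hψ, hε j _ h hj, sub_zero]
  have hι0 : (app' ι.φ 0 (Nat.zero_le _) ≫ p) ≫ i = app' ι.φ 0 (Nat.zero_le _) := by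
    rw [Category.assoc, ← h0, reassoc_of% (hιπ 0 (Nat.zero_le _))]
  have hι1 : (app' ι.φ (n + 1) le_rfl ≫ p') ≫ i' = app' ι.φ (n + 1) le_rfl := by
    rw [Category.assoc, ← h1, reassoc_of% (hιπ (n + 1) le_rfl)]
  refine ⟨M, hM, ⟨app' ι.φ 0 ≫ p, i ≫ app' π.φ 0, ?_, ?_⟩,
    ⟨app' ι.φ (n + 1) ≫ p', i' ≫ app' π.φ (n + 1), ?_, ?_⟩,
    fun j h hj => ⟨app' ι.φ j, app' π.φ j, hιπ j _, h2 j h hj⟩, ?_, ?_, ?_, ?_⟩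
  · rw [← Category.assoc, hι0, hιπ]
  · rw [Category.assoc, reassoc_of% h0, hip, Category.comp_id, hip]
  · rw [← Category.assoc, hι1, hιπ]
  · rw [Category.assoc, reassoc_of% h1, hip', Category.comp_id, hip']
  · dsimp only
    rw [← Category.assoc (_ ≫ p), hι0]
    exact naturality' ι.φ 0 1
  · intro j h hj
    exact naturality' ι.φ j (j + 1)
  · exact naturality'_assoc ι.φ n (n + 1) _ _ p'
  · dsimp only
    rw [← Category.assoc (_ ≫ p'), hι1, S.map_comp, ← Category.assoc, ι.comm, Category.assoc]

/-- A morphism of angles with prescribed ends, together with its mapping cone shifted by one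
position to the right. -/
theorem exists_hom_cone_of_ends (hΘ : IsAngulated S n Θ) (hn : 1 ≤ n) {X Y : SigmaSeq S n} (hX : X ∈ Θ)
    (hY : Y ∈ Θ) (φ₀ : X.seq.obj' 0 ⟶ Y.seq.obj' 0)
    (ψ : X.seq.obj' (n + 1) ⟶ Y.seq.obj' (n + 1)) (h : X.last ≫ S.map φ₀ = ψ ≫ Y.last) :
    ∃ φ : X ⟶ Y, app' φ.φ 0 = φ₀ ∧ app' φ.φ (n + 1) = ψ ∧ ∃ K ∈ Θ, ∃ (U : 𝒞)
      (u : S.obj U ≅ Y.seq.obj' (n + 1)) (υ : U ⟶ Y.seq.obj' 0)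
      (k₀ : K.seq.obj' 0 ≅ X.seq.obj' 0 ⊞ U)
      (k : ∀ (j : ℕ) (hj : j ≤ n), K.seq.obj' (j + 1) ≅ X.seq.obj' (j + 1) ⊞ Y.seq.obj' j),
      S.map υ = (-1 : ℤ) ^ n • (u.hom ≫ Y.last) ∧
      K.seq.map' 0 1 ≫ (k 0 (Nat.zero_le _)).hom =
        k₀.hom ≫ Biprod.ofComponents (-X.seq.map' 0 1) φ₀ 0 υ ∧
      (∀ (j : ℕ) (hj : j < n), K.seq.map' (j + 1) (j + 2) ≫ (k (j + 1) hj).hom =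
        (k j hj.le).hom ≫ Biprod.ofComponents (-X.seq.map' (j + 1) (j + 2)) (app' φ.φ (j + 1)) 0
          (Y.seq.map' j (j + 1))) ∧
      K.last ≫ S.map (k₀.hom ≫ biprod.fst) =
        (k n le_rfl).hom ≫ biprod.desc (-((-1 : ℤ) ^ n • X.last)) 0 ∧
      K.last ≫ S.map (k₀.hom ≫ biprod.snd) ≫ u.hom =
        (k n le_rfl).hom ≫ biprod.desc ψ (Y.seq.map' n (n + 1)) := by
  obtain ⟨m, rfl⟩ : ∃ m, n = m + 1 := ⟨n - 1, by omega⟩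
  have := hΘ.isEquivalence
  have := hΘ.additive
  -- (N4) prescribes the components at positions `0` and `1`. After right rotation these are the
  -- desuspended right end and the left end, so both ends of `X ⟶ Y` can be imposed.
  obtain ⟨UX, ⟨uX⟩⟩ := hΘ.exists_desuspension (X.seq.obj' (m + 1 + 1))
  obtain ⟨U, ⟨u⟩⟩ := hΘ.exists_desuspension (Y.seq.obj' (m + 1 + 1))
  obtain ⟨χ, hχ⟩ := S.map_surjective (uX.hom ≫ ψ ≫ u.inv)
  have hX' := X.rightRot_map_zero_one uX
  have hY' := Y.rightRot_map_zero_one u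
  have e1 : ((-1 : ℤ) ^ (m + 1) • (uX.hom ≫ X.last)) ≫ S.map φ₀ =
      S.map χ ≫ ((-1 : ℤ) ^ (m + 1) • (u.hom ≫ Y.last)) := by
    rw [hχ, Preadditive.zsmul_comp, Preadditive.comp_zsmul, Category.assoc, Category.assoc,
      Category.assoc, u.inv_hom_id_assoc, h]
  obtain ⟨φ', h0, h1, K, hK, ⟨c⟩⟩ := hΘ.exists_hom_cone _ (hΘ.rightRot_mem hX uX) _
    (hΘ.rightRot_mem hY u) χ φ₀ (S.map_injective ((S.map_comp _ _).trans
      ((congrArg (· ≫ S.map φ₀) hX').trans (e1.trans ((congrArg (S.map χ ≫ ·) hY').symm.trans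
        (S.map_comp _ _).symm)))))
  obtain ⟨b, hb⟩ : ∃ b : ∀ (j : ℕ) (hj : j ≤ (m + 1)), X.seq.obj' j ⟶ Y.seq.obj' j,
    ∀ (j : ℕ) (hj : j ≤ (m + 1)), b j hj = app' φ'.φ (j + 1) := ⟨fun j hj => app' φ'.φ (j + 1),
      fun _ _ => rfl⟩
  have hb0 : b 0 (Nat.zero_le _) = φ₀ := (hb 0 _).trans h1
  -- The last square of the rotated morphism, with desuspension undone, is the square at the right
  -- end involving `ψ`.
  have hbn : (X.seq.map' (m + 1) (m + 1 + 1) ≫ uX.inv) ≫ S.map χ =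
      b (m + 1) le_rfl ≫ Y.seq.map' (m + 1) (m + 1 + 1) ≫ u.inv := by
    have := φ'.comm
    rw [h0] at this
    rw [hb]
    exact this
  have hbj : ∀ (j : ℕ) (hj : j < (m + 1)),
      X.seq.map' j (j + 1) ≫ b (j + 1) hj = b j hj.le ≫ Y.seq.map' j (j + 1) := fun j hj => by
    rw [hb (j + 1) hj, hb j hj.le]
    exact naturality' φ'.φ (j + 1) (j + 2)
  obtain ⟨υ, hυ⟩ : ∃ υ : U ⟶ Y.seq.obj' 0, υ = (Y.rightRot u).seq.map' 0 1 := ⟨_, rfl⟩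
  obtain ⟨k₀, l, l', c0, cj, cn, cl, cl'⟩ : ∃ (k₀ : K.seq.obj' 0 ≅ X.seq.obj' 0 ⊞ U)
      (l : ∀ (j : ℕ) (hj : j < (m + 1)), K.seq.obj' (j + 1) ≅ X.seq.obj' (j + 1) ⊞ Y.seq.obj' j)
      (l' : K.seq.obj' (m + 1 + 1) ≅ S.obj UX ⊞ Y.seq.obj' (m + 1)),
      K.seq.map' 0 1 ≫ (l 0 hn).hom =
        k₀.hom ≫ Biprod.ofComponents (-X.seq.map' 0 1) (b 0 (Nat.zero_le _)) 0 υ ∧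
      (∀ (j : ℕ) (hj : j + 1 < (m + 1)), K.seq.map' (j + 1) (j + 2) ≫ (l (j + 1) hj).hom =
        (l j (by omega)).hom ≫ Biprod.ofComponents (-X.seq.map' (j + 1) (j + 2))
          (b (j + 1) (by omega)) 0 (Y.seq.map' j (j + 1))) ∧
      K.seq.map' (m + 1) (m + 1 + 1) ≫ l'.hom =
        (l m (by omega)).hom ≫ Biprod.ofComponents (-X.seq.map' (m + 1) (m + 1 + 1) ≫ uX.inv)
          (b (m + 1) le_rfl) 0 (Y.seq.map' m (m + 1)) ∧
      K.last ≫ S.map (k₀.hom ≫ biprod.fst) =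
        l'.hom ≫ biprod.desc (-((-1 : ℤ) ^ (m + 1) • (uX.hom ≫ X.last))) 0 ∧
      K.last ≫ S.map (k₀.hom ≫ biprod.snd) =
        l'.hom ≫ biprod.desc (S.map χ) (Y.seq.map' (m + 1) (m + 1 + 1) ≫ u.inv) := by
    refine ⟨c.e 0 (Nat.zero_le _), fun j hj => c.e (j + 1) hj, c.eLast, ?_, ?_, ?_, ?_, ?_⟩
    · rw [hb, hυ]
      exact c.comm 0 hn
    · intro j hj
      rw [hb]
      exact c.comm (j + 1) hj
    · rw [hb]
      exact c.comm_n
    · rw [← hX']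
      exact c.comm_last_fst
    · rw [← h0]
      exact c.comm_last_snd
  obtain ⟨a, ha, haψ⟩ : ∃ a : ∀ (j : ℕ) (hj : j ≤ m + 1 + 1), X.seq.obj' j ⟶ Y.seq.obj' j,
      (∀ (j : ℕ) (hj : j ≤ (m + 1)), a j (by omega) = b j hj) ∧ a (m + 1 + 1) le_rfl = ψ :=
    ⟨fun j hj => if h : j = m + 1 + 1 then by subst h; exact ψ else b j (by omega),
      fun j hj => dif_neg (by omega), dif_pos rfl⟩
  have hsq : ∀ (j : ℕ) (hj : j < m + 1 + 1),
      X.seq.map' j (j + 1) ≫ a (j + 1) hj = a j (by omega) ≫ Y.seq.map' j (j + 1) := by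
    intro j hj
    by_cases hjn : j = (m + 1)
    · subst hjn
      rw [haψ, ha (m + 1) le_rfl, ← cancel_mono u.inv, Category.assoc, Category.assoc, ← hbn, hχ,
        Category.assoc, uX.inv_hom_id_assoc]
    · rw [ha (j + 1) (by omega), ha j (by omega)]
      exact hbj j (by omega)
  have hφ : ∀ (j : ℕ) (hj : j ≤ m + 1 + 1), app' (rowHom a hsq) j hj = a j hj := rowHom_app a hsq
  obtain ⟨φ, hφa⟩ : ∃ φ : X ⟶ Y, ∀ (j : ℕ) (hj : j ≤ m + 1 + 1), app' φ.φ j hj = a j hj :=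
    ⟨⟨rowHom a hsq, by rw [hφ, hφ, haψ, ha 0 (Nat.zero_le _), hb0, h]⟩, hφ⟩
  -- Only the last identification differs from that of the cone: `S UX` is replaced by `Xₙ₊₁`.
  obtain ⟨k, hk, hkn⟩ : ∃ k : ∀ (j : ℕ) (hj : j ≤ (m + 1)),
      K.seq.obj' (j + 1) ≅ X.seq.obj' (j + 1) ⊞ Y.seq.obj' j,
      (∀ (j : ℕ) (hj : j < (m + 1)), k j hj.le = l j hj) ∧
      k (m + 1) le_rfl = l' ≪≫ biprod.mapIso uX (Iso.refl (Y.seq.obj' (m + 1))) :=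
    ⟨fun j hj => if h : j = (m + 1) then by
        subst h; exact l' ≪≫ biprod.mapIso uX (Iso.refl (Y.seq.obj' (m + 1)))
      else l j (by omega), fun j hj => dif_neg (by omega), dif_pos rfl⟩
  refine ⟨φ, (hφa _ _).trans ((ha 0 _).trans hb0), (hφa _ _).trans haψ, K, hK, U, u, υ, k₀, k,
    hυ ▸ hY', ?_, ?_, ?_, ?_⟩
  · rw [hk 0 hn, c0, hb0]
  · intro j hj
    rw [hφa (j + 1), ha (j + 1) hj]
    by_cases hjn : m = j
    · subst hjn
      rw [hkn, hk m hj, Iso.trans_hom, reassoc_of% cn, ofComponents_comp_map_iso]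
    · rw [hk (j + 1) (by omega), hk j hj, cj j (by omega)]
  · rw [cl, hkn, Iso.trans_hom, Category.assoc, mapIso_hom_comp_desc, Preadditive.comp_neg,
      Preadditive.comp_zsmul]
  · rw [reassoc_of% cl', hkn, Iso.trans_hom, Category.assoc, mapIso_hom_comp_desc]
    refine congrArg (l'.hom ≫ ·) ?_
    apply biprod.hom_ext'
    · rw [biprod.inl_desc_assoc, biprod.inl_desc, hχ, Category.assoc, Category.assoc,
        u.inv_hom_id, Category.comp_id]
    · rw [biprod.inr_desc_assoc, biprod.inr_desc, Category.assoc, u.inv_hom_id, Category.comp_id]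

end IsAngulated

variable {𝒞 : Type u} [Category.{v} 𝒞] [Preadditive 𝒞] [HasFiniteBiproducts 𝒞]
  {S : 𝒞 ⥤ 𝒞} {n : ℕ} {Θ : Set (SigmaSeq S n)}

theorem map_biprod_total (S : 𝒞 ⥤ 𝒞) [S.Additive] (X Y : 𝒞) :
    S.map (biprod.fst : X ⊞ Y ⟶ X) ≫ S.map biprod.inl +
      S.map (biprod.snd : X ⊞ Y ⟶ Y) ≫ S.map biprod.inr = 𝟙 _ := by
  rw [← S.map_comp, ← S.map_comp, ← S.map_add, biprod.total, S.map_id]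

theorem map_biprod_hom_ext (S : 𝒞 ⥤ 𝒞) [S.Additive] {X Y W : 𝒞} {f g : W ⟶ S.obj (X ⊞ Y)}
    (h₁ : f ≫ S.map biprod.fst = g ≫ S.map biprod.fst)
    (h₂ : f ≫ S.map biprod.snd = g ≫ S.map biprod.snd) : f = g := by
  rw [← Category.comp_id f, ← Category.comp_id g, ← map_biprod_total S, Preadditive.comp_add,
    Preadditive.comp_add, reassoc_of% h₁, reassoc_of% h₂]

section Matrices

variable {A B A' B' W : 𝒞}

theorem ofComponents_comp_desc (a : A ⟶ A') (b : A ⟶ B') (c : B ⟶ A') (d : B ⟶ B') (f : A' ⟶ W)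
    (g : B' ⟶ W) : Biprod.ofComponents a b c d ≫ biprod.desc f g =
      biprod.desc (a ≫ f + b ≫ g) (c ≫ f + d ≫ g) := by
  apply biprod.hom_ext' <;> simp [Biprod.ofComponents]

theorem inl_ofComponents (a : A ⟶ A') (b : A ⟶ B') (c : B ⟶ A') (d : B ⟶ B') :
    biprod.inl ≫ Biprod.ofComponents a b c d = biprod.lift a b := by
  apply biprod.hom_ext <;> simp [Biprod.ofComponents]

theorem inr_ofComponents (a : A ⟶ A') (b : A ⟶ B') (c : B ⟶ A') (d : B ⟶ B') :
    biprod.inr ≫ Biprod.ofComponents a b c d = biprod.lift c d := by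
  apply biprod.hom_ext <;> simp [Biprod.ofComponents]

theorem desc_zero_left (f : B ⟶ W) : biprod.desc (0 : A ⟶ W) f = biprod.snd ≫ f := by
  apply biprod.hom_ext' <;> simp

theorem lift_eq (f : W ⟶ A) (g : W ⟶ B) :
    biprod.lift f g = f ≫ biprod.inl + g ≫ biprod.inr := by
  apply biprod.hom_ext <;> simp

theorem desc_id_left (t : B ⟶ A) : biprod.desc (𝟙 A) t = biprod.fst + biprod.snd ≫ t := by
  apply biprod.hom_ext' <;> simp

end Matrices

/-- The symmetry of the biproduct with signs `(-1)ⁱ` and `(-1)ⁱ⁺¹`. -/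
def signedBraiding (i : ℕ) (X Y : 𝒞) : X ⊞ Y ≅ Y ⊞ X where
  hom := biprod.lift ((-1 : ℤ) ^ i • biprod.snd) (-((-1 : ℤ) ^ i • biprod.fst))
  inv := biprod.lift (-((-1 : ℤ) ^ i • biprod.snd)) ((-1 : ℤ) ^ i • biprod.fst)
  hom_inv_id := by
    apply biprod.hom_ext <;> simp [SigmaSeq.neg_one_pow_zsmul_zsmul]
  inv_hom_id := by
    apply biprod.hom_ext <;> simp [SigmaSeq.neg_one_pow_zsmul_zsmul]

/-- Alternating signs are what turns the cone matrix, with its minus on the differential of `X`,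
into the cocone matrix, with its minus on the differential of `Y`. -/
theorem ofComponents_comp_signedBraiding {A B A' B' : 𝒞} (i : ℕ) (x : A ⟶ A') (f : A ⟶ B')
    (y : B ⟶ B') :
    Biprod.ofComponents (-x) f 0 y ≫ (signedBraiding (i + 1) A' B').hom =
      (signedBraiding i A B).hom ≫ Biprod.ofComponents (-y) 0 f x := by
  apply biprod.hom_ext' <;> apply biprod.hom_ext <;>
    simp [signedBraiding, Biprod.ofComponents, pow_succ]

theorem signedBraiding_comp_desc {A B W : 𝒞} (i : ℕ) (f : A ⟶ W) (y : B ⟶ W) :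
    (signedBraiding i A B).hom ≫ biprod.desc (-y) f = (-1 : ℤ) ^ (i + 1) • biprod.desc f y := by
  apply biprod.hom_ext' <;> simp [signedBraiding, pow_succ]

theorem lift_comp_signedBraiding_zero {A B W : 𝒞} (x : W ⟶ A) (f : W ⟶ B) :
    biprod.lift (-x) f ≫ (signedBraiding 0 A B).hom = biprod.lift f x := by
  apply biprod.hom_ext <;> simp [signedBraiding]

/-- An isomorphism multiplied by the sign `(-1)ⁿ`. -/
def signedIso (n : ℕ) {X Y : 𝒞} (e : X ≅ Y) : X ≅ Y where
  hom := (-1 : ℤ) ^ n • e.hom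
  inv := (-1 : ℤ) ^ n • e.inv
  hom_inv_id := by
    rw [Preadditive.zsmul_comp, Preadditive.comp_zsmul, SigmaSeq.neg_one_pow_zsmul_zsmul,
      e.hom_inv_id]
  inv_hom_id := by
    rw [Preadditive.zsmul_comp, Preadditive.comp_zsmul, SigmaSeq.neg_one_pow_zsmul_zsmul,
      e.inv_hom_id]

namespace IsAngulated

/-- Rotating the shifted cone back gives `X₁ ⊞ Y₀` at the left end and `S (X₀ ⊞ U)` at the right
end, where `S U ≅ Yₙ₊₁`. Invertibility of `φ₀` makes `Y₀` and `S X₀` superfluous, and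
`exists_trim_ends` removes them. -/
theorem exists_cone_angle [IsIdempotentComplete 𝒞] (hΘ : IsAngulated S n Θ) (hn : 1 ≤ n)
    {X Y : SigmaSeq S n} (hX : X ∈ Θ) (hY : Y ∈ Θ) (φ₀ : X.seq.obj' 0 ≅ Y.seq.obj' 0)
    (ψ : X.seq.obj' (n + 1) ⟶ Y.seq.obj' (n + 1)) (h : X.last ≫ S.map φ₀.hom = ψ ≫ Y.last) :
    ∃ φ : X ⟶ Y, app' φ.φ 0 = φ₀.hom ∧ app' φ.φ (n + 1) = ψ ∧ ∃ M ∈ Θ,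
      ∃ (m₀ : M.seq.obj' 0 ≅ X.seq.obj' 1) (m' : M.seq.obj' (n + 1) ≅ Y.seq.obj' (n + 1))
        (e : ∀ (j : ℕ) (_ : 1 ≤ j) (hj : j ≤ n),
          M.seq.obj' j ≅ X.seq.obj' (j + 1) ⊞ Y.seq.obj' j),
      M.seq.map' 0 1 ≫ (e 1 le_rfl hn).hom =
        m₀.hom ≫ biprod.lift (-X.seq.map' 1 2) (app' φ.φ 1) ∧
      (∀ (j : ℕ) (h1 : 1 ≤ j) (hj : j < n), M.seq.map' j (j + 1) ≫
        (e (j + 1) (by omega) hj).hom = (e j h1 hj.le).hom ≫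
          Biprod.ofComponents (-X.seq.map' (j + 1) (j + 2)) (app' φ.φ (j + 1)) 0
            (Y.seq.map' j (j + 1))) ∧
      M.seq.map' n (n + 1) ≫ m'.hom =
        (e n hn le_rfl).hom ≫ biprod.desc ψ (Y.seq.map' n (n + 1)) ∧
      M.last ≫ S.map m₀.hom = m'.hom ≫ Y.last ≫ S.map (φ₀.inv ≫ X.seq.map' 0 1) := by
  have := hΘ.additive
  obtain ⟨φ, hφ0, hφn, K, hK, U, u, υ, k₀, k, hυ, kc0, kc, kl, kl'⟩ :=
    hΘ.exists_hom_cone_of_ends hn hX hY φ₀.hom ψ h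
  obtain ⟨R, ⟨r⟩⟩ := K.exists_leftRotation
  have hR : R ∈ Θ := (hΘ.rotate_iff K R ⟨r⟩).1 hK
  obtain ⟨e, he⟩ : ∃ e : ∀ (j : ℕ) (hj : j ≤ n), R.seq.obj' j ≅ X.seq.obj' (j + 1) ⊞ Y.seq.obj' j,
    ∀ (j : ℕ) (hj : j ≤ n), e j hj = r.e j hj ≪≫ k j hj := ⟨_, fun _ _ => rfl⟩
  have rc : ∀ (j : ℕ) (hj : j < n), R.seq.map' j (j + 1) ≫ (e (j + 1) hj).hom =
      (e j hj.le).hom ≫ Biprod.ofComponents (-X.seq.map' (j + 1) (j + 2)) (app' φ.φ (j + 1)) 0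
        (Y.seq.map' j (j + 1)) := fun j hj => by
    rw [he, he, Iso.trans_hom, Iso.trans_hom, reassoc_of% (r.comm j hj), kc j hj, Category.assoc]
  obtain ⟨e', he'⟩ : ∃ e' : R.seq.obj' (n + 1) ≅ S.obj (X.seq.obj' 0 ⊞ U),
    e' = r.eLast ≪≫ S.mapIso k₀ := ⟨_, rfl⟩
  have rl : (R.seq.map' n (n + 1) ≫ e'.hom) ≫ S.map biprod.fst =
      (e n le_rfl).hom ≫ biprod.desc (-((-1 : ℤ) ^ n • X.last)) 0 := by
    rw [S.map_comp] at kl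
    simp only [he, he', Iso.trans_hom, Functor.mapIso_hom, Category.assoc, reassoc_of% r.comm_n,
      ← kl]
  have rl' : (R.seq.map' n (n + 1) ≫ e'.hom) ≫ S.map biprod.snd ≫ u.hom =
      (e n le_rfl).hom ≫ biprod.desc ψ (Y.seq.map' n (n + 1)) := by
    rw [S.map_comp, Category.assoc] at kl'
    simp only [he, he', Iso.trans_hom, Functor.mapIso_hom, Category.assoc, reassoc_of% r.comm_n,
      ← kl']
  have rL : R.last ≫ S.map (e 0 (Nat.zero_le _)).hom = e'.hom ≫
      ((-1 : ℤ) ^ n • S.map (Biprod.ofComponents (-X.seq.map' 0 1) φ₀.hom 0 υ)) := by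
    rw [he, he', Iso.trans_hom, Iso.trans_hom, S.map_comp, reassoc_of% r.comm_last,
      Preadditive.zsmul_comp, ← S.map_comp, kc0, S.map_comp, Category.assoc,
      Preadditive.comp_zsmul (S.mapIso k₀).hom]
    rfl
  -- The plain projection to `X₁` would not respect the first arrow: `Y₀` has to be sent to `X₁` by
  -- `t`. Similarly `s` corrects the inclusion of `Yₙ₊₁` at the right end.
  obtain ⟨t, ht⟩ : ∃ t : Y.seq.obj' 0 ⟶ X.seq.obj' 1, t = φ₀.inv ≫ X.seq.map' 0 1 := ⟨_, rfl⟩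
  obtain ⟨s, hs⟩ : ∃ s, s = -((-1 : ℤ) ^ n • (Y.last ≫ S.map φ₀.inv)) := ⟨_, rfl⟩
  obtain ⟨i, hi⟩ : ∃ i, i = biprod.inl ≫ (e 0 (Nat.zero_le _)).inv := ⟨_, rfl⟩
  obtain ⟨p, hp⟩ : ∃ p, p = (e 0 (Nat.zero_le _)).hom ≫ biprod.desc (𝟙 _) t := ⟨_, rfl⟩
  obtain ⟨i', hi'⟩ : ∃ i', i' = (s ≫ S.map biprod.inl + u.inv ≫ S.map biprod.inr) ≫ e'.inv :=
    ⟨_, rfl⟩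
  obtain ⟨p', hp'⟩ : ∃ p', p' = e'.hom ≫ S.map biprod.snd ≫ u.hom := ⟨_, rfl⟩
  have hφt : φ₀.hom ≫ t = X.seq.map' 0 1 := by rw [ht, φ₀.hom_inv_id_assoc]
  have hφ1 : X.seq.map' 0 1 ≫ app' φ.φ 1 = φ₀.hom ≫ Y.seq.map' 0 1 :=
    (naturality' φ.φ 0 1).trans (by rw [hφ0])
  have hYl : ψ ≫ Y.last ≫ S.map φ₀.inv = X.last := by
    rw [← Category.assoc, ← h, Category.assoc, ← S.map_comp, φ₀.hom_inv_id, S.map_id,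
      Category.comp_id]
  have rc0 : R.seq.map' 0 1 ≫ (e 1 hn).hom = (e 0 (Nat.zero_le _)).hom ≫
    Biprod.ofComponents (-X.seq.map' 1 2) (app' φ.φ 1) 0 (Y.seq.map' 0 1) := rc 0 hn
  have hip : i ≫ p = 𝟙 _ := by
    rw [hi, hp, Category.assoc, Iso.inv_hom_id_assoc, biprod.inl_desc]
  have hip' : i' ≫ p' = 𝟙 _ := by
    rw [hi', hp', Category.assoc, Iso.inv_hom_id_assoc, Preadditive.add_comp, Category.assoc,
      Category.assoc, ← S.map_comp_assoc, ← S.map_comp_assoc, biprod.inl_snd, biprod.inr_snd,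
      S.map_zero, S.map_id, zero_comp, comp_zero, zero_add, Category.id_comp, u.inv_hom_id]
  have hA : R.last ≫ S.map p = p' ≫ Y.last ≫ S.map t := by
    rw [hp, hp', S.map_comp, reassoc_of% rL, Preadditive.zsmul_comp, ← S.map_comp,
      ofComponents_comp_desc, Category.comp_id, hφt, neg_add_cancel, zero_comp, zero_add (υ ≫ t),
      desc_zero_left, S.map_comp, S.map_comp, hυ, Category.assoc, Category.assoc,
      Preadditive.zsmul_comp, Preadditive.comp_zsmul (S.map biprod.snd),
      SigmaSeq.neg_one_pow_zsmul_zsmul, Category.assoc]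
  have hB : i' ≫ R.last = Y.last ≫ S.map t ≫ S.map i := by
    rw [← cancel_mono (S.map (e 0 (Nat.zero_le _)).hom), Category.assoc, rL, hi', Category.assoc,
      Iso.inv_hom_id_assoc, Preadditive.comp_zsmul, Preadditive.add_comp, Category.assoc,
      Category.assoc, ← S.map_comp, ← S.map_comp, inl_ofComponents, inr_ofComponents, hi,
      Category.assoc, Category.assoc, ← S.map_comp, Category.assoc, Iso.inv_hom_id,
      Category.comp_id, lift_eq, lift_eq, zero_comp, zero_add (υ ≫ _), S.map_add, S.map_comp, S.map_comp,
      S.map_comp, hυ, hs, S.map_neg, ht, S.map_comp]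
    simp only [Preadditive.zsmul_comp, Preadditive.comp_zsmul, Preadditive.comp_add,
      Preadditive.neg_comp, Preadditive.comp_neg, Category.assoc, Iso.inv_hom_id_assoc, smul_add,
      smul_neg, SigmaSeq.neg_one_pow_zsmul_zsmul, neg_neg]
    rw [← S.map_comp_assoc φ₀.inv φ₀.hom, φ₀.inv_hom_id, S.map_id, Category.id_comp]
    abel
  obtain ⟨M, hM, m₀, m', m, h1, h2, h3, h4⟩ := hΘ.exists_trim_ends hn hR i p hip
    (by
      rw [hp, hi, Category.assoc, Category.assoc, ← cancel_mono (e 1 hn).hom, Category.assoc,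
        Category.assoc, Category.assoc, Category.assoc]
      refine (congrArg (fun z => _ ≫ _ ≫ _ ≫ _ ≫ z) rc0).trans (Eq.trans ?_ rc0.symm)
      rw [Iso.inv_hom_id_assoc, inl_ofComponents]
      refine congrArg (_ ≫ ·) (biprod.hom_ext' _ _ ?_ ?_)
      · rw [biprod.inl_desc_assoc, inl_ofComponents, Category.id_comp]
      · rw [biprod.inr_desc_assoc, inr_ofComponents]
        refine biprod.hom_ext _ _ ?_ ?_
        · rw [Category.assoc, biprod.lift_fst, biprod.lift_fst, Preadditive.comp_neg, ht,
            Category.assoc, hΘ.map_comp_map_zero hn hX, comp_zero, neg_zero]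
        · rw [Category.assoc, biprod.lift_snd, biprod.lift_snd, ht, Category.assoc, hφ1,
            φ₀.inv_hom_id_assoc]) i' p' hip'
    (by
      rw [← cancel_mono e'.hom, hi', hp']
      simp only [Category.assoc, Iso.inv_hom_id, Category.comp_id]
      rw [reassoc_of% rl']
      have hd : biprod.desc ψ (Y.seq.map' n (n + 1)) ≫ s =
          biprod.desc (-((-1 : ℤ) ^ n • X.last)) 0 := by
        rw [hs]
        apply biprod.hom_ext'
        · rw [biprod.inl_desc_assoc, biprod.inl_desc, Preadditive.comp_neg,
            Preadditive.comp_zsmul, hYl]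
        · rw [biprod.inr_desc_assoc, biprod.inr_desc, Preadditive.comp_neg,
            Preadditive.comp_zsmul, reassoc_of% (hΘ.map_comp_last hn hY), zero_comp, smul_zero,
            neg_zero]
      apply map_biprod_hom_ext
      · rw [rl, Category.assoc, Category.assoc, Preadditive.add_comp, Category.assoc, Category.assoc,
          ← S.map_comp, ← S.map_comp, biprod.inl_fst, biprod.inr_fst, S.map_id, S.map_zero,
          comp_zero, add_zero, Category.comp_id, hd]
      · rw [Category.assoc, Category.assoc, Preadditive.add_comp, Category.assoc, Category.assoc,
          ← S.map_comp, ← S.map_comp, biprod.inl_snd, biprod.inr_snd, S.map_id, S.map_zero,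
          comp_zero, zero_add, Category.comp_id, ← reassoc_of% rl', u.hom_inv_id,
          Category.comp_id, Category.assoc])
    (by rw [S.map_comp, reassoc_of% hA, hB])
  refine ⟨φ, hφ0, hφn, M, hM, m₀, m', fun j h hj => m j h hj ≪≫ e j hj, ?_, ?_, ?_, ?_⟩
  · rw [Iso.trans_hom, reassoc_of% h1, rc0, hi, Category.assoc, Iso.inv_hom_id_assoc,
      inl_ofComponents]
  · intro j hj hj'
    rw [Iso.trans_hom, Iso.trans_hom, reassoc_of% (h2 j hj hj'), rc j hj', Category.assoc]
  · rw [h3, hp', ← Category.assoc _ e'.hom, rl', Iso.trans_hom, Category.assoc]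
  · rw [h4, reassoc_of% hB, ← S.map_comp, hip, S.map_id, Category.comp_id, ht]

/-- The shifted cone `X₀ ⊞ U ⟶ ⋯ ⟶ Xₙ₊₁ ⊞ Yₙ` is used as it stands. Invertibility of `ψ` makes `U`
and `Xₙ₊₁` superfluous; after trimming, summands are swapped with signs to reach the cocone. -/
theorem exists_cocone_angle [IsIdempotentComplete 𝒞] (hΘ : IsAngulated S n Θ) (hn : 1 ≤ n)
    {X Y : SigmaSeq S n} (hX : X ∈ Θ) (hY : Y ∈ Θ) (φ₀ : X.seq.obj' 0 ⟶ Y.seq.obj' 0)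
    (ψ : X.seq.obj' (n + 1) ≅ Y.seq.obj' (n + 1)) (h : X.last ≫ S.map φ₀ = ψ.hom ≫ Y.last) :
    ∃ φ : X ⟶ Y, app' φ.φ 0 = φ₀ ∧ app' φ.φ (n + 1) = ψ.hom ∧ ∃ N ∈ Θ,
      ∃ (m₀ : N.seq.obj' 0 ≅ X.seq.obj' 0) (m' : N.seq.obj' (n + 1) ≅ Y.seq.obj' n)
        (e : ∀ (i j : ℕ) (_ : i + 1 = j) (hj : j ≤ n),
          N.seq.obj' j ≅ Y.seq.obj' i ⊞ X.seq.obj' j),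
      N.seq.map' 0 1 ≫ (e 0 1 rfl hn).hom = m₀.hom ≫ biprod.lift φ₀ (X.seq.map' 0 1) ∧
      (∀ (i j k : ℕ) (hij : i + 1 = j) (hjk : j + 1 = k) (hk : k ≤ n),
        N.seq.map' j k ≫ (e j k hjk hk).hom = (e i j hij (by omega)).hom ≫
          Biprod.ofComponents (-Y.seq.map' i j) 0 (app' φ.φ j) (X.seq.map' j k)) ∧
      (∀ (i : ℕ) (hi : i + 1 = n), N.seq.map' n (n + 1) ≫ m'.hom =
        (e i n hi le_rfl).hom ≫ biprod.desc (-Y.seq.map' i n) (app' φ.φ n)) ∧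
      N.last ≫ S.map m₀.hom = m'.hom ≫ Y.seq.map' n (n + 1) ≫ ψ.inv ≫ X.last := by
  have := hΘ.additive
  have := hΘ.isEquivalence
  obtain ⟨φ, hφ0, hφn, K, hK, U, u, υ, k₀, k, hυ, kc0, kc, kl, kl'⟩ :=
    hΘ.exists_hom_cone_of_ends hn hX hY φ₀ ψ.hom h
  obtain ⟨t, ht⟩ := S.map_surjective ((-1 : ℤ) ^ n • (u.hom ≫ ψ.inv ≫ X.last))
  obtain ⟨s, hs⟩ : ∃ s : Y.seq.obj' n ⟶ X.seq.obj' (n + 1),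
    s = -(Y.seq.map' n (n + 1) ≫ ψ.inv) := ⟨_, rfl⟩
  obtain ⟨i, hi⟩ : ∃ i, i = biprod.inl ≫ k₀.inv := ⟨_, rfl⟩
  obtain ⟨p, hp⟩ : ∃ p, p = k₀.hom ≫ biprod.desc (𝟙 _) t := ⟨_, rfl⟩
  obtain ⟨i', hi'⟩ : ∃ i', i' = biprod.lift s (𝟙 _) ≫ (k n le_rfl).inv := ⟨_, rfl⟩
  obtain ⟨p', hp'⟩ : ∃ p', p' = (k n le_rfl).hom ≫ biprod.snd := ⟨_, rfl⟩
  have htx : t ≫ X.seq.map' 0 1 = 0 := S.map_injective (by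
    rw [S.map_comp, ht, Preadditive.zsmul_comp, Category.assoc, Category.assoc,
      hΘ.last_comp_map hn hX, comp_zero, comp_zero, smul_zero, S.map_zero])
  have htφ : t ≫ φ₀ = υ := S.map_injective (by
    rw [S.map_comp, ht, hυ, Preadditive.zsmul_comp, Category.assoc, Category.assoc, h,
      ψ.inv_hom_id_assoc])
  have hip : i ≫ p = 𝟙 _ := by
    rw [hi, hp, Category.assoc, Iso.inv_hom_id_assoc, biprod.inl_desc]
  have hip' : i' ≫ p' = 𝟙 _ := by
    rw [hi', hp', Category.assoc, Iso.inv_hom_id_assoc, biprod.lift_snd]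
  have hA : K.last ≫ S.map p = p' ≫ ((-1 : ℤ) ^ n • (Y.seq.map' n (n + 1) ≫ ψ.inv ≫ X.last)) := by
    have e1 : p = k₀.hom ≫ biprod.fst + (k₀.hom ≫ biprod.snd) ≫ t := by
      rw [hp, Category.assoc, ← Preadditive.comp_add]
      exact congrArg (k₀.hom ≫ ·) (desc_id_left t)
    rw [e1, S.map_add, Preadditive.comp_add, kl, S.map_comp _ t, ht, Preadditive.comp_zsmul,
      Preadditive.comp_zsmul, ← Category.assoc (S.map _) u.hom, ← Category.assoc K.last, kl', Category.assoc,
      ← Preadditive.comp_zsmul, ← Preadditive.comp_add, hp', Category.assoc]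
    refine congrArg (_ ≫ ·) ?_
    apply biprod.hom_ext'
    · rw [Preadditive.comp_add, biprod.inl_desc, Preadditive.comp_zsmul, biprod.inl_desc_assoc,
        ψ.hom_inv_id_assoc, neg_add_cancel, biprod.inl_snd_assoc, zero_comp]
    · rw [Preadditive.comp_add, biprod.inr_desc, Preadditive.comp_zsmul, biprod.inr_desc_assoc,
        zero_add, biprod.inr_snd_assoc]
  have hB : i' ≫ K.last = ((-1 : ℤ) ^ n • (Y.seq.map' n (n + 1) ≫ ψ.inv ≫ X.last)) ≫ S.map i := by
    rw [← cancel_mono (S.map k₀.hom), Category.assoc, Category.assoc, ← S.map_comp, hi,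
      Category.assoc, Iso.inv_hom_id, Category.comp_id]
    apply map_biprod_hom_ext
    · rw [Category.assoc, Category.assoc, ← S.map_comp, kl, hi', Category.assoc,
        Iso.inv_hom_id_assoc, Category.assoc, ← S.map_comp, biprod.inl_fst, S.map_id,
        Category.comp_id, biprod.lift_desc, comp_zero, add_zero, hs, Preadditive.comp_neg,
        Preadditive.neg_comp, neg_neg, Preadditive.comp_zsmul, Category.assoc]
    · rw [← cancel_mono u.hom, Category.assoc, Category.assoc, Category.assoc, ← S.map_comp_assoc,
        kl', hi', Category.assoc, Iso.inv_hom_id_assoc, Category.assoc, Category.assoc,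
        ← S.map_comp_assoc,
        biprod.inl_snd, S.map_zero, zero_comp, comp_zero, biprod.lift_desc, hs, Category.id_comp,
        Preadditive.neg_comp, Category.assoc, ψ.inv_hom_id, Category.comp_id, neg_add_cancel]
  obtain ⟨m, rfl⟩ : ∃ m, n = m + 1 := ⟨n - 1, by omega⟩
  have hφm : app' φ.φ (m + 1) ≫ Y.seq.map' (m + 1) (m + 1 + 1) =
      X.seq.map' (m + 1) (m + 1 + 1) ≫ ψ.hom :=
    (naturality' φ.φ (m + 1) (m + 1 + 1)).symm.trans (by rw [hφn])
  have hyy : Y.seq.map' m (m + 1) ≫ Y.seq.map' (m + 1) (m + 1 + 1) = 0 :=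
    (hΘ.isComplex hn hY).zero m
  have kcm : K.seq.map' (m + 1) (m + 1 + 1) ≫ (k (m + 1) le_rfl).hom = (k m (by omega)).hom ≫
    Biprod.ofComponents (-X.seq.map' (m + 1) (m + 1 + 1)) (app' φ.φ (m + 1)) 0
      (Y.seq.map' m (m + 1)) := kc m (by omega)
  obtain ⟨N, hN, m₀, m', e, h1, h2, h3, h4⟩ := hΘ.exists_trim_ends hn hK i p hip
    (by
      rw [hp, hi, Category.assoc, Category.assoc, ← cancel_mono (k 0 (Nat.zero_le _)).hom,
        Category.assoc, Category.assoc, Category.assoc, Category.assoc]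
      refine (congrArg (fun z => _ ≫ _ ≫ _ ≫ _ ≫ z) kc0).trans (Eq.trans ?_ kc0.symm)
      rw [Iso.inv_hom_id_assoc, inl_ofComponents]
      refine congrArg (_ ≫ ·) (biprod.hom_ext' _ _ ?_ ?_)
      · rw [biprod.inl_desc_assoc, inl_ofComponents, Category.id_comp]
      · rw [biprod.inr_desc_assoc, inr_ofComponents]
        refine biprod.hom_ext _ _ ?_ ?_
        · rw [Category.assoc, biprod.lift_fst, biprod.lift_fst, Preadditive.comp_neg, htx, neg_zero]
        · rw [Category.assoc, biprod.lift_snd, biprod.lift_snd, htφ]) i' p' hip'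
    (by
      rw [← cancel_mono (k (m + 1) le_rfl).hom, hi', hp']
      simp only [Category.assoc, Iso.inv_hom_id, Category.comp_id]
      rw [reassoc_of% kcm, kcm]
      refine congrArg (_ ≫ ·) (biprod.hom_ext' _ _ ?_ ?_)
      · rw [← Category.assoc, inl_ofComponents, biprod.lift_snd_assoc]
        refine biprod.hom_ext _ _ ?_ ?_
        · rw [Category.assoc, biprod.lift_fst, biprod.lift_fst, hs, Preadditive.comp_neg,
            reassoc_of% hφm, ψ.hom_inv_id, Category.comp_id]
        · rw [Category.assoc, biprod.lift_snd, biprod.lift_snd, Category.comp_id]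
      · rw [← Category.assoc, inr_ofComponents, biprod.lift_snd_assoc]
        refine biprod.hom_ext _ _ ?_ ?_
        · rw [Category.assoc, biprod.lift_fst, biprod.lift_fst, hs, Preadditive.comp_neg,
            reassoc_of% hyy, zero_comp, neg_zero]
        · rw [Category.assoc, biprod.lift_snd, biprod.lift_snd, Category.comp_id])
    (by rw [S.map_comp, reassoc_of% hA, hB])
  -- The sign left over by the braidings at the right end is absorbed by `signedIso`, which also
  -- cancels the sign in `hB`.
  refine ⟨φ, hφ0, hφn, N, hN, m₀, signedIso (m + 1) m', fun i j hij hj => e j (by omega) hj ≪≫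
    (by subst hij; exact k i (by omega)) ≪≫ signedBraiding i _ _, ?_, ?_, ?_, ?_⟩
  · rw [Iso.trans_hom, reassoc_of% h1, Iso.trans_hom]
    refine (congrArg (fun z => m₀.hom ≫ i ≫ z) ((Category.assoc _ _ _).symm.trans
      (congrArg (· ≫ (signedBraiding 0 _ _).hom) kc0))).trans ?_
    rw [hi, Category.assoc, Category.assoc k₀.hom, Iso.inv_hom_id_assoc,
      ← Category.assoc biprod.inl, inl_ofComponents]
    exact congrArg (m₀.hom ≫ ·) (lift_comp_signedBraiding_zero _ _)
  · rintro i _ _ rfl rfl hk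
    simp only [Iso.trans_hom]
    rw [reassoc_of% (h2 (i + 1) (by omega) (by omega))]
    simp only [Category.assoc, ← ofComponents_comp_signedBraiding]
    exact congrArg (_ ≫ ·) ((Category.assoc _ _ _).symm.trans
      ((congrArg (· ≫ (signedBraiding (i + 1) _ _).hom) (kc i (by omega))).trans
        (Category.assoc _ _ _)))
  · intro i hi
    obtain rfl : m = i := by omega
    simp only [Iso.trans_hom, Category.assoc, signedBraiding_comp_desc, signedIso,
      Preadditive.comp_zsmul]
    rw [h3, hp', reassoc_of% kcm]
    refine congrArg (fun z => (-1 : ℤ) ^ (m + 1) • (_ ≫ _ ≫ z)) ?_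
    apply biprod.hom_ext' <;> simp [Biprod.ofComponents]
  · rw [h4, reassoc_of% hB, ← S.map_comp, hip, S.map_id, Category.comp_id]
    simp only [signedIso, Preadditive.zsmul_comp, Preadditive.comp_zsmul]

end IsAngulated

/-! ### Transport along a fully faithful functor -/

/-- An identification of the bifunctor `E` on `𝒟` with `(C, A) ↦ 𝒞(G C, S (G A))`. -/
structure ExtIso {𝒞 : Type u} [Category.{v} 𝒞] [Preadditive 𝒞] {𝒟 : Type u'} [Category.{v'} 𝒟]
    (G : 𝒟 ⥤ 𝒞) (S : 𝒞 ⥤ 𝒞) (E : 𝒟ᵒᵖ ⥤ 𝒟 ⥤ AddCommGrpCat.{w}) where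
  /-- the isomorphisms of groups -/
  equiv : ∀ C A : 𝒟, ((E.obj (op C)).obj A) ≃+ (G.obj C ⟶ S.obj (G.obj A))
  equiv_map : ∀ ⦃C A A' : 𝒟⦄ (a : A ⟶ A') (δ : (E.obj (op C)).obj A),
    equiv C A' (((E.obj (op C)).map a).hom δ) = equiv C A δ ≫ S.map (G.map a)
  equiv_app : ∀ ⦃C C' A : 𝒟⦄ (c : C' ⟶ C) (δ : (E.obj (op C)).obj A),
    equiv C' A (((E.map c.op).app A).hom δ) = G.map c ≫ equiv C A δ

section Rows

variable {𝒞 : Type u} [Category.{v} 𝒞] {𝒟 : Type u'} [Category.{v'} 𝒟] (G : 𝒟 ⥤ 𝒞)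

theorem exists_row_map_eq [G.Full] [G.Faithful] {m : ℕ} {X Y : ComposableArrows 𝒟 m}
    (φ : (X ⋙ G : ComposableArrows 𝒞 m) ⟶ (Y ⋙ G : ComposableArrows 𝒞 m)) :
    ∃ f : X ⟶ Y, ∀ (j : ℕ) (hj : j ≤ m), G.map (app' f j hj) = app' φ j hj := by
  refine ⟨rowHom (fun j hj => G.preimage (app' φ j hj)) fun j hj => G.map_injective ?_,
    fun j hj => G.map_preimage _⟩
  rw [G.map_comp, G.map_comp, G.map_preimage, G.map_preimage]
  exact naturality' φ j (j + 1)

/-- A row in `𝒞` whose objects come from `𝒟` lifts to a row in `𝒟`. -/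
theorem exists_row_lift [G.Full] [G.Faithful] {m : ℕ} (T : ComposableArrows 𝒞 m)
    (hT : ∀ (j : ℕ) (hj : j ≤ m), ∃ d : 𝒟, Nonempty (G.obj d ≅ T.obj' j)) :
    ∃ X : ComposableArrows 𝒟 m, Nonempty ((X ⋙ G : ComposableArrows 𝒞 m) ≅ T) := by
  choose d g using fun j : Fin (m + 1) => hT j.1 (Nat.lt_succ_iff.1 j.2)
  let e : ∀ j : Fin (m + 1), G.obj (d j) ≅ T.obj j := fun j => (g j).some
  let X : ComposableArrows 𝒟 m := mkOfObjOfMapSucc d fun j =>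
    G.preimage ((e j.castSucc).hom ≫ T.map' j.1 (j.1 + 1) ≫ (e j.succ).inv)
  have hX : ∀ (j : ℕ) (hj : j < m), G.map (X.map' j (j + 1)) =
      (e ⟨j, by omega⟩).hom ≫ T.map' j (j + 1) ≫ (e ⟨j + 1, by omega⟩).inv := fun j hj => by
    have := mkOfObjOfMapSucc_map_succ d (fun j =>
      G.preimage ((e j.castSucc).hom ≫ T.map' j.1 (j.1 + 1) ≫ (e j.succ).inv)) j hj
    refine (congrArg G.map this).trans (G.map_preimage _)
  refine ⟨X, ⟨isoMk (fun j => e j) fun j hj => ?_⟩⟩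
  have key : ∀ {A B C D : 𝒞} (a : A ⟶ B) (b : B ⟶ C) (c : D ≅ C), (a ≫ b ≫ c.inv) ≫ c.hom = a ≫ b :=
    fun a b c => by simp
  exact (congrArg (· ≫ (e ⟨j + 1, by omega⟩).hom) (hX j hj)).trans (key _ _ _)

theorem homotopic_map [Preadditive 𝒞] [Preadditive 𝒟] [G.Additive] {n : ℕ}
    {X Y : ComposableArrows 𝒟 (n + 1)} {f g : X ⟶ Y} (h : NComplex.Homotopic f g) :
    NComplex.Homotopic (X := X ⋙ G) (Y := Y ⋙ G) (Functor.whiskerRight f G)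
      (Functor.whiskerRight g G) := by
  obtain ⟨s, h0, hi, hn⟩ := h
  have key : ∀ (j : ℕ) (hj : j ≤ n + 1), app' (F := X ⋙ G) (G := Y ⋙ G)
      (Functor.whiskerRight g G - Functor.whiskerRight f G) j hj = G.map (app' (g - f) j hj) :=
    fun j hj => (G.map_sub (f := g.app ⟨j, by omega⟩) (g := f.app ⟨j, by omega⟩)).symm
  refine ⟨fun i hi => G.map (s i hi), ?_, fun i hin => ?_, ?_⟩
  · rw [key, h0]
    exact G.map_comp _ _
  · rw [key, hi i hin, G.map_add, G.map_comp, G.map_comp]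
    rfl
  · rw [key, hn]
    exact G.map_comp _ _

end Rows

section Model

variable {𝒞 : Type u} [Category.{v} 𝒞] [Preadditive 𝒞] [HasFiniteBiproducts 𝒞]
  {S : 𝒞 ⥤ 𝒞} {n : ℕ} {Θ : Set (SigmaSeq S n)} {P : ObjectProperty 𝒞}
  {𝒟 : Type u'} [Category.{v'} 𝒟] [Preadditive 𝒟] {G : 𝒟 ⥤ 𝒞} [G.Full] [G.Faithful] [G.Additive]

/-- An angle whose objects come from `𝒟` is isomorphic to the image of a complex in `𝒟`. -/
theorem IsAngulated.exists_nComplex (hΘ : IsAngulated S n Θ) (hn : 1 ≤ n)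
    (hPG : ∀ X, P X → ∃ d, Nonempty (G.obj d ≅ X)) {T : SigmaSeq S n} (hT : T ∈ Θ)
    (hTP : T.Within P) {A C : 𝒟} (a : T.seq.obj' 0 ≅ G.obj A) (c : T.seq.obj' (n + 1) ≅ G.obj C)
    (δ : G.obj C ⟶ S.obj (G.obj A)) (hδ : T.last ≫ S.map a.hom = c.hom ≫ δ) :
    ∃ (X : NComplex n A C)
      (e : ∀ (j : ℕ) (hj : j ≤ n + 1), G.obj (X.seq.obj' j) ≅ T.seq.obj' j),
      (∀ (j : ℕ) (hj : j < n + 1), G.map (X.seq.map' j (j + 1)) ≫ (e (j + 1) hj).hom =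
        (e j (by omega)).hom ≫ T.seq.map' j (j + 1)) ∧
      (e 0 (Nat.zero_le _)).hom ≫ a.hom = G.map X.left.hom ∧
      (e (n + 1) le_rfl).hom ≫ c.hom = G.map X.right.hom ∧ X.toSigmaSeq G S δ ∈ Θ := by
  have := hΘ.additive
  obtain ⟨X, ⟨e⟩⟩ := exists_row_lift G T.seq fun j hj => hPG _ (hTP j hj)
  obtain ⟨e', he'⟩ : ∃ e' : ∀ (j : ℕ) (hj : j ≤ n + 1), G.obj (X.obj' j) ≅ T.seq.obj' j,
    ∀ (j : ℕ) (hj : j ≤ n + 1), (e' j hj).hom = app' e.hom j hj ∧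
      (e' j hj).inv = app' e.inv j hj :=
    ⟨fun j hj => e.app ⟨j, by omega⟩, fun _ _ => ⟨rfl, rfl⟩⟩
  have hw : ∀ (j : ℕ) (hj : j < n + 1), G.map (X.map' j (j + 1)) ≫ (e' (j + 1) hj).hom =
      (e' j (by omega)).hom ≫ T.seq.map' j (j + 1) := fun j hj => by
    rw [(he' _ _).1, (he' _ _).1]
    exact naturality' e.hom j (j + 1)
  have hc := hΘ.isComplex hn hT
  have hXc : X.IsComplex := ⟨fun j hj => G.map_injective (by
    rw [G.map_comp, G.map_zero, ← cancel_mono (e' (j + 2) hj).hom, Category.assoc,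
      hw (j + 1) (by omega), ← Category.assoc, hw j (by omega), Category.assoc]
    exact (congrArg (_ ≫ ·) (hc.zero j)).trans (comp_zero.trans zero_comp.symm))⟩
  refine ⟨⟨X, hXc, G.preimageIso (e' 0 (Nat.zero_le _) ≪≫ a),
    G.preimageIso (e' (n + 1) le_rfl ≪≫ c)⟩, e', hw, ?_, ?_, ?_⟩
  · exact (G.map_preimage _).symm
  · exact (G.map_preimage _).symm
  · refine hΘ.mem_of_iso' (A := T) e.symm ?_ hT
    have h0 : (e' 0 (Nat.zero_le _)).inv = app' e.inv 0 := (he' _ _).2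
    have h1 : (e' (n + 1) le_rfl).inv = app' e.inv (n + 1) := (he' _ _).2
    change T.last ≫ S.map (app' e.inv 0) = app' e.inv (n + 1) ≫ G.map (G.preimage _) ≫ δ ≫
      S.map (G.map (G.preimage _))
    rw [G.map_preimage, G.map_preimage, ← h0, ← h1]
    simp only [Iso.trans_hom, Iso.trans_inv, Category.assoc, Iso.inv_hom_id_assoc]
    rw [← reassoc_of% hδ, ← S.map_comp, a.hom_inv_id_assoc]

end Model

namespace ExtIso

variable {𝒞 : Type u} [Category.{v} 𝒞] [Preadditive 𝒞] [HasFiniteBiproducts 𝒞]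
  {S : 𝒞 ⥤ 𝒞} {n : ℕ} {Θ : Set (SigmaSeq S n)} {P : ObjectProperty 𝒞}
  {𝒟 : Type u'} [Category.{v'} 𝒟] [Preadditive 𝒟] {G : 𝒟 ⥤ 𝒞} [G.Full] [G.Faithful] [G.Additive]
  {E : 𝒟ᵒᵖ ⥤ 𝒟 ⥤ AddCommGrpCat.{w}} (κ : ExtIso G S E)

theorem equiv_push {A A' C : 𝒟} (a : A ⟶ A') (δ : Ext E C A) :
    κ.equiv C A' (push E a δ) = κ.equiv C A δ ≫ S.map (G.map a) :=
  κ.equiv_map a δ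

theorem equiv_pull {A C C' : 𝒟} (c : C' ⟶ C) (δ : Ext E C A) :
    κ.equiv C' A (pull E c δ) = G.map c ≫ κ.equiv C A δ :=
  κ.equiv_app c δ

/-- The complex `X` in `𝒟` and the extension `δ` form an angle in `𝒞`. -/
def IsAngle (Θ : Set (SigmaSeq S n)) {A C : 𝒟} (X : NComplex n A C) (δ : Ext E C A) : Prop :=
  X.toSigmaSeq G S (κ.equiv C A δ) ∈ Θ

variable {κ}

theorem additive_fst (κ : ExtIso G S E) : E.Additive := by
  refine ⟨fun {C C' f g} => ?_⟩
  ext A δ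
  refine (κ.equiv _ _).injective ?_
  refine (κ.equiv_app (f + g).unop δ).trans ?_
  refine Eq.trans ?_ ((κ.equiv _ _).map_add _ _).symm
  refine Eq.trans ?_ (congrArg₂ (· + ·) (κ.equiv_app f.unop δ) (κ.equiv_app g.unop δ)).symm
  rw [unop_add, G.map_add, Preadditive.add_comp]

theorem additive_snd [S.Additive] (κ : ExtIso G S E) (C : 𝒟ᵒᵖ) : (E.obj C).Additive := by
  refine ⟨fun {A A' f g} => ?_⟩
  ext δ
  refine (κ.equiv C.unop A').injective ?_
  refine (κ.equiv_map (f + g) δ).trans ?_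
  refine Eq.trans ?_ ((κ.equiv C.unop A').map_add _ _).symm
  refine Eq.trans ?_ (congrArg₂ (· + ·) (κ.equiv_map f δ) (κ.equiv_map g δ)).symm
  rw [G.map_add, S.map_add, Preadditive.comp_add]

theorem exists_isAngle (κ : ExtIso G S E) (hΘ : IsAngulated S n Θ) (hn : 1 ≤ n)
    (hGP : ∀ d, P (G.obj d))
    (hPG : ∀ X, P X → ∃ d, Nonempty (G.obj d ≅ X)) (hext : IsExtensionClosed Θ P) {A C : 𝒟}
    (δ : Ext E C A) : ∃ X : NComplex n A C, κ.IsAngle Θ X δ := by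
  obtain ⟨T, hT, ⟨a, c, h⟩, hTP⟩ := hext (hGP A) (hGP C) (κ.equiv C A δ)
  obtain ⟨X, e, -, -, -, hX⟩ := hΘ.exists_nComplex hn hPG hT hTP a c _ h
  exact ⟨X, hX⟩

/-- Exactness over `𝒟` is exactness of the angle tested on objects `G W`, since `G` is fully
faithful. -/
theorem IsAngle.isExangle (hΘ : IsAngulated S n Θ) (hn : 1 ≤ n) {A C : 𝒟} {X : NComplex n A C}
    {δ : Ext E C A} (hX : κ.IsAngle Θ X δ) : IsExangle E X δ where
  push_first := by
    refine (κ.equiv _ _).injective ?_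
    rw [κ.equiv_push, map_zero, ← cancel_epi (G.map X.right.hom), comp_zero, NComplex.first,
      G.map_comp, S.map_comp]
    have : (G.map X.right.hom ≫ κ.equiv C A δ ≫ S.map (G.map X.left.inv)) ≫
        S.map (G.map (X.seq.map' 0 1)) = 0 := hΘ.last_comp_map hn hX
    simpa only [Category.assoc] using this
  pull_final := by
    refine (κ.equiv _ _).injective ?_
    rw [κ.equiv_pull, map_zero, ← cancel_mono (S.map (G.map X.left.inv)), zero_comp,
      NComplex.final, G.map_comp, Category.assoc, Category.assoc]
    exact hΘ.map_comp_last hn hX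
  exact_left i hi W g hg := by
    have hg' : G.map g ≫ G.map (X.seq.map' (i + 1) (i + 2)) = 0 := by
      rw [← G.map_comp, hg, G.map_zero]
    obtain ⟨h, hh⟩ : ∃ h : G.obj W ⟶ G.obj (X.seq.obj' i),
      h ≫ G.map (X.seq.map' i (i + 1)) = G.map g := hΘ.exists_lift hn hX i hi (G.map g) hg'
    obtain ⟨h, rfl⟩ := G.map_surjective h
    exact ⟨h, G.map_injective (by rw [G.map_comp, hh])⟩
  exact_left_end W g hg := by
    have hg' : G.map g ≫ κ.equiv C A δ = 0 := by rw [← κ.equiv_pull, hg, map_zero]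
    have hg2 : G.map (g ≫ X.right.inv) ≫ G.map X.right.hom ≫ κ.equiv C A δ ≫
        S.map (G.map X.left.inv) = 0 := by
      rw [← G.map_comp_assoc, Category.assoc, Iso.inv_hom_id, Category.comp_id, reassoc_of% hg',
        zero_comp]
    obtain ⟨h, hh⟩ : ∃ h : G.obj W ⟶ G.obj (X.seq.obj' n),
      h ≫ G.map (X.seq.map' n (n + 1)) = G.map (g ≫ X.right.inv) :=
        hΘ.exists_lift_last hn hX (G.map (g ≫ X.right.inv)) hg2
    obtain ⟨h, rfl⟩ := G.map_surjective h
    have : h ≫ X.seq.map' n (n + 1) = g ≫ X.right.inv := G.map_injective (by rw [G.map_comp, hh])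
    exact ⟨h, by rw [NComplex.final, reassoc_of% this, Iso.inv_hom_id, Category.comp_id]⟩
  exact_right i hi W g hg := by
    have hg' : G.map (X.seq.map' i (i + 1)) ≫ G.map g = 0 := by
      rw [← G.map_comp, hg, G.map_zero]
    obtain ⟨h, hh⟩ : ∃ h : G.obj (X.seq.obj' (i + 2)) ⟶ G.obj W,
      G.map (X.seq.map' (i + 1) (i + 2)) ≫ h = G.map g := hΘ.exists_desc hn hX i hi (G.map g) hg'
    obtain ⟨h, rfl⟩ := G.map_surjective h
    exact ⟨h, G.map_injective (by rw [G.map_comp, hh])⟩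
  exact_right_end W g hg := by
    have hg' : κ.equiv C A δ ≫ S.map (G.map g) = 0 := by rw [← κ.equiv_push, hg, map_zero]
    have hg2 : (G.map X.right.hom ≫ κ.equiv C A δ ≫ S.map (G.map X.left.inv)) ≫
        S.map (G.map (X.left.hom ≫ g)) = 0 := by
      rw [Category.assoc, Category.assoc, ← S.map_comp, ← G.map_comp, Iso.inv_hom_id_assoc, hg',
        comp_zero]
    obtain ⟨h, hh⟩ : ∃ h : G.obj (X.seq.obj' 1) ⟶ G.obj W,
      G.map (X.seq.map' 0 1) ≫ h = G.map (X.left.hom ≫ g) :=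
        hΘ.exists_desc_first hn hX (G.map (X.left.hom ≫ g)) hg2
    obtain ⟨h, rfl⟩ := G.map_surjective h
    have : X.seq.map' 0 1 ≫ h = X.left.hom ≫ g := G.map_injective (by rw [G.map_comp, hh])
    exact ⟨h, by rw [NComplex.first, Category.assoc, this, Iso.inv_hom_id_assoc]⟩

/-- A morphism of extensions is compatible with the last arrows of the realizing sequences. -/
theorem last_comp {A C A' C' : 𝒟} {X : NComplex n A C} {Y : NComplex n A' C'} {δ : Ext E C A}
    {δ' : Ext E C' A'} {a : A ⟶ A'} {c : C ⟶ C'} (h : push E a δ = pull E c δ') :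
    (X.toSigmaSeq G S (κ.equiv C A δ)).last ≫ S.map (G.map (X.left.hom ≫ a ≫ Y.left.inv)) =
      G.map (X.right.hom ≫ c ≫ Y.right.inv) ≫ (Y.toSigmaSeq G S (κ.equiv C' A' δ')).last := by
  have h' : κ.equiv C A δ ≫ S.map (G.map a) = G.map c ≫ κ.equiv C' A' δ' := by
    rw [← κ.equiv_push, ← κ.equiv_pull, h]
  have key : (G.map X.right.hom ≫ κ.equiv C A δ ≫ S.map (G.map X.left.inv)) ≫
        S.map (G.map (X.left.hom ≫ a ≫ Y.left.inv)) = G.map (X.right.hom ≫ c ≫ Y.right.inv) ≫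
      G.map Y.right.hom ≫ κ.equiv C' A' δ' ≫ S.map (G.map Y.left.inv) := by
    rw [Category.assoc, Category.assoc, ← S.map_comp, ← G.map_comp, Iso.inv_hom_id_assoc,
      ← G.map_comp_assoc (X.right.hom ≫ c ≫ Y.right.inv), Category.assoc, Category.assoc,
      Iso.inv_hom_id, Category.comp_id, G.map_comp a, S.map_comp, reassoc_of% h', G.map_comp,
      Category.assoc]
  exact key

/-- A morphism of rows with the right components at the ends is a lift. -/
theorem isLift_of_map_eq {A C A' C' : 𝒟} {X : NComplex n A C} {Y : NComplex n A' C'}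
    {a : A ⟶ A'} {c : C ⟶ C'} {f : X.seq ⟶ Y.seq}
    (h0 : G.map (app' f 0) = G.map (X.left.hom ≫ a ≫ Y.left.inv))
    (h1 : G.map (app' f (n + 1)) = G.map (X.right.hom ≫ c ≫ Y.right.inv)) :
    NComplex.IsLift (X := X) (Y := Y) a c f := by
  constructor
  · rw [G.map_injective h0, Category.assoc, Category.assoc, Iso.inv_hom_id, Category.comp_id]
  · rw [G.map_injective h1, Category.assoc, Category.assoc, Iso.inv_hom_id, Category.comp_id]

theorem IsAngle.exists_isLift (hΘ : IsAngulated S n Θ) (hn : 1 ≤ n) {A C A' C' : 𝒟}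
    {X : NComplex n A C} {Y : NComplex n A' C'} {δ : Ext E C A} {δ' : Ext E C' A'}
    (hX : κ.IsAngle Θ X δ) (hY : κ.IsAngle Θ Y δ') {a : A ⟶ A'} {c : C ⟶ C'}
    (h : push E a δ = pull E c δ') :
    ∃ f : X.seq ⟶ Y.seq, NComplex.IsLift (X := X) (Y := Y) a c f := by
  obtain ⟨φ, h0, h1, -⟩ := hΘ.exists_hom_cone_of_ends hn hX hY _ _ (last_comp (κ := κ) h)
  obtain ⟨f, hf⟩ := exists_row_map_eq G φ.φ
  exact ⟨f, isLift_of_map_eq (G := G) ((hf _ _).trans h0) ((hf _ _).trans h1)⟩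

theorem push_id_eq_pull_id {A C : 𝒟} (δ : Ext E C A) : push E (𝟙 A) δ = pull E (𝟙 C) δ := by
  simp [push, pull]

theorem IsAngle.homotopyEquivalent (hΘ : IsAngulated S n Θ) (hn : 1 ≤ n) {A C : 𝒟}
    {X Y : NComplex n A C} {δ : Ext E C A} (hX : κ.IsAngle Θ X δ) (hY : κ.IsAngle Θ Y δ) :
    NComplex.HomotopyEquivalent X Y := by
  obtain ⟨f, hf⟩ := hX.exists_isLift hΘ hn hY (push_id_eq_pull_id δ)
  obtain ⟨g, hg⟩ := hY.exists_isLift hΘ hn hX (push_id_eq_pull_id δ)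
  have eX := hX.isExangle hΘ hn
  have eY := hY.isExangle hΘ hn
  exact NComplex.homotopyEquivalent_of_exact eX.exact_right eX.exact_left eY.exact_right
    eY.exact_left hf hg

/-- One of the two homotopies suffices: its image under `G` exhibits `Y` as a homotopy retract of
the angle `X`, equal to the identity at the left end, as `mem_of_homotopic` requires. -/
theorem IsAngle.of_homotopyEquivalent [IsIdempotentComplete 𝒞] (hΘ : IsAngulated S n Θ)
    (hn : 1 ≤ n) {A C : 𝒟} {X Y : NComplex n A C} {δ : Ext E C A} (hX : κ.IsAngle Θ X δ)
    (h : NComplex.HomotopyEquivalent X Y) : κ.IsAngle Θ Y δ := by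
  obtain ⟨f, g, hf, hg, -, hgf⟩ := h
  have hl : ∀ {X Y : NComplex n A C} {f : X.seq ⟶ Y.seq}
      (_ : NComplex.IsLift (X := X) (Y := Y) (𝟙 A) (𝟙 C) f),
      (X.toSigmaSeq G S (κ.equiv C A δ)).last ≫ S.map (G.map (app' f 0)) =
        G.map (app' f (n + 1)) ≫ (Y.toSigmaSeq G S (κ.equiv C A δ)).last := by
    intro X Y f hf
    have := last_comp (κ := κ) (X := X) (Y := Y) (push_id_eq_pull_id δ)
    have h0 : app' f 0 = X.left.hom ≫ 𝟙 A ≫ Y.left.inv := by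
      rw [← cancel_mono Y.left.hom, hf.1, Category.id_comp, Category.assoc, Iso.inv_hom_id]
    have h1 : app' f (n + 1) = X.right.hom ≫ 𝟙 C ≫ Y.right.inv := by
      rw [← cancel_mono Y.right.hom, hf.2, Category.id_comp, Category.assoc, Iso.inv_hom_id]
    rwa [← h0, ← h1] at this
  have hc : NComplex.Homotopic (X := Y.seq ⋙ G) (Y := Y.seq ⋙ G)
      (Functor.whiskerRight (g ≫ f) G) (Functor.whiskerRight (𝟙 Y.seq) G) := homotopic_map G hgf
  rw [Functor.whiskerRight_comp, Functor.whiskerRight_id'] at hc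
  have hYc : ComposableArrows.IsComplex (n := n + 1) (Y.seq ⋙ G) := ⟨fun i hi => by
    have := congrArg G.map (Y.isComplex.zero i hi)
    rw [G.map_comp, G.map_zero] at this
    exact this⟩
  have eX := hX.isExangle hΘ hn
  have h0X : G.map X.final ≫ κ.equiv C A δ = 0 := by
    rw [← κ.equiv_pull, eX.pull_final, map_zero]
  have hfin : Y.final = app' g n ≫ X.final := by
    rw [NComplex.final, NComplex.final, ← Category.assoc, ← naturality' g n (n + 1),
      Category.assoc, hg.2, Category.comp_id]
  have h0Y : G.map Y.final ≫ κ.equiv C A δ = 0 := by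
    rw [hfin, G.map_comp, Category.assoc, h0X, comp_zero]
  have hYl : G.map (Y.seq.map' n (n + 1)) ≫ G.map Y.right.hom ≫ κ.equiv C A δ ≫
      S.map (G.map Y.left.inv) = 0 := by
    rw [← G.map_comp_assoc]
    exact (reassoc_of% h0Y) (S.map (G.map Y.left.inv)) |>.trans zero_comp
  have hgf0 : app' g 0 ≫ app' f 0 = 𝟙 (Y.seq.obj' 0) := by
    rw [← cancel_mono Y.left.hom, Category.assoc, hf.1, Category.comp_id, hg.1, Category.comp_id,
      Category.id_comp]
  have hG0 : G.map (app' g 0) ≫ G.map (app' f 0) = 𝟙 (G.obj (Y.seq.obj' 0)) := by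
    rw [← G.map_comp, hgf0, G.map_id]
  exact hΘ.mem_of_homotopic hX hYc hYl ⟨Functor.whiskerRight g G, hl hg⟩
    ⟨Functor.whiskerRight f G, hl hf⟩ hG0 hc

/-- The realization defined by the angles. -/
def realization (κ : ExtIso G S E) (h : ∀ (A C : 𝒟) (δ : Ext E C A),
    ∃ X : NComplex n A C, κ.IsAngle Θ X δ) : Realization E n :=
  fun A C δ => Quotient.mk _ (h A C δ).choose

/-- Angles over `δ` form a single homotopy class, so the choice made in `realization` is immaterial
and every axiom can be checked on angles. -/
theorem distinguished_realization_iff [IsIdempotentComplete 𝒞] (hΘ : IsAngulated S n Θ)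
    (hn : 1 ≤ n) (h : ∀ (A C : 𝒟) (δ : Ext E C A), ∃ X : NComplex n A C, κ.IsAngle Θ X δ)
    {A C : 𝒟} {X : NComplex n A C} {δ : Ext E C A} :
    (κ.realization h).Distinguished X δ ↔ κ.IsAngle Θ X δ := by
  have h' := (h A C δ).choose_spec
  exact ⟨fun hX => h'.of_homotopyEquivalent hΘ hn (Quotient.exact hX),
    fun hX => Quotient.sound (h'.homotopyEquivalent hΘ hn hX)⟩

end ExtIso

attribute [local instance] preservesBinaryBiproduct_of_preservesBiproduct


/-! ### Matrix identities lifted along a fully faithful functor -/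

section Preimage

variable {𝒞 : Type u} [Category.{v} 𝒞] [Preadditive 𝒞] [HasFiniteBiproducts 𝒞]
  {𝒟 : Type u'} [Category.{v'} 𝒟] [Preadditive 𝒟] [HasFiniteBiproducts 𝒟]
  (G : 𝒟 ⥤ 𝒞) [G.Full] [G.Faithful] [G.Additive]

/-- An isomorphism `G Z ≅ T ≅ G X ⊞ G Y` comes from an isomorphism `Z ≅ X ⊞ Y`. -/
def preimageBiprodIso {X Y Z : 𝒟} {T : 𝒞} (e : G.obj Z ≅ T) (b : T ≅ G.obj X ⊞ G.obj Y) :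
    Z ≅ X ⊞ Y :=
  G.preimageIso (e ≪≫ b ≪≫ (G.mapBiprod X Y).symm)

theorem map_preimageBiprodIso {X Y Z : 𝒟} {T : 𝒞} (e : G.obj Z ≅ T)
    (b : T ≅ G.obj X ⊞ G.obj Y) : G.map (preimageBiprodIso G e b).hom ≫ (G.mapBiprod X Y).hom =
      e.hom ≫ b.hom := by
  simp only [preimageBiprodIso, Functor.preimageIso_hom, Functor.map_preimage, Iso.trans_hom,
    Iso.symm_hom, Category.assoc, Iso.inv_hom_id, Category.comp_id]

theorem map_ofComponents {X Y X' Y' : 𝒟} (x : X ⟶ X') (y : X ⟶ Y') (z : Y ⟶ X') (w : Y ⟶ Y') :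
    G.map (Biprod.ofComponents x y z w) ≫ (G.mapBiprod X' Y').hom = (G.mapBiprod X Y).hom ≫
      Biprod.ofComponents (G.map x) (G.map y) (G.map z) (G.map w) := by
  rw [← cancel_epi (G.mapBiprod X Y).inv, Iso.inv_hom_id_assoc]
  apply biprod.hom_ext' <;> apply biprod.hom_ext <;>
    simp only [Functor.mapBiprod_inv, Functor.mapBiprod_hom, biprod.inl_desc_assoc,
      biprod.inr_desc_assoc, Category.assoc, biprod.lift_fst, biprod.lift_snd, ← G.map_comp,
      Biprod.ofComponents_fst, Biprod.ofComponents_snd, Preadditive.comp_add,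
      biprod.inl_fst_assoc, biprod.inl_snd_assoc, biprod.inr_fst_assoc, biprod.inr_snd_assoc,
      zero_comp, add_zero, zero_add]

variable {G}

theorem first_preimageBiprodIso {A M₀ M₁ X Y : 𝒟} {T₀ T₁ : 𝒞} {l : M₀ ≅ A} {d : M₀ ⟶ M₁}
    {e₀ : G.obj M₀ ≅ T₀} {e₁ : G.obj M₁ ≅ T₁} {t : T₀ ⟶ T₁} {b : T₁ ≅ G.obj X ⊞ G.obj Y}
    {a : T₀ ≅ G.obj A} (ha : e₀.hom ≫ a.hom = G.map l.hom) (hd : G.map d ≫ e₁.hom = e₀.hom ≫ t)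
    {x : A ⟶ X} {y : A ⟶ Y} {x' : G.obj A ⟶ G.obj X} {y' : G.obj A ⟶ G.obj Y} (hx : G.map x = x')
    (hy : G.map y = y') (ht : t ≫ b.hom = a.hom ≫ biprod.lift x' y') :
    (l.inv ≫ d) ≫ (preimageBiprodIso G e₁ b).hom = biprod.lift x y := by
  subst hx hy
  apply G.map_injective
  rw [← cancel_mono (G.mapBiprod X Y).hom, G.map_comp, G.map_comp, Category.assoc,
    Category.assoc, map_preimageBiprodIso, reassoc_of% hd, ht, reassoc_of% ha, ← G.map_comp_assoc,
    Iso.inv_hom_id, G.map_id, Category.id_comp, biprod.map_lift_mapBiprod]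

theorem middle_preimageBiprodIso {M₀ M₁ X Y X' Y' : 𝒟} {T₀ T₁ : 𝒞} {d : M₀ ⟶ M₁}
    {e₀ : G.obj M₀ ≅ T₀} {e₁ : G.obj M₁ ≅ T₁} {t : T₀ ⟶ T₁} {b : T₀ ≅ G.obj X ⊞ G.obj Y}
    {b' : T₁ ≅ G.obj X' ⊞ G.obj Y'} (hd : G.map d ≫ e₁.hom = e₀.hom ≫ t)
    {x : X ⟶ X'} {y : X ⟶ Y'} {z : Y ⟶ X'} {w : Y ⟶ Y'} {x' y' z' w'}
    (hx : G.map x = x') (hy : G.map y = y') (hz : G.map z = z') (hw : G.map w = w')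
    (ht : t ≫ b'.hom = b.hom ≫ Biprod.ofComponents x' y' z' w') :
    d ≫ (preimageBiprodIso G e₁ b').hom =
      (preimageBiprodIso G e₀ b).hom ≫ Biprod.ofComponents x y z w := by
  subst hx hy hz hw
  apply G.map_injective
  rw [← cancel_mono (G.mapBiprod X' Y').hom, G.map_comp, G.map_comp, Category.assoc,
    Category.assoc, map_preimageBiprodIso, map_ofComponents, reassoc_of% hd, ht,
    reassoc_of% (map_preimageBiprodIso G e₀ b)]

theorem final_preimageBiprodIso {D M₀ M₁ X Y : 𝒟} {T₀ T₁ : 𝒞} {r : M₁ ≅ D} {d : M₀ ⟶ M₁}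
    {e₀ : G.obj M₀ ≅ T₀} {e₁ : G.obj M₁ ≅ T₁} {t : T₀ ⟶ T₁} {b : T₀ ≅ G.obj X ⊞ G.obj Y}
    {c : T₁ ≅ G.obj D} (hc : e₁.hom ≫ c.hom = G.map r.hom) (hd : G.map d ≫ e₁.hom = e₀.hom ≫ t)
    {x : X ⟶ D} {y : Y ⟶ D} {x' : G.obj X ⟶ G.obj D} {y' : G.obj Y ⟶ G.obj D} (hx : G.map x = x')
    (hy : G.map y = y') (ht : t ≫ c.hom = b.hom ≫ biprod.desc x' y') :
    d ≫ r.hom = (preimageBiprodIso G e₀ b).hom ≫ biprod.desc x y := by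
  subst hx hy
  apply G.map_injective
  rw [G.map_comp, ← hc, reassoc_of% hd, ht, G.map_comp, ← reassoc_of%
    (map_preimageBiprodIso G e₀ b)]
  congr 1
  rw [← cancel_epi (G.mapBiprod X Y).inv, Iso.inv_hom_id_assoc, biprod.mapBiprod_inv_map_desc]

theorem comp_desc_of_comp {T₀ T₁ Q R U V : 𝒞} {t : T₀ ⟶ T₁} {m : T₁ ⟶ Q} {b : T₀ ⟶ U ⊞ V}
    {x : U ⟶ Q} {y : V ⟶ Q} (h : t ≫ m = b ≫ biprod.desc x y) (r : Q ⟶ R) :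
    t ≫ m ≫ r = b ≫ biprod.desc (x ≫ r) (y ≫ r) := by
  rw [reassoc_of% h]
  congr 1
  apply biprod.hom_ext' <;> simp only [biprod.inl_desc, biprod.inl_desc_assoc, biprod.inr_desc,
    biprod.inr_desc_assoc]

variable (G) in
theorem lift_map_comp {X A Y Z : 𝒟} {T : 𝒞} (m : T ⟶ G.obj X) (l : X ≅ A) (q : X ⟶ Y)
    (d : X ⟶ Z) : m ≫ biprod.lift (G.map q) (G.map d) = (m ≫ G.map l.hom) ≫
      biprod.lift (G.map l.inv ≫ G.map q) (G.map l.inv ≫ G.map d) := by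
  apply biprod.hom_ext <;> simp only [Category.assoc, biprod.lift_fst, biprod.lift_snd,
    ← G.map_comp, Iso.hom_inv_id_assoc]

variable (G) in
theorem map_last_comp {S : 𝒞 ⥤ 𝒞} {T : 𝒞} {Y₁ D A Y₀ X₀ X₁ : 𝒟} (m : T ⟶ G.obj Y₁) (r : Y₁ ⟶ D)
    (k : G.obj D ⟶ S.obj (G.obj A)) (y : Y₀ ≅ A) (x : X₀ ≅ A) (d : X₀ ⟶ X₁) :
    m ≫ (G.map r ≫ k ≫ S.map (G.map y.inv)) ≫ S.map (G.map ((y.hom ≫ 𝟙 A) ≫ x.inv) ≫ G.map d) =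
      (m ≫ G.map r) ≫ k ≫ S.map (G.map (x.inv ≫ d)) := by
  simp only [Category.assoc, ← S.map_comp, ← G.map_comp, Category.comp_id, Iso.inv_hom_id_assoc]

variable (G) in
theorem map_final_comp {S : 𝒞 ⥤ 𝒞} {T T' : 𝒞} {Y₀ Y₁ X₁ C A X₀ : 𝒟} {l : T ⟶ S.obj T'}
    {m : T' ⟶ G.obj X₀} {m' : T ⟶ G.obj Y₀} {d : Y₀ ⟶ Y₁} {y : Y₁ ≅ C} {x : X₁ ≅ C}
    {k : G.obj C ⟶ S.obj (G.obj A)} {z : X₀ ≅ A}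
    (h : l ≫ S.map m = m' ≫ G.map d ≫ G.map ((y.hom ≫ 𝟙 C) ≫ x.inv) ≫
      G.map x.hom ≫ k ≫ S.map (G.map z.inv)) :
    l ≫ S.map (m ≫ G.map z.hom) = m' ≫ G.map (d ≫ y.hom) ≫ k := by
  rw [S.map_comp, reassoc_of% h]
  simp only [Category.assoc, ← S.map_comp, ← G.map_comp_assoc, Category.comp_id, Iso.inv_hom_id,
    ← G.map_comp, G.map_id, S.map_id]

end Preimage

/-! ### The exangulated structure given by the angles -/

namespace ExtIso

variable {𝒞 : Type u} [Category.{v} 𝒞] [Preadditive 𝒞] [HasFiniteBiproducts 𝒞]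
  {S : 𝒞 ⥤ 𝒞} {n : ℕ} {Θ : Set (SigmaSeq S n)} {P : ObjectProperty 𝒞}
  {𝒟 : Type u'} [Category.{v'} 𝒟] [Preadditive 𝒟] {G : 𝒟 ⥤ 𝒞} [G.Full] [G.Faithful] [G.Additive]
  {E : 𝒟ᵒᵖ ⥤ 𝒟 ⥤ AddCommGrpCat.{w}} {κ : ExtIso G S E}

/-- Inflations do not mention a chosen extension; for a given angle inside `P`, the extension is
read off from its last arrow. -/
theorem isInflation_iff (hΘ : IsAngulated S n Θ) (hn : 1 ≤ n) (hGP : ∀ d, P (G.obj d))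
    (hPG : ∀ X, P X → ∃ d, Nonempty (G.obj d ≅ X)) {s : Realization E n}
    (hs : ∀ {A C : 𝒟} {X : NComplex n A C} {δ : Ext E C A},
      s.Distinguished X δ ↔ κ.IsAngle Θ X δ) {A B : 𝒟} (f : A ⟶ B) :
    s.IsInflation f ↔ IsFirstArrow Θ P (G.map f) := by
  constructor
  · rintro ⟨C, δ, X, e, hX, rfl⟩
    refine ⟨_, hs.1 hX, fun i hi => hGP _, G.mapIso X.left, G.mapIso e, ?_⟩
    change G.map (X.seq.map' 0 1) ≫ G.map e.hom = G.map X.left.hom ≫ G.map (X.first ≫ e.hom)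
    rw [← G.map_comp, ← G.map_comp, NComplex.first, Category.assoc, Iso.hom_inv_id_assoc]
  · rintro ⟨T, hT, hTP, e₀, e₁, w⟩
    obtain ⟨C, ⟨c⟩⟩ := hPG _ (hTP (n + 1) le_rfl)
    obtain ⟨X, e, he, hl, -, hX⟩ := hΘ.exists_nComplex hn hPG hT hTP e₀ c.symm
      (c.hom ≫ T.last ≫ S.map e₀.hom) (by rw [Iso.symm_hom, Iso.inv_hom_id_assoc])
    refine ⟨C, (κ.equiv C A).symm (c.hom ≫ T.last ≫ S.map e₀.hom), X,
      G.preimageIso (e 1 (by omega) ≪≫ e₁), hs.2 ?_, ?_⟩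
    · rw [IsAngle, AddEquiv.apply_symm_apply]
      exact hX
    · apply G.map_injective
      rw [NComplex.first, G.map_comp, G.map_comp, G.preimageIso_hom, G.map_preimage,
        Iso.trans_hom, Category.assoc, reassoc_of% (he 0 (by omega)), w, reassoc_of% hl,
        ← G.map_comp_assoc, Iso.inv_hom_id, G.map_id, Category.id_comp]

theorem isDeflation_iff (hΘ : IsAngulated S n Θ) (hn : 1 ≤ n) (hGP : ∀ d, P (G.obj d))
    (hPG : ∀ X, P X → ∃ d, Nonempty (G.obj d ≅ X)) {s : Realization E n}
    (hs : ∀ {A C : 𝒟} {X : NComplex n A C} {δ : Ext E C A},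
      s.Distinguished X δ ↔ κ.IsAngle Θ X δ) {B C : 𝒟} (f : B ⟶ C) :
    s.IsDeflation f ↔ IsFinalArrow Θ P (G.map f) := by
  constructor
  · rintro ⟨A, δ, X, e, hX, rfl⟩
    refine ⟨_, hs.1 hX, fun i hi => hGP _, G.mapIso e.symm, G.mapIso X.right, ?_⟩
    change G.map (X.seq.map' n (n + 1)) ≫ G.map X.right.hom =
      G.map e.inv ≫ G.map (e.hom ≫ X.final)
    rw [← G.map_comp, ← G.map_comp, NComplex.final, Iso.inv_hom_id_assoc]
  · rintro ⟨T, hT, hTP, e₀, e₁, w⟩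
    obtain ⟨A, ⟨a⟩⟩ := hPG _ (hTP 0 (Nat.zero_le _))
    obtain ⟨X, e, he, -, hr, hX⟩ := hΘ.exists_nComplex hn hPG hT hTP a.symm e₁
      (e₁.inv ≫ T.last ≫ S.map a.inv) (by rw [Iso.symm_hom, Iso.hom_inv_id_assoc])
    refine ⟨A, (κ.equiv C A).symm (e₁.inv ≫ T.last ≫ S.map a.inv), X,
      G.preimageIso (e n (by omega) ≪≫ e₀).symm, hs.2 ?_, ?_⟩
    · rw [IsAngle, AddEquiv.apply_symm_apply]
      exact hX
    · apply G.map_injective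
      rw [NComplex.final, G.map_comp, G.map_comp, G.preimageIso_hom, G.map_preimage,
        Iso.symm_hom, Iso.trans_inv, Category.assoc, ← hr, reassoc_of% (he n (by omega)), w,
        Iso.inv_hom_id_assoc, Iso.inv_hom_id_assoc]

theorem exists_good_lift [IsIdempotentComplete 𝒞] (hΘ : IsAngulated S n Θ) (hn : 1 ≤ n) [HasFiniteBiproducts 𝒟]
    (hP : IsAdditiveSubcategory P) (hGP : ∀ d, P (G.obj d))
    (hPG : ∀ X, P X → ∃ d, Nonempty (G.obj d ≅ X)) {A C D : 𝒟} (ρ : Ext E D A) (c : C ⟶ D)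
    {X : NComplex n A C} {Y : NComplex n A D} (hX : κ.IsAngle Θ X (pull E c ρ))
    (hY : κ.IsAngle Θ Y ρ) :
    ∃ f : X.seq ⟶ Y.seq, NComplex.IsLift (X := X) (Y := Y) (𝟙 A) c f ∧
      ∃ M : NComplex n (X.seq.obj' 1) D, Nonempty (NComplex.Cone (X := X) (Y := Y) f M) ∧
        κ.IsAngle Θ M (push E X.first ρ) := by
  have h1 : push E (𝟙 A) (pull E c ρ) = pull E c ρ := by simp [push]
  obtain ⟨φ, h0, hn1, M, hM, m₀, m', b, hb0, hbj, hbn, hMl⟩ := hΘ.exists_cone_angle hn hX hY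
    (G.mapIso (X.left ≪≫ Iso.refl A ≪≫ Y.left.symm)) _ (last_comp (κ := κ) h1)
  obtain ⟨f, hf⟩ := exists_row_map_eq G φ.φ
  -- The ends lie in the image of `G` and the inner objects are biproducts of such objects, so the
  -- cone lifts to `𝒟`.
  have hMP : M.Within P := fun j hj => by
    rcases Nat.eq_zero_or_pos j with rfl | hj0
    · exact hP.of_iso ⟨m₀.symm⟩ (hGP _)
    rcases Nat.lt_or_ge n j with h | h
    · obtain rfl : j = n + 1 := by omega
      exact hP.of_iso ⟨m'.symm⟩ (hGP _)
    · exact hP.of_iso ⟨(b j hj0 h).symm⟩ (hP.biprod (hGP _) (hGP _))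
  have hδ : M.last ≫ S.map m₀.hom =
      (m' ≪≫ G.mapIso Y.right).hom ≫ κ.equiv D _ (push E X.first ρ) := by
    rw [κ.equiv_push]
    exact hMl.trans (map_last_comp G _ _ _ _ _ _)
  obtain ⟨N, e, he, hl, hr, hN⟩ := hΘ.exists_nComplex hn hPG hM hMP m₀ (m' ≪≫ G.mapIso Y.right)
    _ hδ
  refine ⟨f, isLift_of_map_eq (G := G) ((hf _ _).trans h0) ((hf _ _).trans hn1), N, ⟨?_⟩, hN⟩
  have hfn : G.map (app' f (n + 1) ≫ Y.right.hom) =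
      G.map (X.right.hom ≫ c ≫ Y.right.inv) ≫ G.map Y.right.hom := by
    rw [G.map_comp, hf, hn1]
  refine
    { e := fun j h1 hj => preimageBiprodIso G (e j (by omega)) (b j h1 hj)
      comm_first := fun _ => first_preimageBiprodIso hl (he 0 (by omega))
        G.map_neg (hf 1 (by omega)) hb0
      comm := fun j h1 hj => middle_preimageBiprodIso (he j (by omega))
        G.map_neg (hf (j + 1) (by omega)) (G.map_zero _ _) rfl (hbj j h1 hj)
      comm_final := fun _ => final_preimageBiprodIso hr (he n (by omega)) hfn
        (G.map_comp _ _) (comp_desc_of_comp hbn (G.map Y.right.hom)) }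

theorem exists_good_lift_op [IsIdempotentComplete 𝒞] (hΘ : IsAngulated S n Θ) (hn : 1 ≤ n)
    [HasFiniteBiproducts 𝒟] (hP : IsAdditiveSubcategory P) (hGP : ∀ d, P (G.obj d))
    (hPG : ∀ X, P X → ∃ d, Nonempty (G.obj d ≅ X)) {A B C : 𝒟} (ρ : Ext E C A) (a : A ⟶ B)
    {X : NComplex n A C} {Y : NComplex n B C} (hX : κ.IsAngle Θ X ρ)
    (hY : κ.IsAngle Θ Y (push E a ρ)) :
    ∃ f : X.seq ⟶ Y.seq, NComplex.IsLift (X := X) (Y := Y) a (𝟙 C) f ∧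
      ∃ N : NComplex n A (Y.seq.obj' n), Nonempty (NComplex.Cocone (X := X) (Y := Y) f N) ∧
        κ.IsAngle Θ N (pull E Y.final ρ) := by
  have h1 : push E a ρ = pull E (𝟙 C) (push E a ρ) := by simp [pull]
  obtain ⟨φ, h0, hn1, M, hM, m₀, m', b, hb0, hbj, hbn, hMl⟩ := hΘ.exists_cocone_angle hn hX hY
    _ (G.mapIso (X.right ≪≫ Iso.refl C ≪≫ Y.right.symm)) (last_comp (κ := κ) h1)
  obtain ⟨f, hf⟩ := exists_row_map_eq G φ.φ
  have hMP : M.Within P := fun j hj => by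
    rcases Nat.eq_zero_or_pos j with rfl | hj0
    · exact hP.of_iso ⟨m₀.symm⟩ (hGP _)
    rcases Nat.lt_or_ge n j with h | h
    · obtain rfl : j = n + 1 := by omega
      exact hP.of_iso ⟨m'.symm⟩ (hGP _)
    · exact hP.of_iso ⟨(b (j - 1) j (by omega) h).symm⟩ (hP.biprod (hGP _) (hGP _))
  have hδ : M.last ≫ S.map (m₀ ≪≫ G.mapIso X.left).hom =
      m'.hom ≫ κ.equiv _ A (pull E Y.final ρ) := by
    rw [κ.equiv_pull]
    exact map_final_comp G hMl
  obtain ⟨N, e, he, hl, hr, hN⟩ := hΘ.exists_nComplex hn hPG hM hMP (m₀ ≪≫ G.mapIso X.left) m'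
    _ hδ
  refine ⟨f, isLift_of_map_eq (G := G) ((hf _ _).trans h0) ((hf _ _).trans hn1), N, ⟨?_⟩, hN⟩
  have hf0 : G.map (X.left.inv ≫ app' f 0) =
      G.map X.left.inv ≫ G.map (X.left.hom ≫ a ≫ Y.left.inv) := by
    rw [G.map_comp, hf, h0]
  refine
    { e := fun i j hij hj => preimageBiprodIso G (e j (by omega)) (b i j hij hj)
      comm_first := fun _ => first_preimageBiprodIso hl (he 0 (by omega)) hf0
        (G.map_comp _ _) (hb0.trans (lift_map_comp G _ X.left _ _))
      comm := fun i j k hij hjk hk => ?_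
      comm_final := fun i hi => final_preimageBiprodIso hr (he n (by omega))
        G.map_neg (hf n (by omega)) (hbn i hi) }
  subst hjk
  exact middle_preimageBiprodIso (he j (by omega)) G.map_neg (G.map_zero _ _)
    (hf j (by omega)) rfl (hbj i j (j + 1) hij rfl hk)

/-- The angles with objects in an extension closed subcategory define an `n`-exangulated
structure on any category equivalent to it. -/
theorem exists_isExangulated [IsIdempotentComplete 𝒞] [HasFiniteBiproducts 𝒟] (κ : ExtIso G S E)
    (hΘ : IsAngulated S n Θ) (hn : 1 ≤ n) (hP : IsAdditiveSubcategory P)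
    (hext : IsExtensionClosed Θ P) (hGP : ∀ d, P (G.obj d))
    (hPG : ∀ X, P X → ∃ d, Nonempty (G.obj d ≅ X)) :
    ∃ s : Realization E n, (∀ (A C : 𝒟) (δ : Ext E C A) (X : NComplex n A C),
      κ.IsAngle Θ X δ → s.Distinguished X δ) ∧ IsExangulated E s := by
  have := hΘ.additive
  have hex : ∀ (A C : 𝒟) (δ : Ext E C A), ∃ X : NComplex n A C, κ.IsAngle Θ X δ :=
    fun A C δ => κ.exists_isAngle hΘ hn hGP hPG hext δ
  obtain ⟨s, hs⟩ : ∃ s : Realization E n, ∀ {A C : 𝒟} {X : NComplex n A C} {δ : Ext E C A},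
      s.Distinguished X δ ↔ κ.IsAngle Θ X δ :=
    ⟨κ.realization hex, distinguished_realization_iff hΘ hn hex⟩
  refine ⟨s, fun A C δ X => hs.2, ?_⟩
  refine
    { hasFiniteBiproducts := inferInstance
      additive_fst := κ.additive_fst
      additive_snd := κ.additive_snd
      isExact :=
        { exists_lift := fun A C A' C' δ δ' a c h X Y hX hY =>
            (hs.1 hX).exists_isLift hΘ hn (hs.1 hY) h
          isExangle := fun A C δ X hX => (hs.1 hX).isExangle hΘ hn
          zero_right := fun A Z hZ X hi hz => hs.2 ?_
          zero_left := fun A Z hZ X hi hz => hs.2 ?_ }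
      inflation_comp := fun A B C f g hf hg => ?_
      deflation_comp := fun A B C f g hf hg => ?_
      good_lift := fun A C D ρ c X Y hX hY => ?_
      good_lift_op := fun A B C ρ a X Y hX hY => ?_ }
  · refine hΘ.trivial_mem _ ⟨?_, fun i hi h2 => G.map_isZero (hz i hi h2)⟩
    change IsIso (G.map (X.seq.map' 0 1))
    infer_instance
  · have hZ0 : IsZero (X.seq.obj' 0) := hZ.of_iso X.left
    -- `0 ⟶ ⋯ ⟶ 0 ⟶ A ⟶ A` is a disc in positions `n` and `n + 1`.
    refine SigmaSeq.IsDisc.mem (i := n) (hi := le_rfl) hΘ ⟨?_, fun i hi h1 h2 =>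
      G.map_isZero (hz i (by omega))⟩
    change IsIso (G.map (X.seq.map' n (n + 1)))
    infer_instance
  · rw [isInflation_iff hΘ hn hGP hPG hs] at hf hg ⊢
    rw [G.map_comp]
    exact hΘ.isFirstArrow_comp hn hP hext hf hg
  · rw [isDeflation_iff hΘ hn hGP hPG hs] at hf hg ⊢
    rw [G.map_comp]
    exact hΘ.isFinalArrow_comp hn hP hext hf hg
  · obtain ⟨f, hf, M, hM, hMd⟩ := exists_good_lift hΘ hn hP hGP hPG ρ c (hs.1 hX) (hs.1 hY)
    exact ⟨f, hf, M, hM, hs.2 hMd⟩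
  · obtain ⟨f, hf, N, hN, hNd⟩ := exists_good_lift_op hΘ hn hP hGP hPG ρ a (hs.1 hX) (hs.1 hY)
    exact ⟨f, hf, N, hN, hs.2 hNd⟩

end ExtIso

/-! ### Comparison with the idempotent completion -/

section ExtIsoOfIso

variable {𝒞 : Type u} [Category.{v} 𝒞] [Preadditive 𝒞] {𝒟 : Type u'} [Category.{v'} 𝒟]
  [Preadditive 𝒟] {ℬ : Type*} [Category.{v} ℬ] [Preadditive ℬ]
  {G : 𝒟 ⥤ 𝒞} {F : 𝒟 ⥤ ℬ} {S : 𝒞 ⥤ 𝒞} {S' : ℬ ⥤ ℬ} (J : 𝒞 ⥤ ℬ) [J.Full] [J.Faithful] [J.Additive]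
  (η : G ⋙ J ≅ F) (σ : J ⋙ S' ≅ S ⋙ J)

theorem preimage_comp_map {A A' C : 𝒟} (a : A ⟶ A') (δ : F.obj C ⟶ S'.obj (F.obj A)) :
    J.preimage (η.hom.app C ≫ (δ ≫ S'.map (F.map a)) ≫ S'.map (η.inv.app A') ≫
      σ.hom.app (G.obj A')) = J.preimage (η.hom.app C ≫ δ ≫ S'.map (η.inv.app A) ≫
        σ.hom.app (G.obj A)) ≫ S.map (G.map a) := J.map_injective (by
  have h1 := η.inv.naturality a
  have h2 := σ.hom.naturality (G.map a)
  dsimp only [Functor.comp_obj, Functor.comp_map] at h1 h2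
  rw [J.map_comp, J.map_preimage, J.map_preimage]
  simp only [Category.assoc]
  rw [← h2, ← S'.map_comp_assoc, h1, S'.map_comp, Category.assoc])

theorem preimage_map_comp {A C C' : 𝒟} (c : C' ⟶ C) (δ : F.obj C ⟶ S'.obj (F.obj A)) :
    J.preimage (η.hom.app C' ≫ (F.map c ≫ δ) ≫ S'.map (η.inv.app A) ≫ σ.hom.app (G.obj A)) =
      G.map c ≫ J.preimage (η.hom.app C ≫ δ ≫ S'.map (η.inv.app A) ≫ σ.hom.app (G.obj A)) :=
  J.map_injective (by
    have h1 := η.hom.naturality c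
    dsimp only [Functor.comp_obj, Functor.comp_map] at h1
    rw [J.map_comp, J.map_preimage, J.map_preimage, reassoc_of% h1, Category.assoc])

/-- A fully faithful functor `J` commuting with the suspensions identifies
`ℬ(F C, S' (F A))` with `𝒞(G C, S (G A))` whenever `F ≅ G ⋙ J`. -/
def ExtIso.ofIso : ExtIso G S (homBifunctor F S') where
  equiv C A :=
    { toFun := fun δ : F.obj C ⟶ S'.obj (F.obj A) => J.preimage
        (η.hom.app C ≫ δ ≫ S'.map (η.inv.app A) ≫ σ.hom.app (G.obj A))
      invFun := fun f => (η.inv.app C ≫ J.map f ≫ σ.inv.app (G.obj A) ≫ S'.map (η.hom.app A) :)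
      left_inv := fun δ : F.obj C ⟶ S'.obj (F.obj A) => by
        change η.inv.app C ≫ J.map (J.preimage (η.hom.app C ≫ δ ≫ S'.map (η.inv.app A) ≫
          σ.hom.app (G.obj A))) ≫ σ.inv.app (G.obj A) ≫ S'.map (η.hom.app A) = δ
        rw [J.map_preimage]
        simp [← S'.map_comp]
      right_inv := fun f => J.map_injective (by
        rw [J.map_preimage]
        simp [← S'.map_comp_assoc])
      map_add' := fun δ δ' : F.obj C ⟶ S'.obj (F.obj A) => J.map_injective (by
        change J.map (J.preimage (η.hom.app C ≫ (δ + δ') ≫ _)) = J.map (J.preimage _ + J.preimage _)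
        rw [J.map_add, J.map_preimage, J.map_preimage, J.map_preimage, Preadditive.add_comp,
          Preadditive.comp_add]) }
  equiv_map _ _ _ a δ := preimage_comp_map J η σ a δ
  equiv_app _ _ _ c δ := preimage_map_comp J η σ c δ

theorem ExtIso.map_ofIso {A C : 𝒟} (δ : F.obj C ⟶ S'.obj (F.obj A)) :
    J.map ((ExtIso.ofIso J η σ).equiv C A δ) =
      η.hom.app C ≫ δ ≫ S'.map (η.inv.app A) ≫ σ.hom.app (G.obj A) :=
  J.map_preimage _

theorem ExtIso.map_last_ofIso {A C X₀ X₁ : 𝒟} (δ : F.obj C ⟶ S'.obj (F.obj A)) (r : X₁ ⟶ C)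
    (l : A ⟶ X₀) :
    (J.map (G.map r ≫ (ExtIso.ofIso J η σ).equiv C A δ ≫ S.map (G.map l)) ≫
      σ.inv.app (G.obj X₀)) ≫ S'.map (η.hom.app X₀) =
        η.hom.app X₁ ≫ F.map r ≫ δ ≫ S'.map (F.map l) := by
  have h1 := η.hom.naturality r
  have h2 := σ.inv.naturality (G.map l)
  have h3 := η.hom.naturality l
  dsimp only [Functor.comp_obj, Functor.comp_map] at h1 h2 h3
  rw [J.map_comp, J.map_comp, ExtIso.map_ofIso]
  simp only [Category.assoc]
  rw [reassoc_of% h1, reassoc_of% h2, ← S'.map_comp, h3, Iso.hom_inv_id_app_assoc,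
    ← S'.map_comp, Iso.inv_hom_id_app_assoc]

end ExtIsoOfIso

section KaroubiMap

variable {𝒞 : Type u} [Category.{v} 𝒞] {𝒟 : Type u'} [Category.{v'} 𝒟] (F : 𝒟 ⥤ 𝒞)

instance [F.Faithful] : (karoubiMap F).Faithful where
  map_injective h := Karoubi.hom_ext _ _ (F.map_injective (congrArg Karoubi.Hom.f h))

instance [F.Full] [F.Faithful] : (karoubiMap F).Full where
  map_surjective f := by
    obtain ⟨g, hg⟩ := F.map_surjective f.f
    refine ⟨⟨g, F.map_injective ?_⟩, Karoubi.hom_ext _ _ hg⟩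
    rw [F.map_comp, F.map_comp, hg]
    exact f.comm

instance [Preadditive 𝒞] [Preadditive 𝒟] [F.Additive] : (karoubiMap F).Additive where
  map_add {_ _ f g} := Karoubi.hom_ext _ _ (F.map_add (f := f.f) (g := g.f))

/-- The induced functor on idempotent completions extends `F`. -/
def toKaroubiCompKaroubiMap : toKaroubi 𝒟 ⋙ karoubiMap F ≅ F ⋙ toKaroubi 𝒞 :=
  (functorExtension₂CompWhiskeringLeftToKaroubiIso 𝒟 𝒞).app F

end KaroubiMap

section Completion

variable {𝒞 : Type u} [Category.{v} 𝒞] {S : 𝒞 ⥤ 𝒞} {n : ℕ}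

theorem SigmaSeq.toKaroubi_last (U : SigmaSeq S n) : U.toKaroubi.last =
    (Idempotents.toKaroubi 𝒞).map U.last ≫ (toKaroubiCompKaroubiMap S).inv.app (U.seq.obj' 0) :=
  Karoubi.hom_ext _ _ (Category.comp_id U.last).symm

/-- Morphisms between the images of sequences in the idempotent completion. -/
theorem SigmaSeq.exists_of_toKaroubi_hom {A B : SigmaSeq S n} (h : A.toKaroubi ⟶ B.toKaroubi) :
    ∃ f : A ⟶ B, ∀ (j : ℕ) (hj : j ≤ n + 1), (Idempotents.toKaroubi 𝒞).map (app' f.φ j hj) = app' h.φ j hj := by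
  obtain ⟨φ, hφ⟩ := exists_row_map_eq (Idempotents.toKaroubi 𝒞) (X := A.seq) (Y := B.seq) h.φ
  have hφ' : ∀ (j : ℕ) (hj : j ≤ n + 1), app' φ j hj = (app' h.φ j hj).f := fun j hj =>
    congrArg Karoubi.Hom.f (hφ j hj)
  refine ⟨⟨φ, ?_⟩, hφ⟩
  have := congrArg Karoubi.Hom.f h.comm
  rw [hφ', hφ']
  exact this

variable [Preadditive 𝒞]

/-- The image of a sequence in the idempotent completion is a direct summand of a sequence
in `Θ` only if the sequence is in `Θ`. -/
theorem IsAngulated.mem_of_toKaroubi_mem [HasFiniteBiproducts 𝒞] [IsIdempotentComplete 𝒞]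
    {Θ : Set (SigmaSeq S n)} (hΘ : IsAngulated S n Θ) {U : SigmaSeq S n}
    {V : SigmaSeq (karoubiMap S) n} (hV : V ∈ completedAngles Θ) (e : U.toKaroubi ≅ V) :
    U ∈ Θ := by
  -- Only the retraction matters: it descends to `𝒞` by full faithfulness, and there
  -- `mem_of_retract` applies.
  obtain ⟨T', W, hW, i, -, p, -, hip, -⟩ := hV
  obtain ⟨f, hf⟩ := SigmaSeq.exists_of_toKaroubi_hom (e.hom ≫ i)
  obtain ⟨g, hg⟩ := SigmaSeq.exists_of_toKaroubi_hom (p ≫ e.inv)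
  refine hΘ.mem_of_retract hW f g (row_ext fun j hj => (Idempotents.toKaroubi 𝒞).map_injective ?_)
  have h : (e.hom ≫ i) ≫ p ≫ e.inv = 𝟙 _ := by
    rw [Category.assoc, reassoc_of% hip, Iso.hom_inv_id]
  have h' : app' (e.hom ≫ i).φ j hj ≫ app' (p ≫ e.inv).φ j hj = 𝟙 _ :=
    congrArg (fun t => app' (SigmaSeq.Hom.φ t) j hj) h
  rw [← hf, ← hg] at h'
  exact ((Idempotents.toKaroubi 𝒞).map_comp _ _).trans
    (h'.trans ((Idempotents.toKaroubi 𝒞).map_id _).symm)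

theorem mem_completedAngles [S.Additive] [HasFiniteBiproducts 𝒞] {Θ : Set (SigmaSeq S n)}
    {U : SigmaSeq S n} {V : SigmaSeq (karoubiMap S) n} (hU : U ∈ Θ) (e : U.toKaroubi ≅ V) :
    V ∈ completedAngles Θ := by
  have : HasZeroObject (Karoubi 𝒞) := hasZeroObject_of_hasFiniteBiproducts _
  -- A sequence isomorphic to the image of an angle is a direct summand of it with zero complement.
  let Z : SigmaSeq (karoubiMap S) n := ⟨(Functor.const _).obj 0, 0⟩
  have hZ : ∀ (j : ℕ) (hj : j ≤ n + 1), IsZero (Z.seq.obj' j) := fun j hj => isZero_zero _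
  have h0 : ∀ A B : SigmaSeq (karoubiMap S) n,
      A.last ≫ (karoubiMap S).map (app' (0 : A.seq ⟶ B.seq) 0) =
        app' (0 : A.seq ⟶ B.seq) (n + 1) ≫ B.last := fun A B => by
    change A.last ≫ (karoubiMap S).map 0 = 0 ≫ B.last
    rw [Functor.map_zero, comp_zero, zero_comp]
  refine ⟨Z, U, hU, e.inv, ⟨0, h0 _ _⟩, e.hom, ⟨0, h0 _ _⟩, e.inv_hom_id,
    SigmaSeq.hom_ext (row_ext fun j hj => (hZ j hj).eq_of_src _ _), comp_zero, zero_comp, ?_⟩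
  rw [comp_zero, add_zero]
  exact congrArg SigmaSeq.Hom.φ e.hom_inv_id

end Completion

section Subcategory

variable {𝒞 : Type u} [Category.{v} 𝒞] [Preadditive 𝒞] [HasFiniteBiproducts 𝒞]
  [IsIdempotentComplete 𝒞] (P : ObjectProperty 𝒞)

/-- The idempotent completion of a full subcategory, as a full subcategory of `𝒞`. -/
def splitting : Karoubi P.FullSubcategory ⥤ 𝒞 :=
  karoubiMap P.ι ⋙ (toKaroubiEquivalence 𝒞).inverse

instance : (splitting P).Full := by
  unfold splitting; infer_instance

instance : (splitting P).Faithful := by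
  unfold splitting; infer_instance

instance : (splitting P).Additive := by
  unfold splitting; infer_instance

/-- The image of `splitting P` in the idempotent completion of `𝒞`. -/
def splittingCompToKaroubi : splitting P ⋙ toKaroubi 𝒞 ≅ karoubiMap P.ι :=
  Functor.isoWhiskerLeft (karoubiMap P.ι) (toKaroubiEquivalence 𝒞).counitIso

theorem prop_splitting {P : ObjectProperty 𝒞} (hP : IsAdditiveSubcategory P)
    (d : Karoubi P.FullSubcategory) : P ((splitting P).obj d) := by
  -- In the completion of `𝒞`, the object `d` is a retract of its underlying object; this retraction
  -- is transported back to `𝒞`.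
  let e : (Idempotents.toKaroubi 𝒞).obj ((splitting P).obj d) ≅ (karoubiMap P.ι).obj d :=
    (splittingCompToKaroubi P).app d
  obtain ⟨i, hi⟩ := (Idempotents.toKaroubi 𝒞).map_surjective
    (e.hom ≫ Karoubi.decompId_i ((karoubiMap P.ι).obj d))
  obtain ⟨p, hp⟩ := (Idempotents.toKaroubi 𝒞).map_surjective
    (Karoubi.decompId_p ((karoubiMap P.ι).obj d) ≫ e.inv)
  refine hP.retract i p ((Idempotents.toKaroubi 𝒞).map_injective ?_) d.X.property
  rw [Functor.map_comp, hi, hp, Category.assoc, ← Category.assoc (Karoubi.decompId_i _),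
    ← Karoubi.decompId, Category.id_comp, Iso.hom_inv_id, CategoryTheory.Functor.map_id]

theorem exists_splitting_iso {P : ObjectProperty 𝒞} (X : 𝒞) (hX : P X) :
    ∃ d, Nonempty ((splitting P).obj d ≅ X) :=
  ⟨(toKaroubi _).obj ⟨X, hX⟩, ⟨(Idempotents.toKaroubi 𝒞).preimageIso
    ((splittingCompToKaroubi P).app _ ≪≫ (toKaroubiCompKaroubiMap P.ι).app ⟨X, hX⟩)⟩⟩

variable {S : 𝒞 ⥤ 𝒞} {n : ℕ}

/-- The extensions in the completed subcategory, in terms of the suspension of `𝒞`. -/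
def completedExtIso (S : 𝒞 ⥤ 𝒞) : ExtIso (splitting P) S (completedExt S P) :=
  ExtIso.ofIso (F := karoubiMap P.ι) (S' := karoubiMap S) (Idempotents.toKaroubi 𝒞)
    (splittingCompToKaroubi P) (toKaroubiCompKaroubiMap S)

variable {P}

/-- The sequence in the idempotent completion given by an extension comes from `𝒞`. -/
def toSigmaSeqIso {A C : Karoubi P.FullSubcategory} (X : NComplex n A C)
    (δ : Ext (completedExt S P) C A) :
    (X.toSigmaSeq (splitting P) S ((completedExtIso P S).equiv C A δ)).toKaroubi ≅
      X.toSigmaSeq (karoubiMap P.ι) (karoubiMap S) δ :=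
  SigmaSeq.isoMk (Functor.isoWhiskerLeft X.seq (splittingCompToKaroubi P)) (by
    rw [SigmaSeq.toKaroubi_last]
    exact ExtIso.map_last_ofIso (F := karoubiMap P.ι) (S' := karoubiMap S) (Idempotents.toKaroubi 𝒞) (splittingCompToKaroubi P)
      (toKaroubiCompKaroubiMap S) δ X.right.hom X.left.inv)

/-- As `𝒞` is idempotent complete, taking summands in the completion creates no new angles up to
isomorphism. -/
theorem isCompletedAngle_iff {Θ : Set (SigmaSeq S n)} (hΘ : IsAngulated S n Θ)
    {A C : Karoubi P.FullSubcategory} {X : NComplex n A C} {δ : Ext (completedExt S P) C A} :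
    IsCompletedAngle Θ P X δ ↔ (completedExtIso P S).IsAngle Θ X δ := by
  have := hΘ.additive
  exact ⟨fun h => hΘ.mem_of_toKaroubi_mem h (toSigmaSeqIso X δ),
    fun h => mem_completedAngles h (toSigmaSeqIso X δ)⟩

end Subcategory

section HasFiniteBiproducts

variable {𝒞 : Type u} [Category.{v} 𝒞] [Preadditive 𝒞] [HasFiniteBiproducts 𝒞]

/-- Finite biproducts pass from here to the idempotent completion of the subcategory. -/
theorem IsAdditiveSubcategory.hasFiniteBiproducts {P : ObjectProperty 𝒞}
    (hP : IsAdditiveSubcategory P) : HasFiniteBiproducts P.FullSubcategory := by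
  have hz : HasZeroObject 𝒞 := hasZeroObject_of_hasFiniteBiproducts 𝒞
  have : HasZeroObject P.FullSubcategory := by
    refine ⟨⟨(0 : 𝒞), hP.of_isZero (isZero_zero 𝒞)⟩, ?_⟩
    rw [IsZero.iff_id_eq_zero]
    exact P.ι.map_injective ((isZero_zero 𝒞).eq_of_src _ _)
  have : HasBinaryBiproducts P.FullSubcategory := ⟨fun X Y => by
    let b : BinaryBicone X Y :=
      { pt := ⟨X.obj ⊞ Y.obj, hP.biprod X.property Y.property⟩
        fst := P.homMk biprod.fst
        snd := P.homMk biprod.snd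
        inl := P.homMk biprod.inl
        inr := P.homMk biprod.inr
        inl_fst := P.ι.map_injective biprod.inl_fst
        inl_snd := P.ι.map_injective biprod.inl_snd
        inr_fst := P.ι.map_injective biprod.inr_fst
        inr_snd := P.ι.map_injective biprod.inr_snd }
    exact hasBinaryBiproduct_of_total b (P.ι.map_injective biprod.total)⟩
  have := hasBinaryProducts_of_hasBinaryBiproducts (C := P.FullSubcategory)
  have := hasFiniteProducts_of_has_binary_and_terminal (C := P.FullSubcategory)
  exact HasFiniteBiproducts.of_hasFiniteProducts

end HasFiniteBiproducts

end HigherAngulated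

end

open HigherAngulated in
theorem theorem3p12 {𝒞 : Type u} [Category.{v} 𝒞] [Preadditive 𝒞] [HasFiniteBiproducts 𝒞]
    (n : ℕ) (hn : 1 ≤ n) (S : 𝒞 ⥤ 𝒞) (Θ : Set (SigmaSeq S n)) (hΘ : IsAngulated S n Θ)
    (hKS : IsKrullSchmidt 𝒞) (P : ObjectProperty 𝒞) (hP : IsAdditiveSubcategory P)
    (hext : IsExtensionClosed Θ P) :
    (∀ (A C : Karoubi P.FullSubcategory) (δ : Ext (completedExt S P) C A),
      ∃ X : NComplex n A C, IsCompletedAngle Θ P X δ) ∧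
    ∃ s : Realization (completedExt S P) n,
      (∀ (A C : Karoubi P.FullSubcategory) (δ : Ext (completedExt S P) C A)
        (X : NComplex n A C), IsCompletedAngle Θ P X δ → s.Distinguished X δ) ∧
      IsExangulated (completedExt S P) s := by
  -- With idempotents split, both claims follow from the results for `ExtIso`, applied to `splitting
  -- P`.
  have := hKS.isIdempotentComplete
  have := hP.hasFiniteBiproducts
  have hGP := prop_splitting hP
  have hPG := exists_splitting_iso (P := P)
  refine ⟨fun A C δ => ?_, ?_⟩
  · obtain ⟨X, hX⟩ := (completedExtIso P S).exists_isAngle hΘ hn hGP hPG hext δ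
    exact ⟨X, (isCompletedAngle_iff hΘ).2 hX⟩
  · obtain ⟨s, hs, h⟩ := (completedExtIso P S).exists_isExangulated hΘ hn hP hext hGP hPG
    exact ⟨s, fun A C δ X hX => hs A C δ X ((isCompletedAngle_iff hΘ).1 hX), h⟩
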